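/- Let $r,t$ be fixed positive integers and let $(\mathcal A,\tau)$ be a noncommutative probability space (a unital complex $*$-algebra with a linear functional $\tau$ such that $\tau(1)=1$). The noncommutative distribution of a family $b=(b_i)$ in $(\mathcal A,\tau)$ is the map $P\mapsto\tau(P(b,b^*))$ on noncommutative polynomials; convergence in distribution is pointwise convergence of these maps. Let $x=(x_1,\dots,x_r)$ be a semicircular system in $(\mathcal A,\tau)$ (that is, $x_i=x_i^*$, the $x_i$ are free, and $\tau(x_i^k)=\frac1{2\pi}\int_{-2}^2 s^k\sqrt{4-s^2}\,ds$ for all $k\in\mathbb N$), and let $a=(a_1,\dots,a_t)$ be a tuple in $\mathcal A$ such that $x$ is free from $a$. For each $n$ let $A_n^{(1)},\dots,A_n^{(t)}$ be deterministic Hermitian $n\times n$ matrices with $\max_u\sup_n\|A_n^{(u)}\|<\infty$ (spectral norm), and suppose that $(A_n^{(1)},\dots,A_n^{(t)})$ in $(M_n(\mathbb C),\frac1n\mathrm{Tr})$ converges in distribution to $(a_1,\dots,a_t)$ as $n\to\infty$. Let $X_n^{(v)}=[X^{(v)}_{ij}]_{i,j=1}^n$, $v=1,\dots,r$, be independent random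 Hermitian matrices, the $n\times n$ corners of infinite Hermitian arrays, such that for each $v$ the complex random variables $X^{(v)}_{ij}$, $1\le i\le j$, are independent and centred with $\mathbb E|X^{(v)}_{ij}|^2=1$ (the real and imaginary parts of an entry need not be independent and the entries need not be identically distributed). Suppose that for each $v$: 1. there are a constant $K_v$, a random variable $Z^{(v)}$ with $\mathbb E|Z^{(v)}|^4<\infty$, a real $x_0>0$ and an integer $n_0>0$ such that for all real $x>x_0$ and all integers $n>n_0$, $$\frac1{n^2}\sum_{1\le i,j\le n}\mathbb P\bigl(|X^{(v)}_{ij}|>x\bigr)\le K_v\,\mathbb P\bigl(|Z^{(v)}|>x\bigr);$$ 2. $\sup_{1\le i<j}\mathbb E\bigl(|X^{(v)}_{ij}|^3\bigr)<\infty$. Then, almost surely, $\Bigl(\frac{X_n^{(1)}}{\sqrt n},\dots,\frac{X_n^{(r)}}{\sqrt n},A_n^{(1)},\dots,A_n^{(t)}\Bigr)$ in $(M_n(\mathbb C),\frac1n\mathrm{Tr})$ converges in distribution to $(x_1,\dots,x_r,a_1,\dots,a_t)$ as $n\to\infty$. -/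

import Mathlib

open MeasureTheory ProbabilityTheory Filter Topology

noncomputable section

namespace NCProb

section Algebraic

variable {A : Type*} [Ring A] [StarRing A] [Algebra ℂ A]

/-- Evaluation `P ↦ P(a, a*)` of the noncommutative polynomials in the indeterminates
`ι ⊕ ι`: the indeterminate `inl i` becomes `a i` and `inr i` becomes `(a i)*`. -/
def polyEval {ι : Type*} (a : ι → A) : FreeAlgebra ℂ (ι ⊕ ι) →ₐ[ℂ] A :=
  FreeAlgebra.lift ℂ (Sum.elim a (fun i => star (a i)))

/-- The noncommutative distribution `P ↦ τ (P(a, a*))` of a family `a`. -/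
def ncDistribution {ι : Type*} (τ : A →ₗ[ℂ] ℂ) (a : ι → A) :
    FreeAlgebra ℂ (ι ⊕ ι) →ₗ[ℂ] ℂ :=
  τ ∘ₗ (polyEval a).toLinearMap

/-- Freeness, with respect to `τ`, of a family of sets `S i` of noncommutative random variables.
The elements of `StarAlgebra.adjoin ℂ (S i)` are the noncommutative polynomials in
the elements of `S i` and their adjoints. The products have `k + 1 ≥ 1` factors. -/
def IsFree [StarModule ℂ A] {ι : Type*} (τ : A →ₗ[ℂ] ℂ) (S : ι → Set A) : Prop :=
  ∀ (k : ℕ) (i : Fin (k + 1) → ι) (p : Fin (k + 1) → A),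
    (∀ l : Fin k, i l.castSucc ≠ i l.succ) →
    (∀ l, p l ∈ StarAlgebra.adjoin ℂ (S (i l))) →
    (∀ l, τ (p l) = 0) →
    τ (List.ofFn p).prod = 0

end Algebraic

/-- Convergence in distribution of the families `a n` in `(𝓐 n, τ n)` towards the
family `b` in `(B, σ)`: pointwise convergence of the noncommutative distributions. -/
def ConvergesInDistribution {ι : Type*} {𝓐 : ℕ → Type*} [∀ n, Ring (𝓐 n)]
    [∀ n, StarRing (𝓐 n)] [∀ n, Algebra ℂ (𝓐 n)] (τ : ∀ n, 𝓐 n →ₗ[ℂ] ℂ) (a : ∀ n, ι → 𝓐 n)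
    {B : Type*} [Ring B] [StarRing B] [Algebra ℂ B] (σ : B →ₗ[ℂ] ℂ) (b : ι → B) : Prop :=
  ∀ P : FreeAlgebra ℂ (ι ⊕ ι),
    Tendsto (fun n => ncDistribution (τ n) (a n) P) atTop (𝓝 (ncDistribution σ b P))

/-- The standard semicircular distribution, of density `(2π)⁻¹ √(4 - t²)` on `[-2, 2]`. -/
def semicircleMeasure : Measure ℝ :=
  volume.withDensity fun t =>
    ENNReal.ofReal ((Set.Icc (-2 : ℝ) 2).indicator
      (fun s => 1 / (2 * Real.pi) * Real.sqrt (4 - s ^ 2)) t)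

/-- `x` is a semicircular system in `(A, τ)`. -/
structure IsSemicircularSystem {A : Type*} [Ring A] [StarRing A] [Algebra ℂ A]
    [StarModule ℂ A] {ι : Type*} (τ : A →ₗ[ℂ] ℂ) (x : ι → A) : Prop where
  selfAdjoint : ∀ i, star (x i) = x i
  free : IsFree τ (fun i => ({x i} : Set A))
  moments : ∀ (i : ι) (k : ℕ), τ (x i ^ k) = ((∫ t : ℝ, t ^ k ∂semicircleMeasure : ℝ) : ℂ)

/-- The normalized trace `n⁻¹ Tr` on `n × n` matrices. -/
def normalizedTrace (n : ℕ) : Matrix (Fin n) (Fin n) ℂ →ₗ[ℂ] ℂ :=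
  ((n : ℂ)⁻¹) • Matrix.traceLinearMap (Fin n) ℂ ℂ

/-- The spectral norm of a matrix: its operator norm on the Euclidean space `ℂⁿ`. -/
def matrixSpectralNorm {n : ℕ} (M : Matrix (Fin n) (Fin n) ℂ) : ℝ :=
  ‖Matrix.toEuclideanCLM (n := Fin n) (𝕜 := ℂ) M‖

section Wigner

variable {Ω : Type*} [MeasurableSpace Ω]

/-- A family, indexed by `V`, of independent infinite Hermitian arrays of complex
random variables; the entries on and above the diagonal are independent (jointly over the
arrays), centred, and satisfy `𝔼 |X i j|² = 1`. No relation between the real and the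
imaginary part of an entry is imposed. -/
structure IsWignerFamily {V : Type*} (μ : Measure Ω) (X : V → ℕ → ℕ → Ω → ℂ) : Prop where
  measurable : ∀ v i j, Measurable (X v i j)
  hermitian : ∀ v i j ω, X v j i ω = star (X v i j ω)
  indep : iIndepFun (fun (q : {q : V × ℕ × ℕ // q.2.1 ≤ q.2.2}) => X q.1.1 q.1.2.1 q.1.2.2) μ
  memLp : ∀ v i j, MemLp (X v i j) 2 μ
  centred : ∀ v i j, ∫ ω, X v i j ω ∂μ = 0
  variance : ∀ v i j, ∫ ω, ‖X v i j ω‖ ^ 2 ∂μ = 1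

/-- The tails of the entries of the array are dominated, on average over the `n × n` corner, by
the tail of a real random variable (given by its law `ζ`) with finite fourth moment. -/
def HasDominatedTails (μ : Measure Ω) (Y : ℕ → ℕ → Ω → ℂ) : Prop :=
  ∃ (K : ℝ) (ζ : Measure ℝ), IsProbabilityMeasure ζ ∧ ∫⁻ z, ‖z‖ₑ ^ 4 ∂ζ < ⊤ ∧
    ∃ x₀ : ℝ, 0 < x₀ ∧ ∃ n₀ : ℕ, 0 < n₀ ∧ ∀ x : ℝ, x₀ < x → ∀ n : ℕ, n₀ < n →
      1 / (n : ℝ) ^ 2 * ∑ i : Fin n, ∑ j : Fin n, μ.real {ω | x < ‖Y i j ω‖}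
        ≤ K * ζ.real {z | x < |z|}

/-- The third absolute moments of the entries above the diagonal are bounded. -/
def HasBoundedThirdMoments (μ : Measure Ω) (Y : ℕ → ℕ → Ω → ℂ) : Prop :=
  ∃ θ : NNReal, ∀ i j : ℕ, i < j → ∫⁻ ω, ‖Y i j ω‖ₑ ^ 3 ∂μ ≤ θ

/-- The `n × n` corner of a realization of an infinite array. -/
def corner (Y : ℕ → ℕ → Ω → ℂ) (n : ℕ) (ω : Ω) : Matrix (Fin n) (Fin n) ℂ :=
  Matrix.of fun i j => Y i j ω

end Wigner

end NCProb

end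

/-!
The entries of the Wigner matrices have too few moments for the method of moments, so they are
truncated at the level `√n`. The tail condition, summed over dyadic sizes, gives by Borel–Cantelli
that almost surely this changes only finitely many corners
(`HasDominatedTails.ae_eventually_norm_le`). The truncated entries are then centred; the matrices
of their means have bounded Hilbert–Schmidt norm, hence tend to zero in spectral norm after
normalization (`matrixSpectralNorm_truncMean_le`), and are treated as additional deterministic
letters with limit `0`. It remains to study words in Hermitian matrices with independent, centred
entries bounded by a constant, of variance about `1 / n` and third absolute moment `O(n ^ (-3/2))`
off the diagonal (`Ensemble`), and in deterministic matrices of bounded absolute moments.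

Everything rests on the effect of a single entry (and its conjugate) on a word. It is a polynomial
in the entry, with coefficients that are products of entries, in the two rows and columns
concerned, of words in the other entries: the *local size* bounds these. Taking out one factor of
`Tr X ^ (2k + 2)` and expanding the rest in that entry bounds even moments by induction
(`exists_even_moment_bound`), and a Hölder-type inequality for traces bounds the absolute moments
of all words by `O(n)` (`exists_absMoment_word_bound`). Consequently all moments of the local size
are bounded on average over the pairs of rows (`exists_locSize_moment_bound`). The Efron–Stein
inequality then shows that the normalized trace of a word has variance `O(n ^ (-3/2))`
(`exists_variance_bound`), which is summable, and an expansion to second order in one entry gives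
the approximate Schwinger–Dyson equation
`E tr(X_v w) = ∑ E[tr(w₁) tr(w₂)] + O(n ^ (-1/2))`,
the sum being over the decompositions `w = w₁ X_v w₂` (`exists_schwingerDyson_bound`). The third
moments enter in these two estimates. The mean of the square of a complex entry is not assumed to
vanish, but it multiplies only products of off-diagonal entries of words, which are negligible.

In the limit, a semicircular system free from `a` satisfies the exact equation
`τ(p x_v w) = ∑ τ(w₁) τ(p w₂)` for words `p` in `a` (`schwingerDyson_of_isFree`). For one variable this is the
recursion of the Catalan numbers (`semicircleMoment_succ`); freeness propagates it to all words,
because every polynomial is a combination of alternating products of centred ones, and on such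
products both sides can be computed (`schwingerDyson_of_isFreeKinds`).

The variance bound factorizes `E[tr(w₁) tr(w₂)]` asymptotically, so both sides obey the same
recursion on the number of Wigner letters, and words without such letters converge by hypothesis:
the expected traces converge (`tendsto_integral_ntr`), and by summability of the variances so do
the traces almost surely (`ae_tendsto_ntr`). The substitution `centringSubst` carries this over
from words in the centred matrices to polynomials in the original ones.
-/


namespace NCProb

/-! ### Trace inequalities for matrices -/

section MatrixInequalities

set_option linter.unusedSectionVars false

variable {m : Type*} [Fintype m] [DecidableEq m]

open Matrix
open scoped ComplexOrder

theorem trace_mul_conjTranspose_eq (A : Matrix m m ℂ) :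
    trace (A * Aᴴ) = ((∑ i, ∑ j, ‖A i j‖ ^ 2 : ℝ) : ℂ) := by
  simp only [trace, diag, mul_apply, conjTranspose_apply]
  push_cast
  refine Finset.sum_congr rfl fun i _ => Finset.sum_congr rfl fun j _ => ?_
  exact Complex.mul_conj' (A i j)

theorem norm_trace_mul_sq_le (A B : Matrix m m ℂ) :
    ‖trace (A * B)‖ ^ 2 ≤ (∑ i, ∑ j, ‖A i j‖ ^ 2) * ∑ i, ∑ j, ‖B i j‖ ^ 2 := by
  have h1 : ‖trace (A * B)‖ ≤ ∑ p : m × m, ‖A p.1 p.2‖ * ‖B p.2 p.1‖ := by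
    simp only [trace, diag, mul_apply]
    rw [Fintype.sum_prod_type]
    refine (norm_sum_le _ _).trans (Finset.sum_le_sum fun i _ => ?_)
    refine (norm_sum_le _ _).trans (Finset.sum_le_sum fun j _ => ?_)
    exact (norm_mul _ _).le
  have h2 := Finset.sum_mul_sq_le_sq_mul_sq Finset.univ (fun p : m × m => ‖A p.1 p.2‖)
    (fun p => ‖B p.2 p.1‖)
  have h3 : ∑ p : m × m, ‖B p.2 p.1‖ ^ 2 = ∑ i, ∑ j, ‖B i j‖ ^ 2 := by
    rw [Fintype.sum_prod_type, Finset.sum_comm]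
  rw [h3, Fintype.sum_prod_type (f := fun p : m × m => ‖A p.1 p.2‖ ^ 2)] at h2
  refine le_trans ?_ h2
  gcongr

/-- The `2k`-th absolute moment `Tr |M|^{2k}`. -/
noncomputable def absMoment (k : ℕ) (M : Matrix m m ℂ) : ℝ := (trace ((M * Mᴴ) ^ k)).re

theorem absMoment_nonneg (k : ℕ) (M : Matrix m m ℂ) : 0 ≤ absMoment k M :=
  (Complex.nonneg_iff.1 ((posSemidef_self_mul_conjTranspose M).pow k).trace_nonneg).1

theorem absMoment_one (M : Matrix m m ℂ) : absMoment 1 M = ∑ i, ∑ j, ‖M i j‖ ^ 2 := by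
  rw [absMoment, pow_one, trace_mul_conjTranspose_eq, Complex.ofReal_re]

theorem trace_mul_pow_comm (U V : Matrix m m ℂ) (k : ℕ) :
    trace ((U * V) ^ k) = trace ((V * U) ^ k) := by
  cases k with
  | zero => simp
  | succ k =>
    have h : ∀ k, (U * V) ^ (k + 1) = U * (V * U) ^ k * V := by
      intro k
      induction k with
      | zero => simp
      | succ k ih => rw [pow_succ, ih, pow_succ]; simp only [mul_assoc]
    rw [h, mul_assoc, trace_mul_comm, mul_assoc, ← pow_succ]

theorem absMoment_of_isHermitian {P : Matrix m m ℂ} (hP : P.IsHermitian) (k : ℕ) :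
    absMoment k P = (trace (P ^ (2 * k))).re := by
  rw [absMoment, hP.eq, ← sq, ← pow_mul]

/-- One pairing step of Hölder's inequality, deduced from the inequality for `2 ^ (l + 1)` factors
applied to an alternating product of two positive matrices. -/
theorem absMoment_mul_sq_le (l : ℕ)
    (ih : ∀ L : List (Matrix m m ℂ), L.length = 2 ^ (l + 1) →
      ‖trace L.prod‖ ^ 2 ^ (l + 1) ≤ (L.map (absMoment (2 ^ l))).prod)
    (A B : Matrix m m ℂ) :
    absMoment (2 ^ l) (A * B) ^ 2 ≤ absMoment (2 ^ (l + 1)) A * absMoment (2 ^ (l + 1)) B := by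
  set P := Aᴴ * A with hP
  set Q := B * Bᴴ with hQ
  have hPh : P.IsHermitian := isHermitian_conjTranspose_mul_self A
  have hQh : Q.IsHermitian := isHermitian_mul_conjTranspose_self B
  have h1 : trace ((A * B * (A * B)ᴴ) ^ 2 ^ l) = trace ((Q * P) ^ 2 ^ l) := by
    rw [conjTranspose_mul, hP, hQ, show A * B * (Bᴴ * Aᴴ) = A * (B * Bᴴ * Aᴴ) by
      simp only [mul_assoc], trace_mul_pow_comm]
    simp only [mul_assoc]
  -- `(Q * P) ^ k` is a product of `2 * k` factors, to which the induction hypothesis applies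
  have hflat : ∀ k : ℕ, ∃ L : List (Matrix m m ℂ), L.length = 2 * k ∧ L.prod = (Q * P) ^ k ∧
      (L.map (absMoment (2 ^ l))).prod = (absMoment (2 ^ l) Q * absMoment (2 ^ l) P) ^ k := by
    intro k
    induction k with
    | zero => exact ⟨[], by simp⟩
    | succ k ihk =>
      obtain ⟨L, h1, h2, h3⟩ := ihk
      refine ⟨Q :: P :: L, by simp [h1]; ring, ?_, ?_⟩
      · simp only [List.prod_cons, h2]; rw [pow_succ', ← mul_assoc Q P]
      · simp only [List.map_cons, List.prod_cons, h3]; ring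
  obtain ⟨L, hL1, hL2, hL3⟩ := hflat (2 ^ l)
  have h2 := ih L (by rw [hL1, pow_succ'])
  rw [hL2, hL3, pow_succ' 2 l, pow_mul] at h2
  have h3 := le_of_pow_le_pow_left₀ (by positivity : (2 ^ l) ≠ 0)
    (mul_nonneg (absMoment_nonneg _ _) (absMoment_nonneg _ _)) h2
  have hQ' : absMoment (2 ^ l) Q = absMoment (2 ^ (l + 1)) B := by
    rw [absMoment_of_isHermitian hQh, ← pow_succ', absMoment]
  have hP' : absMoment (2 ^ l) P = absMoment (2 ^ (l + 1)) A := by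
    rw [absMoment_of_isHermitian hPh, ← pow_succ', absMoment, hP, trace_mul_pow_comm]
  rw [hQ', hP'] at h3
  rw [mul_comm]
  refine le_trans ?_ h3
  have h4 : absMoment (2 ^ l) (A * B) ≤ ‖trace ((Q * P) ^ 2 ^ l)‖ := by
    rw [absMoment, h1]; exact Complex.re_le_norm _
  have := absMoment_nonneg (2 ^ l) (A * B)
  gcongr

/-- Hölder's inequality for the trace of a product of `2 ^ (l + 1)` matrices. -/
theorem norm_trace_prod_pow_le (l : ℕ) : ∀ L : List (Matrix m m ℂ), L.length = 2 ^ (l + 1) →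
    ‖trace L.prod‖ ^ 2 ^ (l + 1) ≤ (L.map (absMoment (2 ^ l))).prod := by
  induction l with
  | zero =>
    intro L hL
    match L, hL with
    | [A, B], _ =>
      simp only [List.prod_cons, List.prod_nil, mul_one, List.map_cons, List.map_nil, zero_add,
        pow_one, pow_zero, absMoment_one]
      exact norm_trace_mul_sq_le A B
  | succ l ih =>
    -- multiply neighbouring factors, which halves their number
    have hpair : ∀ k : ℕ, ∀ L : List (Matrix m m ℂ), L.length = 2 * k →
        ∃ L' : List (Matrix m m ℂ), L'.length = k ∧ L'.prod = L.prod ∧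
          0 ≤ (L'.map (absMoment (2 ^ l))).prod ∧
          (L'.map (absMoment (2 ^ l))).prod ^ 2 ≤ (L.map (absMoment (2 ^ (l + 1)))).prod := by
      intro k
      induction k with
      | zero =>
        intro L hL
        have : L = [] := List.length_eq_zero_iff.1 (by simpa using hL)
        subst this
        exact ⟨[], by simp⟩
      | succ k ihk =>
        intro L hL
        match L, hL with
        | A :: B :: L, hL =>
          obtain ⟨L', h1, h2, h3, h4⟩ := ihk L (by simp at hL; omega)
          refine ⟨(A * B) :: L', by simp [h1], by simp [h2, mul_assoc], ?_, ?_⟩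
          · simp only [List.map_cons, List.prod_cons]
            exact mul_nonneg (absMoment_nonneg _ _) h3
          · simp only [List.map_cons, List.prod_cons, mul_pow, ← mul_assoc]
            have := absMoment_mul_sq_le l ih A B
            have h5 := absMoment_nonneg (2 ^ (l + 1)) A
            have h6 := absMoment_nonneg (2 ^ (l + 1)) B
            gcongr
    intro L hL
    obtain ⟨L', h1, h2, h3, h4⟩ := hpair (2 ^ (l + 1)) L (by rw [hL]; ring)
    have h5 := ih L' h1
    rw [h2] at h5
    calc ‖trace L.prod‖ ^ 2 ^ (l + 1 + 1) = (‖trace L.prod‖ ^ 2 ^ (l + 1)) ^ 2 := by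
          rw [← pow_mul, ← pow_succ]
      _ ≤ _ := by gcongr
      _ ≤ _ := h4

theorem list_prod_le_pow_sum (L : List ℝ) (h0 : ∀ x ∈ L, 0 ≤ x) :
    L.prod ≤ L.sum ^ L.length := by
  induction L with
  | nil => simp
  | cons a L ih =>
    have ha : 0 ≤ a := h0 a (by simp)
    have hL : ∀ x ∈ L, 0 ≤ x := fun x hx => h0 x (by simp [hx])
    have hs : 0 ≤ L.sum := List.sum_nonneg hL
    simp only [List.prod_cons, List.sum_cons, List.length_cons, pow_succ']
    have h1 := ih hL
    have h2 : L.sum ^ L.length ≤ (a + L.sum) ^ L.length := by gcongr; linarith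
    have h3 : 0 ≤ L.sum ^ L.length := by positivity
    calc a * L.prod ≤ a * L.sum ^ L.length := by gcongr
      _ ≤ (a + L.sum) * (a + L.sum) ^ L.length := by gcongr; linarith

/-- Hölder's inequality in additive form, with the factors padded by identities up to
`2 ^ (l + 1)` of them. -/
theorem norm_trace_prod_le_sum (l : ℕ) (L : List (Matrix m m ℂ)) (hL : L.length ≤ 2 ^ (l + 1)) :
    ‖trace L.prod‖ ≤ (L.map (absMoment (2 ^ l))).sum + 2 ^ (l + 1) * Fintype.card m := by
  set L' := L ++ List.replicate (2 ^ (l + 1) - L.length) (1 : Matrix m m ℂ) with hL'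
  have h1 := norm_trace_prod_pow_le l L' (by simp [hL']; omega)
  have h2 := list_prod_le_pow_sum (L'.map (absMoment (2 ^ l))) (by
    simp only [List.mem_map]
    rintro x ⟨M, -, rfl⟩
    exact absMoment_nonneg _ _)
  have h3 : L'.prod = L.prod := by simp [hL']
  have h4 : (L'.map (absMoment (2 ^ l))).length = 2 ^ (l + 1) := by simp [hL']; omega
  have hone : absMoment (2 ^ l) (1 : Matrix m m ℂ) = Fintype.card m := by simp [absMoment]
  have h5 : (L'.map (absMoment (2 ^ l))).sum ≤
      (L.map (absMoment (2 ^ l))).sum + 2 ^ (l + 1) * Fintype.card m := by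
    simp only [hL', List.map_append, List.sum_append, List.map_replicate, List.sum_replicate, hone]
    rw [nsmul_eq_mul]
    have : ((2 ^ (l + 1) - L.length : ℕ) : ℝ) ≤ 2 ^ (l + 1) := by
      exact_mod_cast Nat.sub_le _ _
    gcongr
  rw [h4] at h2
  rw [h3] at h1
  have h6 : 0 ≤ (L'.map (absMoment (2 ^ l))).sum := List.sum_nonneg (by
    simp only [List.mem_map]
    rintro x ⟨M, -, rfl⟩
    exact absMoment_nonneg _ _)
  exact (le_of_pow_le_pow_left₀ (by positivity) h6 (h1.trans h2)).trans h5

theorem isHermitian_pow_apply {H : Matrix m m ℂ} (hH : H.IsHermitian) (c : ℕ) (a b : m) :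
    (H ^ c) a b = ∑ k, (hH.eigenvectorUnitary : Matrix m m ℂ) a k * (hH.eigenvalues k : ℂ) ^ c *
      star ((hH.eigenvectorUnitary : Matrix m m ℂ) b k) := by
  conv_lhs => rw [hH.spectral_theorem, ← map_pow, Unitary.conjStarAlgAut_apply, diagonal_pow]
  rw [mul_apply]
  refine Finset.sum_congr rfl fun k _ => ?_
  rw [mul_diagonal]
  rfl

theorem sum_norm_sq_eigenvectorUnitary {H : Matrix m m ℂ} (hH : H.IsHermitian) (a : m) :
    ∑ k, ‖(hH.eigenvectorUnitary : Matrix m m ℂ) a k‖ ^ 2 = 1 := by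
  have h := isHermitian_pow_apply hH 0 a a
  simp only [pow_zero, one_apply_eq, mul_one] at h
  have h2 : ((∑ k, ‖(hH.eigenvectorUnitary : Matrix m m ℂ) a k‖ ^ 2 : ℝ) : ℂ) = 1 := by
    rw [h]
    push_cast
    exact Finset.sum_congr rfl fun k _ => (Complex.mul_conj' _).symm
  exact_mod_cast h2

theorem isHermitian_pow_apply_self {H : Matrix m m ℂ} (hH : H.IsHermitian) (c : ℕ) (a : m) :
    (H ^ c) a a = ((∑ k, ‖(hH.eigenvectorUnitary : Matrix m m ℂ) a k‖ ^ 2 *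
      hH.eigenvalues k ^ c : ℝ) : ℂ) := by
  rw [isHermitian_pow_apply hH]
  push_cast
  refine Finset.sum_congr rfl fun k _ => ?_
  rw [← Complex.mul_conj', mul_right_comm]
  rfl

/-- Jensen's inequality for the spectral measure of a positive matrix at a basis vector. -/
theorem posSemidef_apply_pow_le {P : Matrix m m ℂ} (hP : P.PosSemidef) (p : ℕ) (a : m) :
    (P a a).re ^ p ≤ ((P ^ p) a a).re := by
  have h1 := isHermitian_pow_apply_self hP.1 1 a
  rw [pow_one] at h1
  rw [h1, isHermitian_pow_apply_self hP.1 p a, Complex.ofReal_re, Complex.ofReal_re]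
  simp only [pow_one]
  exact Real.pow_arith_mean_le_arith_mean_pow _ _ _ (fun _ _ => by positivity)
    (sum_norm_sq_eigenvectorUnitary hP.1 a) (fun k _ => hP.eigenvalues_nonneg k) p

theorem norm_apply_sq_le (V : Matrix m m ℂ) (a b : m) : ‖V a b‖ ^ 2 ≤ ((V * Vᴴ) a a).re := by
  have : ((V * Vᴴ) a a) = ((∑ k, ‖V a k‖ ^ 2 : ℝ) : ℂ) := by
    rw [mul_apply]
    push_cast
    exact Finset.sum_congr rfl fun k _ => Complex.mul_conj' _
  rw [this, Complex.ofReal_re]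
  exact Finset.single_le_sum (f := fun k => ‖V a k‖ ^ 2) (fun _ _ => by positivity)
    (Finset.mem_univ b)

theorem norm_apply_pow_le (V : Matrix m m ℂ) (a b : m) (p : ℕ) :
    ‖V a b‖ ^ (2 * p) ≤ (((V * Vᴴ) ^ p) a a).re := by
  rw [pow_mul]
  exact (pow_le_pow_left₀ (by positivity) (norm_apply_sq_le V a b) p).trans
    (posSemidef_apply_pow_le (posSemidef_self_mul_conjTranspose V) p a)

theorem re_pow_apply_self_nonneg (V : Matrix m m ℂ) (p : ℕ) (a : m) :
    0 ≤ (((V * Vᴴ) ^ p) a a).re :=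
  (by positivity : 0 ≤ ‖V a a‖ ^ (2 * p)).trans (norm_apply_pow_le V a a p)

theorem sum_re_pow_apply_self (V : Matrix m m ℂ) (p : ℕ) :
    ∑ a, (((V * Vᴴ) ^ p) a a).re = absMoment p V := by
  rw [absMoment, trace, Complex.re_sum]
  rfl

theorem re_even_pow_apply_self_nonneg {H : Matrix m m ℂ} (hH : H.IsHermitian) (K : ℕ) (a : m) :
    0 ≤ ((H ^ (2 * K)) a a).re := by
  rw [isHermitian_pow_apply_self hH, Complex.ofReal_re]
  exact Finset.sum_nonneg fun k _ => by rw [pow_mul]; positivity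

/-- All entries of the powers `H ^ c`, `c ≤ 2K`, in the rows and columns `i`, `j` are controlled
homogeneously by the two diagonal entries of `H ^ (2K)`. -/
theorem exists_local_bound {H : Matrix m m ℂ} (hH : H.IsHermitian) (K : ℕ) (i j : m) :
    ∃ h : ℝ, 1 ≤ h ∧
      h ^ (2 * K) ≤ 4 ^ K * (1 + ((H ^ (2 * K)) i i).re + ((H ^ (2 * K)) j j).re) ∧
      ∀ c ≤ 2 * K, ∀ a b, (a = i ∨ a = j) → (b = i ∨ b = j) → ‖(H ^ c) a b‖ ≤ h ^ c := by
  have hi := re_even_pow_apply_self_nonneg hH K i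
  have hj := re_even_pow_apply_self_nonneg hH K j
  set T : ℝ := 1 + ((H ^ (2 * K)) i i).re + ((H ^ (2 * K)) j j).re with hT
  have hT1 : 1 ≤ T := by linarith
  have hzero : ∀ a b : m, ‖(H ^ 0) a b‖ ≤ 1 := by
    intro a b
    rw [pow_zero, one_apply]
    split_ifs <;> simp
  rcases Nat.eq_zero_or_pos K with hK | hK
  · subst hK
    refine ⟨1, le_rfl, by simpa using hT1, ?_⟩
    intro c hc a b _ _
    have : c = 0 := by omega
    subst this
    simpa using hzero a b
  -- `g ^ (2 * K) = T`; the factor `2` in the bound `h = 2 * g` absorbs the two terms of `hS` below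
  set g : ℝ := T ^ ((1 : ℝ) / (2 * K : ℕ)) with hg
  have hg1 : 1 ≤ g := Real.one_le_rpow hT1 (by positivity)
  have hgT : g ^ (2 * K) = T := by
    rw [hg, ← Real.rpow_natCast, ← Real.rpow_mul (by linarith), one_div,
      inv_mul_cancel₀ (by positivity), Real.rpow_one]
  have hg0 : 0 < g := by linarith
  refine ⟨2 * g, by linarith, ?_, ?_⟩
  · rw [mul_pow, hgT, pow_mul]; norm_num
  intro c hc a b ha hb
  rcases Nat.eq_zero_or_pos c with h0 | h0
  · subst h0; simpa using hzero a b
  set U := (hH.eigenvectorUnitary : Matrix m m ℂ) with hU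
  set l := hH.eigenvalues with hl
  -- the `c`-th absolute moment of the spectral measure at `a`, by `t ^ c ≤ 1 + t ^ (2 * K)`
  have hS : ∀ a, (a = i ∨ a = j) → ∑ k, ‖U a k‖ ^ 2 * |l k| ^ c ≤ 2 * g ^ c := by
    intro a ha
    have hSa : ∑ k, ‖U a k‖ ^ 2 * l k ^ (2 * K) ≤ g ^ (2 * K) := by
      have h1 := isHermitian_pow_apply_self hH (2 * K) a
      have h2 := congrArg Complex.re h1
      rw [Complex.ofReal_re] at h2
      rw [← h2, hgT]
      rcases ha with rfl | rfl <;> linarith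
    have hpt : ∀ k, |l k| ^ c ≤ g ^ c * (1 + l k ^ (2 * K) / g ^ (2 * K)) := by
      intro k
      have hx : 0 ≤ |l k| / g := by positivity
      have h1 : (|l k| / g) ^ c ≤ 1 + (|l k| / g) ^ (2 * K) := by
        rcases le_total (|l k| / g) 1 with h | h
        · have := pow_le_one₀ (n := c) hx h
          have : 0 ≤ (|l k| / g) ^ (2 * K) := by positivity
          linarith
        · have := pow_le_pow_right₀ h hc
          linarith
      rw [div_pow, div_pow, pow_mul |l k|, sq_abs, ← pow_mul, div_le_iff₀ (by positivity)] at h1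
      linarith
    calc ∑ k, ‖U a k‖ ^ 2 * |l k| ^ c
        ≤ ∑ k, ‖U a k‖ ^ 2 * (g ^ c * (1 + l k ^ (2 * K) / g ^ (2 * K))) := by
          gcongr with k; exact hpt k
      _ = g ^ c * (∑ k, ‖U a k‖ ^ 2 + (∑ k, ‖U a k‖ ^ 2 * l k ^ (2 * K)) / g ^ (2 * K)) := by
          rw [Finset.sum_div, ← Finset.sum_add_distrib, Finset.mul_sum]
          exact Finset.sum_congr rfl fun k _ => by ring
      _ ≤ g ^ c * (1 + 1) := by
          rw [sum_norm_sq_eigenvectorUnitary hH a]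
          gcongr
          exact (div_le_one (by positivity)).2 hSa
      _ = 2 * g ^ c := by ring
  calc ‖(H ^ c) a b‖ ≤ ∑ k, ‖U a k‖ * |l k| ^ c * ‖U b k‖ := by
        rw [isHermitian_pow_apply hH]
        refine (norm_sum_le _ _).trans (Finset.sum_le_sum fun k _ => ?_)
        rw [norm_mul, norm_mul, norm_star, norm_pow, Complex.norm_real, Real.norm_eq_abs]
    _ ≤ ∑ k, ((‖U a k‖ ^ 2 * |l k| ^ c) / 2 + (‖U b k‖ ^ 2 * |l k| ^ c) / 2) := by
        refine Finset.sum_le_sum fun k _ => ?_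
        have : 0 ≤ |l k| ^ c := by positivity
        nlinarith [mul_nonneg this (sq_nonneg (‖U a k‖ - ‖U b k‖))]
    _ ≤ 2 * g ^ c := by
        rw [Finset.sum_add_distrib, ← Finset.sum_div, ← Finset.sum_div]
        linarith [hS a ha, hS b hb]
    _ ≤ (2 * g) ^ c := by
        rw [mul_pow]
        gcongr
        exact le_self_pow₀ (by norm_num) (by omega)

end MatrixInequalities

end NCProb


namespace NCProb

/-! ### Words and their local perturbations -/

section Words

variable {α : Type*}

/-- The value of a word in the letters `α`, each letter `c` being replaced by `M c`. -/
def evalWord {R : Type*} [Monoid R] (M : α → R) (w : List α) : R := (w.map M).prod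

section

variable {R : Type*} [Monoid R] (M : α → R)

@[simp] theorem evalWord_nil : evalWord M [] = 1 := rfl

@[simp] theorem evalWord_cons (c : α) (w : List α) :
    evalWord M (c :: w) = M c * evalWord M w := by simp [evalWord]

@[simp] theorem evalWord_append (u w : List α) :
    evalWord M (u ++ w) = evalWord M u * evalWord M w := by simp [evalWord]

theorem evalWord_replicate (k : ℕ) (c : α) : evalWord M (List.replicate k c) = M c ^ k := by
  simp [evalWord]

end

variable [DecidableEq α]

/-- The list of all pairs `(s₁, s₂)` such that `w = s₁ ++ ℓ :: s₂`. -/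
def splits (ℓ : α) : List α → List (List α × List α)
  | [] => []
  | c :: s => (if c = ℓ then [([], s)] else []) ++ (splits ℓ s).map fun q => (c :: q.1, q.2)

theorem eq_of_mem_splits {ℓ : α} {w : List α} {q : List α × List α} (hq : q ∈ splits ℓ w) :
    w = q.1 ++ ℓ :: q.2 := by
  induction w generalizing q with
  | nil => simp [splits] at hq
  | cons c s ih =>
    simp only [splits, List.mem_append, List.mem_map] at hq
    rcases hq with hq | ⟨q', hq', rfl⟩
    · split_ifs at hq with h
      · simp only [List.mem_singleton] at hq
        subst hq
        simp [h]
      · simp at hq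
    · simpa using ih hq'

theorem splits_append_of_notMem {ℓ : α} {w p : List α} (hp : ℓ ∉ p) :
    splits ℓ (w ++ p) = (splits ℓ w).map fun q => (q.1, q.2 ++ p) := by
  induction w with
  | nil =>
    simp only [List.nil_append, splits, List.map_nil]
    induction p with
    | nil => rfl
    | cons c s ih =>
      simp only [List.mem_cons, not_or] at hp
      simp [splits, ih hp.2, Ne.symm hp.1]
  | cons c s ih =>
    simp only [List.cons_append, splits, ih, List.map_append, List.map_map]
    congr 1
    split_ifs <;> simp

end Words

section Perturbation

variable {m : Type*} [Fintype m] [DecidableEq m] {α : Type*} [DecidableEq α]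

open Matrix

/-- The Hermitian matrix (for real `y` if `i = j`) whose entries are `y` at `(i, j)`,
the conjugate of `y` at `(j, i)`, and zero elsewhere. -/
def entryPert (i j : m) (y : ℂ) : Matrix m m ℂ :=
  single i j y + if i = j then 0 else single j i (star y)

theorem mul_single_mul_apply (U V : Matrix m m ℂ) (i j a b : m) (y : ℂ) :
    (U * single i j y * V) a b = U a i * y * V j b := by
  rw [mul_apply, Finset.sum_eq_single j]
  · rw [mul_single_apply_same]
  · intro k _ hk
    rw [mul_single_apply_of_ne _ _ _ _ _ hk, zero_mul]
  · simp

theorem mul_entryPert_mul_apply (U V : Matrix m m ℂ) (i j a b : m) (y : ℂ) :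
    (U * entryPert i j y * V) a b =
      U a i * y * V j b + if i = j then 0 else U a j * star y * V i b := by
  rw [entryPert, mul_add, add_mul, Matrix.add_apply, mul_single_mul_apply]
  congr 1
  split_ifs
  · simp
  · rw [mul_single_mul_apply]

theorem trace_entryPert_mul (V : Matrix m m ℂ) (i j : m) (y : ℂ) :
    trace (entryPert i j y * V) = y * V j i + if i = j then 0 else star y * V i j := by
  rw [entryPert, add_mul, trace_add, trace_single_mul]
  congr 1
  split_ifs
  · simp
  · rw [trace_single_mul, smul_eq_mul]

theorem norm_trace_entryPert_mul_le (V : Matrix m m ℂ) (i j : m) (y : ℂ) :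
    ‖trace (entryPert i j y * V)‖ ≤ ‖y‖ * (‖V j i‖ + ‖V i j‖) := by
  rw [trace_entryPert_mul, mul_add]
  refine (norm_add_le _ _).trans (add_le_add (norm_mul _ _).le ?_)
  split_ifs
  · simp; positivity
  · rw [norm_mul, norm_star]

theorem norm_mul_entryPert_mul_apply_le {U V : Matrix m m ℂ} {i j a b : m} (y : ℂ) {B C : ℝ}
    (hB : 0 ≤ B) (hU : ∀ c, (c = i ∨ c = j) → ‖U a c‖ ≤ B)
    (hV : ∀ c, (c = i ∨ c = j) → ‖V c b‖ ≤ C) :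
    ‖(U * entryPert i j y * V) a b‖ ≤ 2 * ‖y‖ * (B * C) := by
  have hC : 0 ≤ C := (norm_nonneg _).trans (hV i (Or.inl rfl))
  have key : ∀ c d, (c = i ∨ c = j) → (d = i ∨ d = j) → ‖U a c * y * V d b‖ ≤ ‖y‖ * (B * C) := by
    intro c d hc hd
    rw [norm_mul, norm_mul]
    calc ‖U a c‖ * ‖y‖ * ‖V d b‖ ≤ B * ‖y‖ * C := by
          gcongr
          · exact hU c hc
          · exact hV d hd
      _ = _ := by ring
  rw [mul_entryPert_mul_apply]
  have h1 := key i j (Or.inl rfl) (Or.inr rfl)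
  have h2 : ‖if i = j then 0 else U a j * star y * V i b‖ ≤ ‖y‖ * (B * C) := by
    split_ifs
    · rw [norm_zero]; positivity
    · have := key j i (Or.inr rfl) (Or.inl rfl)
      rw [norm_mul, norm_mul] at this
      rwa [norm_mul, norm_mul, norm_star]
  linarith [norm_add_le (U a i * y * V j b) (if i = j then 0 else U a j * star y * V i b)]

/-- The entries in the rows and columns `i`, `j` of all subwords of `L` of length at most `k`
are bounded by the corresponding powers of `h`. -/
def LocalBound (M : α → Matrix m m ℂ) (i j : m) (h : ℝ) (L : List α) (k : ℕ) : Prop :=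
  ∀ V, V <:+: L → V.length ≤ k → ∀ a b, (a = i ∨ a = j) → (b = i ∨ b = j) →
    ‖evalWord M V a b‖ ≤ h ^ V.length

omit [DecidableEq α] in
theorem LocalBound.mono {M : α → Matrix m m ℂ} {i j : m} {h : ℝ} {L L' : List α} {k k' : ℕ}
    (H : LocalBound M i j h L k) (hL : L' <:+: L) (hk : k' ≤ k) : LocalBound M i j h L' k' :=
  fun V hV hVk => H V (hV.trans hL) (hVk.trans hk)

variable {M M₀ : α → Matrix m m ℂ} {ℓ : α} {i j : m} {y : ℂ}

/-- The exact first order expansion of a word when one letter is perturbed. -/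
theorem evalWord_sub_evalWord {D : Matrix m m ℂ}
    (hM : ∀ c, M c = M₀ c + if c = ℓ then D else 0) (w : List α) :
    evalWord M w - evalWord M₀ w =
      ((splits ℓ w).map fun q => evalWord M₀ q.1 * D * evalWord M q.2).sum := by
  induction w with
  | nil => simp [splits]
  | cons c s ih =>
    have h1 : evalWord M (c :: s) - evalWord M₀ (c :: s) =
        (if c = ℓ then D else 0) * evalWord M s + M₀ c * (evalWord M s - evalWord M₀ s) := by
      rw [evalWord_cons, evalWord_cons, hM c, add_mul, mul_sub]; abel
    rw [h1, ih, splits, List.map_append, List.sum_append, List.map_map]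
    congr 1
    · split_ifs <;> simp
    · rw [← List.sum_map_mul_left]
      simp [Function.comp_def, mul_assoc]

/-- Perturbing one letter costs a factor `5` per letter in the local bound: the block `s`, flanked
by unperturbed words, is expanded letter by letter, and each occurrence of `ℓ` contributes `M₀ ℓ`
or the perturbation, whose entries lie in the rows and columns `i`, `j`. -/
theorem norm_evalWord_perturbed_le (hM : ∀ c, M c = M₀ c + if c = ℓ then entryPert i j y else 0)
    (hy : ‖y‖ ≤ 2) {h : ℝ} (hh : 1 ≤ h) (s u p : List α) {k : ℕ}
    (hk : (u ++ s ++ p).length ≤ k) (H : LocalBound M₀ i j h (u ++ s ++ p) k)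
    (a b : m) (ha : a = i ∨ a = j) (hb : b = i ∨ b = j) :
    ‖(evalWord M₀ u * evalWord M s * evalWord M₀ p) a b‖ ≤
      h ^ u.length * (5 * h) ^ (s.length + p.length) := by
  induction s generalizing u k a b with
  | nil =>
    have h1 := H (u ++ p) (by simp) (by simpa using hk) a b ha hb
    rw [evalWord_append, List.length_append, pow_add] at h1
    simp only [evalWord_nil, mul_one, List.length_nil, zero_add]
    refine h1.trans ?_
    gcongr
    linarith
  | cons c s ih =>
    have hlen : u.length + (s.length + 1) + p.length ≤ k := by
      simp only [List.length_append, List.length_cons] at hk; omega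
    have h1 := ih (u ++ [c]) (k := k) (by simp; omega)
      (H.mono (by simp) le_rfl) a b ha hb
    have hV : ∀ d, (d = i ∨ d = j) → ‖(evalWord M s * evalWord M₀ p) d b‖ ≤
        (5 * h) ^ (s.length + p.length) := by
      intro d hd
      have := ih [] (k := k) (by simp; omega)
        (H.mono ⟨u ++ [c], [], by simp⟩ le_rfl) d b hd hb
      simpa using this
    have hU : ∀ d, (d = i ∨ d = j) → ‖evalWord M₀ u a d‖ ≤ h ^ u.length := by
      intro d hd
      exact H u ⟨[], c :: s ++ p, by simp⟩ (by omega) a d ha hd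
    have h2 := norm_mul_entryPert_mul_apply_le y (by positivity) hU hV
    have h3 : evalWord M₀ u * evalWord M (c :: s) * evalWord M₀ p =
        evalWord M₀ (u ++ [c]) * evalWord M s * evalWord M₀ p +
        if c = ℓ then evalWord M₀ u * entryPert i j y * (evalWord M s * evalWord M₀ p) else 0 := by
      rw [evalWord_cons, hM c, evalWord_append, evalWord_cons, evalWord_nil]
      split_ifs
      · simp only [mul_add, add_mul, mul_assoc, mul_one]
      · simp [mul_assoc]
    have h4 : ‖(if c = ℓ then evalWord M₀ u * entryPert i j y * (evalWord M s * evalWord M₀ p)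
        else 0 : Matrix m m ℂ) a b‖ ≤
        2 * ‖y‖ * (h ^ u.length * (5 * h) ^ (s.length + p.length)) := by
      split_ifs
      · exact h2
      · rw [Matrix.zero_apply, norm_zero]; positivity
    rw [h3, Matrix.add_apply]
    refine (norm_add_le _ _).trans ((add_le_add h1 h4).trans ?_)
    simp only [List.length_append, List.length_cons, List.length_nil, zero_add]
    set Q := h ^ u.length * (5 * h) ^ (s.length + p.length) with hQ
    have hQ0 : 0 ≤ Q := by positivity
    have e1 : h ^ (u.length + 1) * (5 * h) ^ (s.length + p.length) = Q * h := by rw [hQ]; ring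
    have e2 : h ^ u.length * (5 * h) ^ (s.length + 1 + p.length) = Q * (5 * h) := by rw [hQ]; ring
    rw [e1, e2]
    nlinarith [mul_nonneg hQ0 (norm_nonneg y), mul_nonneg hQ0 (sub_nonneg.2 hh),
      mul_nonneg hQ0 (sub_nonneg.2 hy)]

/-- The first order difference is `O(‖y‖)`, with one power of `h` less than the word has letters.
Only subwords that are strictly shorter than the word enter, whence the bound `k + 1` on the
length. -/
theorem norm_evalWord_perturbed_sub_le
    (hM : ∀ c, M c = M₀ c + if c = ℓ then entryPert i j y else 0)
    (hy : ‖y‖ ≤ 2) {h : ℝ} (hh : 1 ≤ h) (s u p : List α) {k : ℕ}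
    (hk : (u ++ s ++ p).length ≤ k + 1) (H : LocalBound M₀ i j h (u ++ s ++ p) k)
    (a b : m) (ha : a = i ∨ a = j) (hb : b = i ∨ b = j) :
    ‖(evalWord M₀ u * evalWord M s * evalWord M₀ p) a b - evalWord M₀ (u ++ s ++ p) a b‖ ≤
      ‖y‖ * 5 ^ (s.length + p.length) * h ^ (u.length + s.length + p.length - 1) := by
  induction s generalizing u with
  | nil =>
    simp only [evalWord_nil, mul_one, List.append_nil, evalWord_append, sub_self, norm_zero]
    positivity
  | cons c s ih =>
    have hlen : u.length + (s.length + 1) + p.length ≤ k + 1 := by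
      simp only [List.length_append, List.length_cons] at hk; omega
    have h1 := ih (u ++ [c]) (by simp; omega) (H.mono (by simp) le_rfl)
    have hV : ∀ d, (d = i ∨ d = j) → ‖(evalWord M s * evalWord M₀ p) d b‖ ≤
        (5 * h) ^ (s.length + p.length) := by
      intro d hd
      have := norm_evalWord_perturbed_le hM hy hh s [] p (k := k) (by simp; omega)
        (H.mono ⟨u ++ [c], [], by simp⟩ le_rfl) d b hd hb
      simpa using this
    have hU : ∀ d, (d = i ∨ d = j) → ‖evalWord M₀ u a d‖ ≤ h ^ u.length := by
      intro d hd
      exact H u ⟨[], c :: s ++ p, by simp⟩ (by omega) a d ha hd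
    have h2 := norm_mul_entryPert_mul_apply_le y (by positivity) hU hV
    have h3 : evalWord M₀ u * evalWord M (c :: s) * evalWord M₀ p =
        evalWord M₀ (u ++ [c]) * evalWord M s * evalWord M₀ p +
        if c = ℓ then evalWord M₀ u * entryPert i j y * (evalWord M s * evalWord M₀ p) else 0 := by
      rw [evalWord_cons, hM c, evalWord_append, evalWord_cons, evalWord_nil]
      split_ifs
      · simp only [mul_add, add_mul, mul_assoc, mul_one]
      · simp [mul_assoc]
    have h4 : ‖(if c = ℓ then evalWord M₀ u * entryPert i j y * (evalWord M s * evalWord M₀ p)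
        else 0 : Matrix m m ℂ) a b‖ ≤
        2 * ‖y‖ * (h ^ u.length * (5 * h) ^ (s.length + p.length)) := by
      split_ifs
      · exact h2
      · rw [Matrix.zero_apply, norm_zero]; positivity
    have e0 : u ++ c :: s ++ p = u ++ [c] ++ s ++ p := by simp
    rw [h3, Matrix.add_apply, e0, add_sub_right_comm]
    refine (norm_add_le _ _).trans ((add_le_add h1 h4).trans ?_)
    simp only [List.length_append, List.length_cons, List.length_nil, zero_add]
    have e1 : u.length + 1 + s.length + p.length - 1 = u.length + (s.length + p.length) := by omega
    have e2 : u.length + (s.length + 1) + p.length - 1 = u.length + (s.length + p.length) := by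
      omega
    rw [e1, e2]
    set Q := ‖y‖ * (h ^ (u.length + (s.length + p.length)) * 5 ^ (s.length + p.length)) with hQ
    have hQ0 : 0 ≤ Q := by positivity
    have e3 : ‖y‖ * 5 ^ (s.length + p.length) * h ^ (u.length + (s.length + p.length)) = Q := by
      rw [hQ]; ring
    have e4 : 2 * ‖y‖ * (h ^ u.length * (5 * h) ^ (s.length + p.length)) = 2 * Q := by
      rw [hQ, mul_pow]; ring
    have e5 : ‖y‖ * 5 ^ (s.length + 1 + p.length) * h ^ (u.length + (s.length + p.length)) =
        5 * Q := by
      rw [hQ]; ring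
    rw [e3, e4, e5]
    linarith

/-- The first order term in the expansion of a word at `M₀`. -/
def linearTerm (M₀ : α → Matrix m m ℂ) (ℓ : α) (D : Matrix m m ℂ) (w : List α) : Matrix m m ℂ :=
  ((splits ℓ w).map fun q => evalWord M₀ q.1 * D * evalWord M₀ q.2).sum

theorem linearTerm_cons (D : Matrix m m ℂ) (c : α) (s : List α) :
    linearTerm M₀ ℓ D (c :: s) =
      (if c = ℓ then D * evalWord M₀ s else 0) + M₀ c * linearTerm M₀ ℓ D s := by
  rw [linearTerm, splits, List.map_append, List.sum_append, List.map_map]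
  congr 1
  · split_ifs <;> simp
  · rw [linearTerm, ← List.sum_map_mul_left]
    simp [Function.comp_def, mul_assoc]

/-- The remainder after the first order term is `O(‖y‖ ^ 2)`. -/
theorem norm_evalWord_second_order_le
    (hM : ∀ c, M c = M₀ c + if c = ℓ then entryPert i j y else 0)
    (hy : ‖y‖ ≤ 2) {h : ℝ} (hh : 1 ≤ h) (s u : List α)
    (H : LocalBound M₀ i j h (u ++ s) (u ++ s).length)
    (a b : m) (ha : a = i ∨ a = j) (hb : b = i ∨ b = j) :
    ‖(evalWord M₀ u * (evalWord M s - evalWord M₀ s -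
      linearTerm M₀ ℓ (entryPert i j y) s)) a b‖ ≤
      ‖y‖ ^ 2 * (h ^ u.length * (5 * h) ^ s.length) := by
  induction s generalizing u with
  | nil => simp [linearTerm, splits]; positivity
  | cons c s ih =>
    have h1 := ih (u ++ [c]) (by simpa using H)
    have hV : ∀ d, (d = i ∨ d = j) → ‖(evalWord M s - evalWord M₀ s) d b‖ ≤
        ‖y‖ * (5 * h) ^ s.length := by
      intro d hd
      have := norm_evalWord_perturbed_sub_le hM hy hh s [] [] (k := s.length) (by simp)
        (H.mono ⟨u ++ [c], [], by simp⟩ (by simp; omega)) d b hd hb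
      simp only [evalWord_nil, one_mul, mul_one, List.nil_append, List.append_nil, List.length_nil,
        add_zero, zero_add] at this
      rw [Matrix.sub_apply]
      refine this.trans ?_
      rw [mul_pow, mul_assoc]
      gcongr
      omega
    have hU : ∀ d, (d = i ∨ d = j) → ‖evalWord M₀ u a d‖ ≤ h ^ u.length := by
      intro d hd
      exact H u ⟨[], c :: s, by simp⟩ (by simp) a d ha hd
    have h2 := norm_mul_entryPert_mul_apply_le y (by positivity) hU hV
    have h3 : evalWord M₀ u * (evalWord M (c :: s) - evalWord M₀ (c :: s) -
          linearTerm M₀ ℓ (entryPert i j y) (c :: s)) =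
        evalWord M₀ (u ++ [c]) * (evalWord M s - evalWord M₀ s -
          linearTerm M₀ ℓ (entryPert i j y) s) +
        if c = ℓ then evalWord M₀ u * entryPert i j y * (evalWord M s - evalWord M₀ s) else 0 := by
      rw [evalWord_cons, evalWord_cons, hM c, evalWord_append, evalWord_cons, evalWord_nil,
        linearTerm_cons]
      split_ifs
      · simp only [mul_add, add_mul, mul_sub, mul_assoc, mul_one]; abel
      · simp [mul_assoc, mul_sub]
    have h4 : ‖(if c = ℓ then evalWord M₀ u * entryPert i j y * (evalWord M s - evalWord M₀ s)
        else 0 : Matrix m m ℂ) a b‖ ≤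
        2 * ‖y‖ * (h ^ u.length * (‖y‖ * (5 * h) ^ s.length)) := by
      split_ifs
      · exact h2
      · rw [Matrix.zero_apply, norm_zero]; positivity
    rw [h3, Matrix.add_apply]
    refine (norm_add_le _ _).trans ((add_le_add h1 h4).trans ?_)
    simp only [List.length_append, List.length_cons, List.length_nil, zero_add]
    set Q := ‖y‖ ^ 2 * (h ^ u.length * (5 * h) ^ s.length) with hQ
    have hQ0 : 0 ≤ Q := by positivity
    have e1 : ‖y‖ ^ 2 * (h ^ (u.length + 1) * (5 * h) ^ s.length) = Q * h := by rw [hQ]; ring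
    have e2 : 2 * ‖y‖ * (h ^ u.length * (‖y‖ * (5 * h) ^ s.length)) = Q * 2 := by rw [hQ]; ring
    have e3 : ‖y‖ ^ 2 * (h ^ u.length * (5 * h) ^ (s.length + 1)) = Q * (5 * h) := by
      rw [hQ]; ring
    rw [e1, e2, e3]
    nlinarith [mul_nonneg hQ0 (sub_nonneg.2 hh)]

end Perturbation

end NCProb


namespace NCProb

/-! ### Product measures and the Efron–Stein inequality -/

section ProductMeasure

set_option linter.unusedSectionVars false

variable {E : Type*} [Fintype E] [DecidableEq E] (ν : E → Measure ℂ)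
  [∀ e, IsProbabilityMeasure (ν e)]

theorem measurePreserving_update (e : E) :
    MeasurePreserving (fun p : (E → ℂ) × ℂ => Function.update p.1 e p.2)
      ((Measure.pi ν).prod (ν e)) (Measure.pi ν) := by
  have hm : Measurable fun p : (E → ℂ) × ℂ => Function.update p.1 e p.2 := by
    refine measurable_pi_lambda _ fun a => ?_
    by_cases h : a = e
    · subst h; simpa using measurable_snd
    · simp only [Function.update_of_ne h]; fun_prop
  refine ⟨hm, (Measure.pi_eq fun s hs => ?_).symm⟩
  rw [Measure.map_apply hm (MeasurableSet.univ_pi hs)]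
  have h1 : (fun p : (E → ℂ) × ℂ => Function.update p.1 e p.2) ⁻¹' (Set.pi Set.univ s) =
      (Set.pi Set.univ (Function.update s e Set.univ)) ×ˢ s e := by
    ext p
    simp only [Set.mem_preimage, Set.mem_pi, Set.mem_univ, forall_const, Set.mem_prod]
    constructor
    · intro h
      refine ⟨fun a => ?_, by simpa using h e⟩
      by_cases ha : a = e
      · subst ha; simp
      · simpa [ha] using h a
    · rintro ⟨h, h'⟩ a
      by_cases ha : a = e
      · subst ha; simpa using h'
      · simpa [ha] using h a
  rw [h1, Measure.prod_prod, Measure.pi_pi, ← Finset.prod_erase_mul _ _ (Finset.mem_univ e),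
    ← Finset.prod_erase_mul (a := e) _ (fun i => ν i (s i)) (Finset.mem_univ e)]
  simp only [Function.update_self, measure_univ, mul_one]
  congr 1
  refine Finset.prod_congr rfl fun a ha => ?_
  rw [Function.update_of_ne (Finset.ne_of_mem_erase ha)]

variable {G : Type*} [NormedAddCommGroup G]

theorem ae_pi_norm_le {R : ℝ} (hν : ∀ e, ∀ᵐ t ∂ν e, ‖t‖ ≤ R) :
    ∀ᵐ z ∂Measure.pi ν, ∀ e, ‖z e‖ ≤ R := by
  rw [ae_all_iff]
  intro e
  exact (measurePreserving_eval ν e).quasiMeasurePreserving.ae (hν e)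

theorem integrable_pi_of_continuous {R : ℝ} (hν : ∀ e, ∀ᵐ t ∂ν e, ‖t‖ ≤ R)
    {F : (E → ℂ) → G} [SecondCountableTopology G]
    (hF : Continuous F) :
    Integrable F (Measure.pi ν) := by
  obtain ⟨C, hC⟩ := (isCompact_closedBall (0 : E → ℂ) (max R 0)).exists_bound_of_continuousOn
    hF.continuousOn
  refine Integrable.of_bound hF.aestronglyMeasurable C ?_
  filter_upwards [ae_pi_norm_le ν hν] with z hz
  refine hC z ?_
  rw [mem_closedBall_zero_iff, pi_norm_le_iff_of_nonneg (le_max_right _ _)]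
  exact fun e => (hz e).trans (le_max_left _ _)

theorem integrable_of_continuous_entry {R : ℝ} (hν : ∀ e, ∀ᵐ t ∂ν e, ‖t‖ ≤ R)
    {F : ℂ → G} [SecondCountableTopology G]
    (hF : Continuous F) (e : E) :
    Integrable F (ν e) := by
  obtain ⟨C, hC⟩ := (isCompact_closedBall (0 : ℂ) R).exists_bound_of_continuousOn
    hF.continuousOn
  refine Integrable.of_bound hF.aestronglyMeasurable C ?_
  filter_upwards [hν e] with t ht
  exact hC t (by simpa using ht)

variable [NormedSpace ℝ G]

theorem integral_pi_eq_integral_update {R : ℝ} (hν : ∀ e, ∀ᵐ t ∂ν e, ‖t‖ ≤ R)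
    {F : (E → ℂ) → G} [SecondCountableTopology G]
    (hF : Continuous F) (e : E) :
    ∫ z, F z ∂Measure.pi ν = ∫ z, ∫ t, F (Function.update z e t) ∂ν e ∂Measure.pi ν := by
  have h := measurePreserving_update ν e
  have hi := integrable_pi_of_continuous ν hν hF
  have h2 : Integrable (fun p : (E → ℂ) × ℂ => F (Function.update p.1 e p.2))
      ((Measure.pi ν).prod (ν e)) := h.integrable_comp_of_integrable hi
  rw [← integral_prod _ h2, ← h.map_eq, integral_map h.measurable.aemeasurable]
  rw [h.map_eq]
  exact hF.aestronglyMeasurable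

/-- The average over the coordinate `e`. -/
noncomputable def avg (e : E) (F : (E → ℂ) → ℝ) (z : E → ℂ) : ℝ :=
  ∫ t, F (Function.update z e t) ∂ν e

theorem continuous_update_uncurry (e : E) :
    Continuous fun p : (E → ℂ) × ℂ => Function.update p.1 e p.2 :=
  continuous_fst.update e continuous_snd

theorem continuous_avg {R : ℝ} (hν : ∀ e, ∀ᵐ t ∂ν e, ‖t‖ ≤ R)
    (e : E) {F : (E → ℂ) → ℝ} (hF : Continuous F) : Continuous (avg ν e F) := by
  have h := continuous_parametric_integral_of_continuous (μ := ν e)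
    (f := fun (z : E → ℂ) (t : ℂ) => F (Function.update z e t))
    (hF.comp (continuous_update_uncurry e)) (isCompact_closedBall (0 : ℂ) R)
  have h2 : (ν e).restrict (Metric.closedBall 0 R) = ν e := by
    refine Measure.restrict_eq_self_of_ae_mem ?_
    filter_upwards [hν e] with t ht
    simpa using ht
  rw [h2] at h
  exact h

theorem avg_update (e : E) (F : (E → ℂ) → ℝ) (z : E → ℂ) (s : ℂ) :
    avg ν e F (Function.update z e s) = avg ν e F z := by
  simp [avg]

theorem avg_comm {R : ℝ} (hν : ∀ e, ∀ᵐ t ∂ν e, ‖t‖ ≤ R) {e e' : E} (hne : e ≠ e')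
    {F : (E → ℂ) → ℝ} (hF : Continuous F) :
    avg ν e (avg ν e' F) = avg ν e' (avg ν e F) := by
  ext z
  simp only [avg]
  rw [integral_integral_swap]
  · simp_rw [Function.update_comm hne]
  · have hc : Continuous fun p : ℂ × ℂ =>
        F (Function.update (Function.update z e p.1) e' p.2) := by
      have : Continuous fun p : ℂ × ℂ => Function.update (Function.update z e p.1) e' p.2 :=
        (Continuous.update (continuous_const (y := z)) e continuous_fst).update e' continuous_snd
      exact hF.comp this
    obtain ⟨C, hC⟩ := (isCompact_closedBall (0 : ℂ × ℂ) R).exists_bound_of_continuousOn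
      hc.continuousOn
    refine Integrable.of_bound hc.aestronglyMeasurable C ?_
    have h1 : ∀ᵐ p ∂(ν e).prod (ν e'), ‖p.1‖ ≤ R :=
      Measure.quasiMeasurePreserving_fst.ae (hν e)
    have h2 : ∀ᵐ p ∂(ν e).prod (ν e'), ‖p.2‖ ≤ R :=
      Measure.quasiMeasurePreserving_snd.ae (hν e')
    filter_upwards [h1, h2] with p hp1 hp2
    refine hC p ?_
    simpa [Prod.norm_def] using ⟨hp1, hp2⟩

theorem integral_sq_le_of_probability {Ω : Type*} [MeasurableSpace Ω] (P : Measure Ω)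
    [IsProbabilityMeasure P] {f : Ω → ℝ} (hf : Integrable f P)
    (hf2 : Integrable (fun x => f x ^ 2) P) : (∫ x, f x ∂P) ^ 2 ≤ ∫ x, f x ^ 2 ∂P := by
  have h : 0 ≤ ∫ x, (f x - ∫ y, f y ∂P) ^ 2 ∂P := integral_nonneg fun x => sq_nonneg _
  set c := ∫ y, f y ∂P with hc
  have h2 : ∫ x, (f x - c) ^ 2 ∂P = ∫ x, f x ^ 2 ∂P - c ^ 2 := by
    have : ∀ x, (f x - c) ^ 2 = f x ^ 2 - 2 * c * f x + c ^ 2 := fun x => by ring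
    simp_rw [this]
    have hi : Integrable (fun x => f x ^ 2 - 2 * c * f x) P := hf2.sub (hf.const_mul _)
    rw [integral_add hi (integrable_const _), integral_sub hf2 (hf.const_mul _),
      integral_const_mul, integral_const, ← hc]
    simp
    ring
  linarith

/-- Averaging over a coordinate is an orthogonal projection. -/
theorem integral_sq_sub_eq (e : E) {R : ℝ} (hν : ∀ e, ∀ᵐ t ∂ν e, ‖t‖ ≤ R) {F G : (E → ℂ) → ℝ}
    (hF : Continuous F) (hG : Continuous G) (hGe : ∀ z s, G (Function.update z e s) = G z) :
    ∫ z, (F z - G z) ^ 2 ∂Measure.pi ν = ∫ z, (F z - avg ν e F z) ^ 2 ∂Measure.pi ν +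
      ∫ z, (avg ν e F z - G z) ^ 2 ∂Measure.pi ν := by
  have hA := continuous_avg ν hν e hF
  have i1 := integrable_pi_of_continuous ν hν (F := fun z => (F z - avg ν e F z) ^ 2)
    (by fun_prop)
  have i2 := integrable_pi_of_continuous ν hν (F := fun z => (avg ν e F z - G z) ^ 2)
    (by fun_prop)
  have hc3 : Continuous fun z => 2 * ((F z - avg ν e F z) * (avg ν e F z - G z)) := by fun_prop
  have i3 := integrable_pi_of_continuous ν hν hc3
  have h0 : ∫ z, 2 * ((F z - avg ν e F z) * (avg ν e F z - G z)) ∂Measure.pi ν = 0 := by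
    rw [integral_pi_eq_integral_update ν hν hc3 e]
    refine integral_eq_zero_of_ae (Eventually.of_forall fun z => ?_)
    simp only [avg_update, hGe, Pi.zero_apply]
    rw [integral_const_mul, integral_mul_const, integral_sub, integral_const]
    · simp [avg]
    · exact integrable_of_continuous_entry ν hν
        (hF.comp ((continuous_update_uncurry e).comp (Continuous.prodMk_right z))) e
    · exact integrable_const _
  have i12 : Integrable (fun z => (F z - avg ν e F z) ^ 2 + (avg ν e F z - G z) ^ 2)
    (Measure.pi ν) := i1.add i2
  rw [← integral_add i1 i2]
  rw [← add_zero (∫ z, ((F z - avg ν e F z) ^ 2 + (avg ν e F z - G z) ^ 2) ∂Measure.pi ν), ← h0,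
    ← integral_add i12 i3]
  refine integral_congr_ae (Eventually.of_forall fun z => ?_)
  simp only
  ring

theorem avg_sq_le (e : E) {R : ℝ} (hν : ∀ e, ∀ᵐ t ∂ν e, ‖t‖ ≤ R) {F : (E → ℂ) → ℝ}
    (hF : Continuous F) :
    ∫ z, avg ν e F z ^ 2 ∂Measure.pi ν ≤ ∫ z, F z ^ 2 ∂Measure.pi ν := by
  have h := integral_sq_sub_eq ν e hν hF (G := fun _ => 0) continuous_const (by simp)
  simp only [sub_zero] at h
  rw [h]
  have : 0 ≤ ∫ z, (F z - avg ν e F z) ^ 2 ∂Measure.pi ν := integral_nonneg fun x => sq_nonneg _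
  linarith

/-- The average over the coordinates in a list. -/
noncomputable def listAvg : List E → ((E → ℂ) → ℝ) → (E → ℂ) → ℝ
  | [], F => F
  | e :: l, F => listAvg l (avg ν e F)

/-- Averaging over the coordinates in a list `l` preserves continuity and the mean, and removes the
dependence on the coordinates in `l`. By orthogonality the squared distance of `F` to its average
telescopes, which bounds it by the sum of those to the averages over single coordinates. -/
theorem listAvg_props {R : ℝ} (hν : ∀ e, ∀ᵐ t ∂ν e, ‖t‖ ≤ R) (l : List E) (hl : l.Nodup)
    (F : (E → ℂ) → ℝ) (hF : Continuous F) :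
    Continuous (listAvg ν l F) ∧
    (∫ z, listAvg ν l F z ∂Measure.pi ν = ∫ z, F z ∂Measure.pi ν) ∧
    (∀ e, (e ∈ l ∨ ∀ z s, F (Function.update z e s) = F z) →
      ∀ z s, listAvg ν l F (Function.update z e s) = listAvg ν l F z) ∧
    ∫ z, (F z - listAvg ν l F z) ^ 2 ∂Measure.pi ν ≤
      (l.map fun e => ∫ z, (F z - avg ν e F z) ^ 2 ∂Measure.pi ν).sum := by
  induction l generalizing F with
  | nil => simp [listAvg, hF]
  | cons e l ih =>
    have hA := continuous_avg ν hν e hF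
    obtain ⟨hel, hl⟩ := List.nodup_cons.1 hl
    obtain ⟨c1, c2, c3, c4⟩ := ih hl _ hA
    have hpres : ∀ e', (∀ z s, F (Function.update z e' s) = F z) →
        ∀ z s, avg ν e F (Function.update z e' s) = avg ν e F z := by
      intro e' h z s
      by_cases hee : e' = e
      · subst hee; exact avg_update ν _ F z s
      · simp only [avg]
        simp_rw [Function.update_comm hee, h]
    refine ⟨c1, ?_, ?_, ?_⟩
    · rw [listAvg, c2, integral_pi_eq_integral_update ν hν hF e]; rfl
    · intro e' he' z s
      simp only [listAvg]
      refine c3 e' ?_ z s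
      rcases he' with he' | he'
      · rcases List.mem_cons.1 he' with rfl | h
        · exact Or.inr (avg_update ν _ F)
        · exact Or.inl h
      · exact Or.inr (hpres e' he')
    · simp only [listAvg, List.map_cons, List.sum_cons]
      rw [integral_sq_sub_eq ν e hν hF c1 (fun z s => c3 e (Or.inr (avg_update ν e F)) z s)]
      gcongr
      refine c4.trans (List.sum_le_sum fun e' he' => ?_)
      have hne : e' ≠ e := fun h => hel (h ▸ he')
      rw [avg_comm ν hν hne hF]
      have hA' := continuous_avg ν hν e' hF
      have h := avg_sq_le ν e hν (F := fun z => F z - avg ν e' F z) (hF.sub hA')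
      refine le_trans (le_of_eq ?_) h
      refine integral_congr_ae (Eventually.of_forall fun z => ?_)
      simp only [avg]
      rw [integral_sub]
      · exact integrable_of_continuous_entry ν hν
          (hF.comp ((continuous_update_uncurry e).comp (Continuous.prodMk_right z))) e
      · exact integrable_of_continuous_entry ν hν
          (hA'.comp ((continuous_update_uncurry e).comp (Continuous.prodMk_right z))) e

/-- The Efron–Stein inequality: the variance of a function of independent variables is at most the
sum over the variables of the squared distances to functions not depending on that variable. -/
theorem efronStein_real {R : ℝ} (hν : ∀ e, ∀ᵐ t ∂ν e, ‖t‖ ≤ R) {F : (E → ℂ) → ℝ}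
    (hF : Continuous F) {G : E → (E → ℂ) → ℝ} (hG : ∀ e, Continuous (G e))
    (hGe : ∀ e z s, G e (Function.update z e s) = G e z) :
    ∫ z, (F z - ∫ w, F w ∂Measure.pi ν) ^ 2 ∂Measure.pi ν ≤
      ∑ e, ∫ z, (F z - G e z) ^ 2 ∂Measure.pi ν := by
  obtain ⟨c1, c2, c3, c4⟩ := listAvg_props ν hν Finset.univ.toList (Finset.nodup_toList _) F hF
  have hconst : ∀ z w, listAvg ν Finset.univ.toList F z = listAvg ν Finset.univ.toList F w := by
    intro z w
    set A := listAvg ν Finset.univ.toList F with hA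
    have hstep : ∀ S : Finset E, A (S.piecewise w z) = A z := by
      intro S
      induction S using Finset.induction_on with
      | empty => simp
      | insert e S he ih =>
        rw [Finset.piecewise_insert, c3 e (Or.inl (by simp)), ih]
    have := hstep Finset.univ
    rw [Finset.piecewise_univ] at this
    exact this.symm
  have hval : ∀ z, listAvg ν Finset.univ.toList F z = ∫ w, F w ∂Measure.pi ν := by
    intro z
    rw [← c2]
    simp_rw [hconst _ z]
    simp
  simp_rw [hval] at c4
  refine c4.trans ?_
  rw [Finset.sum_map_toList]
  refine Finset.sum_le_sum fun e _ => ?_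
  rw [integral_sq_sub_eq ν e hν hF (hG e) (hGe e)]
  have : 0 ≤ ∫ z, (avg ν e F z - G e z) ^ 2 ∂Measure.pi ν := integral_nonneg fun x => sq_nonneg _
  linarith

/-- The Efron–Stein inequality for complex functions, from that for real and imaginary parts. -/
theorem efronStein {R : ℝ} (hν : ∀ e, ∀ᵐ t ∂ν e, ‖t‖ ≤ R) {F : (E → ℂ) → ℂ}
    (hF : Continuous F) {G : E → (E → ℂ) → ℂ} (hG : ∀ e, Continuous (G e))
    (hGe : ∀ e z s, G e (Function.update z e s) = G e z) :
    ∫ z, ‖F z - ∫ w, F w ∂Measure.pi ν‖ ^ 2 ∂Measure.pi ν ≤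
      ∑ e, ∫ z, ‖F z - G e z‖ ^ 2 ∂Measure.pi ν := by
  have hi := integrable_pi_of_continuous ν hν hF
  have key : ∀ c : ℂ, ‖c‖ ^ 2 = c.re ^ 2 + c.im ^ 2 := fun c => by
    rw [← Complex.normSq_eq_norm_sq, Complex.normSq_apply]; ring
  have hr := efronStein_real ν hν (F := fun z => (F z).re) (by fun_prop)
    (G := fun e z => (G e z).re) (fun e => by have := hG e; fun_prop) (fun e z s => by rw [hGe])
  have him := efronStein_real ν hν (F := fun z => (F z).im) (by fun_prop)
    (G := fun e z => (G e z).im) (fun e => by have := hG e; fun_prop) (fun e z s => by rw [hGe])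
  have hre : ∫ w, (F w).re ∂Measure.pi ν = (∫ w, F w ∂Measure.pi ν).re := integral_re hi
  have him' : ∫ w, (F w).im ∂Measure.pi ν = (∫ w, F w ∂Measure.pi ν).im := integral_im hi
  rw [hre] at hr
  rw [him'] at him
  simp_rw [key, Complex.sub_re, Complex.sub_im]
  rw [integral_add]
  · refine (add_le_add hr him).trans (le_of_eq ?_)
    rw [← Finset.sum_add_distrib]
    refine Finset.sum_congr rfl fun e _ => ?_
    have := hG e
    rw [integral_add]
    · exact integrable_pi_of_continuous ν hν (by fun_prop)
    · exact integrable_pi_of_continuous ν hν (by fun_prop)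
  · exact integrable_pi_of_continuous ν hν (by fun_prop)
  · exact integrable_pi_of_continuous ν hν (by fun_prop)

end ProductMeasure

end NCProb


namespace NCProb

/-! ### Wigner matrices with independent bounded entries -/

section Ensemble

open Matrix

/-- The index set of the independent entries of `r` Hermitian `n × n` matrices. -/
abbrev Edge (r n : ℕ) : Type := {q : Fin r × Fin n × Fin n // q.2.1 ≤ q.2.2}

/-- The independent entry that determines the `(i, j)` entry of the `v`-th matrix. -/
def edge {r n : ℕ} (v : Fin r) (i j : Fin n) : Edge r n :=
  if h : i ≤ j then ⟨(v, i, j), h⟩ else ⟨(v, j, i), (not_le.1 h).le⟩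

/-- The `(i, j)` entry of a Hermitian matrix as a function of the independent entry; on the
diagonal the real part is taken, so that the matrix is Hermitian for all arguments. -/
noncomputable def entry {n : ℕ} (i j : Fin n) (t : ℂ) : ℂ :=
  if i < j then t else if j < i then star t else (t.re : ℂ)

/-- The Hermitian matrices built from their independent entries. -/
noncomputable def hermitianOf {r n : ℕ} (z : Edge r n → ℂ) (v : Fin r) :
    Matrix (Fin n) (Fin n) ℂ :=
  Matrix.of fun i j => entry i j (z (edge v i j))

/-- The letters `inl v` stand for the random matrices and the letters `inr b` for deterministic
ones. -/
noncomputable def letters {r n : ℕ} {β : Type*} (B : β → Matrix (Fin n) (Fin n) ℂ)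
    (z : Edge r n → ℂ) : Fin r ⊕ β → Matrix (Fin n) (Fin n) ℂ :=
  Sum.elim (hermitianOf z) B

variable {r n : ℕ} {β : Type*}

theorem edge_comm (v : Fin r) (i j : Fin n) : edge v i j = edge v j i := by
  unfold edge
  rcases lt_trichotomy i j with h | h | h
  · rw [dif_pos h.le, dif_neg (not_le.2 h)]
  · subst h; rfl
  · rw [dif_neg (not_le.2 h), dif_pos h.le]

theorem edge_eq_iff {v v' : Fin r} {i j a b : Fin n} :
    edge v' a b = edge v i j ↔ v' = v ∧ ((a = i ∧ b = j) ∨ (a = j ∧ b = i)) := by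
  unfold edge
  split_ifs with h1 h2 h2 <;> simp only [Subtype.mk.injEq, Prod.mk.injEq]
  · constructor
    · tauto
    · rintro ⟨rfl, h | ⟨rfl, rfl⟩⟩
      · tauto
      · have := le_antisymm h1 h2; subst this; simp
  · constructor
    · tauto
    · rintro ⟨rfl, ⟨rfl, rfl⟩ | h⟩
      · exact absurd h1 h2
      · tauto
  · constructor
    · tauto
    · rintro ⟨rfl, ⟨rfl, rfl⟩ | h⟩
      · exact absurd h2 h1
      · tauto
  · constructor
    · tauto
    · rintro ⟨rfl, h | ⟨rfl, rfl⟩⟩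
      · tauto
      · exact absurd ((not_le.1 h1).trans (not_le.1 h2)) (lt_irrefl _)

theorem star_entry (i j : Fin n) (t : ℂ) : star (entry i j t) = entry j i t := by
  unfold entry
  rcases lt_trichotomy i j with h | h | h
  · simp [h, h.not_gt]
  · subst h; simp
  · simp [h, h.not_gt]

theorem norm_entry_le (i j : Fin n) (t : ℂ) : ‖entry i j t‖ ≤ ‖t‖ := by
  unfold entry
  split_ifs
  · exact le_rfl
  · rw [norm_star]
  · rw [Complex.norm_real]; exact Complex.abs_re_le_norm t

theorem continuous_entry (i j : Fin n) : Continuous (entry i j) := by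
  unfold entry
  split_ifs <;> fun_prop

theorem entry_zero (i j : Fin n) : entry i j 0 = 0 := by
  unfold entry; split_ifs <;> simp

theorem isHermitian_hermitianOf (z : Edge r n → ℂ) (v : Fin r) : (hermitianOf z v).IsHermitian := by
  ext i j
  simp [hermitianOf, conjTranspose_apply, star_entry, edge_comm v j i]

theorem continuous_hermitianOf (v : Fin r) :
    Continuous fun z : Edge r n → ℂ => hermitianOf z v := by
  refine continuous_matrix fun i j => ?_
  exact (continuous_entry i j).comp (continuous_apply _)

theorem continuous_letters (B : β → Matrix (Fin n) (Fin n) ℂ) (c : Fin r ⊕ β) :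
    Continuous fun z => letters B z c := by
  cases c with
  | inl v => exact continuous_hermitianOf v
  | inr b => exact continuous_const

theorem continuous_evalWord_letters (B : β → Matrix (Fin n) (Fin n) ℂ) (w : List (Fin r ⊕ β)) :
    Continuous fun z => evalWord (letters B z) w := by
  induction w with
  | nil => exact continuous_const
  | cons c w ih =>
    simp only [evalWord_cons]
    exact (continuous_letters B c).matrix_mul ih

theorem entryPert_apply {m : Type*} [DecidableEq m] (i j a b : m) (y : ℂ) :
    entryPert i j y a b = (if i = a ∧ j = b then y else 0) +
      if i = j then 0 else if j = a ∧ i = b then star y else 0 := by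
  rw [entryPert, Matrix.add_apply, single_apply]
  congr 1
  by_cases h : i = j
  · rw [if_pos h, if_pos h, Matrix.zero_apply]
  · rw [if_neg h, if_neg h, single_apply]

/-- Changing one independent entry is a local perturbation of one letter. -/
theorem letters_update [DecidableEq β] (B : β → Matrix (Fin n) (Fin n) ℂ) (z : Edge r n → ℂ)
    (v : Fin r) (i j : Fin n) (t : ℂ) (c : Fin r ⊕ β) :
    letters B (Function.update z (edge v i j) t) c =
      letters B (Function.update z (edge v i j) 0) c +
        if c = Sum.inl v then entryPert i j (entry i j t) else 0 := by
  cases c with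
  | inr b => simp [letters]
  | inl v' =>
    simp only [letters, Sum.elim_inl, Sum.inl.injEq]
    ext a b
    simp only [hermitianOf, Matrix.of_apply, Matrix.add_apply]
    by_cases h : edge v' a b = edge v i j
    · rw [h, Function.update_self, Function.update_self, entry_zero, zero_add]
      obtain ⟨rfl, h | h⟩ := edge_eq_iff.1 h
      · obtain ⟨rfl, rfl⟩ := h
        rw [if_pos rfl, entryPert_apply, if_pos ⟨rfl, rfl⟩]
        split_ifs with hab h2
        · simp
        · exact absurd h2.2 hab
        · simp
      · obtain ⟨rfl, rfl⟩ := h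
        rw [if_pos rfl, entryPert_apply]
        by_cases hab : b = a
        · subst hab; simp
        · simp [hab, star_entry]
    · rw [Function.update_of_ne h, Function.update_of_ne h]
      split_ifs with hv
      · subst hv
        have h2 : ¬ (a = i ∧ b = j) ∧ ¬ (a = j ∧ b = i) := by
          rw [edge_eq_iff] at h; tauto
        rw [entryPert_apply, if_neg (fun h => h2.1 ⟨h.1.symm, h.2.symm⟩),
          if_neg (c := j = a ∧ i = b) (fun h => h2.2 ⟨h.1.symm, h.2.symm⟩)]
        simp
      · simp

theorem letters_eq_update [DecidableEq β] (B : β → Matrix (Fin n) (Fin n) ℂ) (z : Edge r n → ℂ)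
    (v : Fin r) (i j : Fin n) (c : Fin r ⊕ β) :
    letters B z c = letters B (Function.update z (edge v i j) 0) c +
        if c = Sum.inl v then entryPert i j (entry i j (z (edge v i j))) else 0 := by
  have := letters_update B z v i j (z (edge v i j)) c
  rwa [Function.update_eq_self] at this

theorem entryPert_neg {m : Type*} [DecidableEq m] (i j : m) (y : ℂ) :
    entryPert i j (-y) = -entryPert i j y := by
  ext a b
  rw [Matrix.neg_apply, entryPert_apply, entryPert_apply]
  split_ifs <;> simp [add_comm]

theorem letters_update_zero_eq [DecidableEq β] (B : β → Matrix (Fin n) (Fin n) ℂ)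
    (z : Edge r n → ℂ) (v : Fin r) (i j : Fin n) (c : Fin r ⊕ β) :
    letters B (Function.update z (edge v i j) 0) c = letters B z c +
        if c = Sum.inl v then entryPert i j (-entry i j (z (edge v i j))) else 0 := by
  rw [letters_eq_update B z v i j c, entryPert_neg]
  split_ifs <;> simp [add_comm]

/-- The data for a fixed dimension `n`: independent, centred, bounded entries with variance close
to `1 / n` and with third moments of order `n ^ (-3/2)` off the diagonal, and deterministic matrices
with bounded absolute moments. The parameter `θ` bounds all constants. -/
structure Ensemble (r : ℕ) (β : Type*) (θ : ℝ) (n : ℕ) where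
  ν : Edge r n → Measure ℂ
  prob : ∀ e, IsProbabilityMeasure (ν e)
  norm_le : ∀ e, ∀ᵐ t ∂ν e, ‖t‖ ≤ 2
  centred : ∀ e, ∫ t, t ∂ν e = 0
  sq_le : ∀ e, ∫ t, ‖t‖ ^ 2 ∂ν e ≤ 1 / n
  sq_ge : ∀ e, e.1.2.1 < e.1.2.2 → 1 / n - ∫ t, ‖t‖ ^ 2 ∂ν e ≤ θ / (n * √n)
  cube_le : ∀ e, e.1.2.1 < e.1.2.2 → ∫ t, ‖t‖ ^ 3 ∂ν e ≤ θ / (n * √n)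
  B : β → Matrix (Fin n) (Fin n) ℂ
  absMoment_le : ∀ b k, absMoment k (B b) ≤ n * θ ^ (2 * k)

attribute [instance] Ensemble.prob

namespace Ensemble

variable {θ : ℝ} (𝓜 : Ensemble r β θ n)

/-- The joint law of the independent entries. -/
noncomputable def law : Measure (Edge r n → ℂ) := Measure.pi 𝓜.ν

instance : IsProbabilityMeasure 𝓜.law := by unfold law; infer_instance

/-- The value of a word in the random and deterministic matrices. -/
noncomputable def word (z : Edge r n → ℂ) (w : List (Fin r ⊕ β)) : Matrix (Fin n) (Fin n) ℂ :=
  evalWord (letters 𝓜.B z) w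

theorem continuous_word (w : List (Fin r ⊕ β)) : Continuous fun z => 𝓜.word z w :=
  continuous_evalWord_letters _ w

theorem continuous_word_apply (w : List (Fin r ⊕ β)) (a b : Fin n) :
    Continuous fun z => 𝓜.word z w a b :=
  (continuous_word 𝓜 w).matrix_elem a b

theorem integrable {G : Type*} [NormedAddCommGroup G] [SecondCountableTopology G]
    {F : (Edge r n → ℂ) → G} (hF : Continuous F) : Integrable F 𝓜.law :=
  integrable_pi_of_continuous 𝓜.ν 𝓜.norm_le hF

theorem ae_norm_le : ∀ᵐ z ∂𝓜.law, ∀ e, ‖z e‖ ≤ 2 := ae_pi_norm_le 𝓜.ν 𝓜.norm_le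

theorem integrable_entry {G : Type*} [NormedAddCommGroup G] [SecondCountableTopology G]
    {F : ℂ → G} (hF : Continuous F) (e : Edge r n) : Integrable F (𝓜.ν e) :=
  integrable_of_continuous_entry 𝓜.ν 𝓜.norm_le hF e

theorem continuous_update_zero (e : Edge r n) :
    Continuous fun z : Edge r n → ℂ => Function.update z e 0 :=
  continuous_id.update e continuous_const

theorem integral_entry (v : Fin r) (i j : Fin n) :
    ∫ t, entry i j t ∂𝓜.ν (edge v i j) = 0 := by
  have h := 𝓜.centred (edge v i j)
  unfold entry
  split_ifs
  · exact h
  · have : ∫ t, star t ∂𝓜.ν (edge v i j) = star (∫ t, t ∂𝓜.ν (edge v i j)) := integral_conj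
    rw [this, h, star_zero]
  · rw [integral_complex_ofReal]
    have := integral_re (𝓜.integrable_entry (F := fun t : ℂ => t) continuous_id (edge v i j))
    simp only [RCLike.re_to_complex] at this
    rw [this, h]
    simp

/-- The error bound attached to the `(i, j)` entry. It is of order `n ^ (-3/2)` off the diagonal but
only `1 / n` on it, where no third moment is assumed. -/
noncomputable def errorBound (θ : ℝ) (i j : Fin n) : ℝ :=
  θ / (n * √n) + if i = j then (2 : ℝ) / n else 0

theorem integral_norm_entry_sq_le (v : Fin r) (i j : Fin n) :
    ∫ t, ‖entry i j t‖ ^ 2 ∂𝓜.ν (edge v i j) ≤ 1 / n := by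
  refine le_trans (integral_mono ?_ ?_ fun t => ?_) (𝓜.sq_le (edge v i j))
  · exact 𝓜.integrable_entry ((continuous_entry i j).norm.pow 2) _
  · exact 𝓜.integrable_entry (by fun_prop) _
  · exact pow_le_pow_left₀ (norm_nonneg _) (norm_entry_le i j t) 2

theorem edge_lt {v : Fin r} {i j : Fin n} (h : i ≠ j) :
    (edge v i j).1.2.1 < (edge v i j).1.2.2 := by
  unfold edge
  split_ifs with h1
  · exact lt_of_le_of_ne h1 h
  · exact not_le.1 h1

theorem norm_entry_of_ne {i j : Fin n} (h : i ≠ j) (t : ℂ) : ‖entry i j t‖ = ‖t‖ := by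
  unfold entry
  rcases lt_or_gt_of_ne h with h | h
  · simp [h]
  · simp [h, h.not_gt]

theorem abs_sub_integral_norm_entry_sq_le (hθ : 0 ≤ θ) (v : Fin r) (i j : Fin n) :
    |1 / n - ∫ t, ‖entry i j t‖ ^ 2 ∂𝓜.ν (edge v i j)| ≤ errorBound θ i j := by
  have h1 := 𝓜.integral_norm_entry_sq_le v i j
  rw [abs_of_nonneg (by linarith)]
  unfold errorBound
  split_ifs with h
  · have h2 : 0 ≤ ∫ t, ‖entry i j t‖ ^ 2 ∂𝓜.ν (edge v i j) :=
      integral_nonneg fun t => by positivity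
    have h3 : 0 ≤ θ / (n * √n) := by positivity
    have h4 : (1 : ℝ) / n ≤ 2 / n := by gcongr; norm_num
    linarith
  · simp_rw [norm_entry_of_ne h]
    rw [add_zero]
    exact 𝓜.sq_ge _ (edge_lt h)

theorem integral_norm_entry_cube_le (hθ : 0 ≤ θ) (v : Fin r) (i j : Fin n) :
    ∫ t, ‖entry i j t‖ ^ 3 ∂𝓜.ν (edge v i j) ≤ errorBound θ i j := by
  unfold errorBound
  split_ifs with h
  · have h3 : 0 ≤ θ / (n * √n) := by positivity
    have h1 := 𝓜.integral_norm_entry_sq_le v i j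
    have h2 : ∫ t, ‖entry i j t‖ ^ 3 ∂𝓜.ν (edge v i j) ≤
        ∫ t, 2 * ‖entry i j t‖ ^ 2 ∂𝓜.ν (edge v i j) := by
      refine integral_mono_ae ?_ ?_ ?_
      · exact 𝓜.integrable_entry ((continuous_entry i j).norm.pow 3) _
      · exact 𝓜.integrable_entry (((continuous_entry i j).norm.pow 2).const_mul 2) _
      · filter_upwards [𝓜.norm_le (edge v i j)] with t ht
        have := (norm_entry_le i j t).trans ht
        rw [pow_succ', ]
        gcongr
    rw [integral_const_mul] at h2
    have : (2 : ℝ) / n = 2 * (1 / n) := by ring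
    linarith
  · simp_rw [norm_entry_of_ne h]
    rw [add_zero]
    exact 𝓜.cube_le _ (edge_lt h)

theorem norm_integral_le_of_update {F : (Edge r n → ℂ) → ℂ} (hF : Continuous F) (e : Edge r n)
    {G : (Edge r n → ℂ) → ℝ} (hG : Continuous G)
    (h : ∀ z, ‖∫ t, F (Function.update z e t) ∂𝓜.ν e‖ ≤ G z) :
    ‖∫ z, F z ∂𝓜.law‖ ≤ ∫ z, G z ∂𝓜.law := by
  rw [law, integral_pi_eq_integral_update 𝓜.ν 𝓜.norm_le hF e]
  refine norm_integral_le_of_norm_le (𝓜.integrable hG) (Eventually.of_forall h)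

theorem integral_le_of_update {F : (Edge r n → ℂ) → ℝ} (hF : Continuous F) (e : Edge r n)
    {G : (Edge r n → ℂ) → ℝ} (hG : Continuous G)
    (h : ∀ z, ∫ t, F (Function.update z e t) ∂𝓜.ν e ≤ G z) :
    ∫ z, F z ∂𝓜.law ≤ ∫ z, G z ∂𝓜.law := by
  have hF' : Continuous fun z => ∫ t, F (Function.update z e t) ∂𝓜.ν e :=
    continuous_avg 𝓜.ν 𝓜.norm_le e hF
  rw [law, integral_pi_eq_integral_update 𝓜.ν 𝓜.norm_le hF e]
  exact integral_mono (𝓜.integrable hF') (𝓜.integrable hG) h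

end Ensemble

end Ensemble

end NCProb


namespace NCProb

/-! ### A priori bounds on the expected absolute moments -/

section APriori

open Matrix

variable {r n : ℕ} {β : Type*} {θ : ℝ}

namespace Ensemble

variable (𝓜 : Ensemble r β θ n)

theorem continuous_hermitianOf_pow_apply (v : Fin r) (d : ℕ) (a b : Fin n) :
    Continuous fun z : Edge r n → ℂ => (hermitianOf z v ^ d) a b :=
  ((continuous_hermitianOf v).pow d).matrix_elem a b

theorem localBound_replicate {m α : Type*} [Fintype m] [DecidableEq m] {M : α → Matrix m m ℂ}
    {c : α} {i j : m} {h : ℝ} {K : ℕ}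
    (H : ∀ c' ≤ K, ∀ a b, (a = i ∨ a = j) → (b = i ∨ b = j) → ‖(M c ^ c') a b‖ ≤ h ^ c') (d : ℕ) :
    LocalBound M i j h (List.replicate d c) K := by
  intro V hV hVK a b ha hb
  have hrep : V = List.replicate V.length c :=
    List.eq_replicate_of_mem fun x hx => List.eq_of_mem_replicate (hV.subset hx)
  rw [hrep, evalWord_replicate, List.length_replicate]
  exact H _ hVK a b ha hb

/-- The independence of one entry from the others, combined with the first order expansion in that
entry, reduces a moment of order `2K + 2` to moments of order `2K`. -/
theorem norm_integral_entry_mul_pow_le (v : Fin r) (i j : Fin n) (K : ℕ) :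
    ‖∫ z, hermitianOf z v i j * (hermitianOf z v ^ (2 * K + 1)) j i ∂𝓜.law‖ ≤
      1 / n * (5 ^ (2 * K + 1) * 4 ^ K * (3 * 100 ^ K)) *
        ∫ z, (1 + ((hermitianOf z v ^ (2 * K)) i i).re + ((hermitianOf z v ^ (2 * K)) j j).re)
          ∂𝓜.law := by
  classical
  set e : Edge r n := edge v i j with he
  obtain ⟨d, hd⟩ : ∃ d, d = 2 * K + 1 := ⟨_, rfl⟩
  rw [← hd]
  set S : (Edge r n → ℂ) → ℝ := fun z =>
    1 + ((hermitianOf z v ^ (2 * K)) i i).re + ((hermitianOf z v ^ (2 * K)) j j).re with hS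
  have hScont : Continuous S := by
    have h1 := continuous_hermitianOf_pow_apply (n := n) v (2 * K) i i
    have h2 := continuous_hermitianOf_pow_apply (n := n) v (2 * K) j j
    exact (continuous_const.add (Complex.continuous_re.comp h1)).add
      (Complex.continuous_re.comp h2)
  have hS0cont : Continuous fun z => S (Function.update z e 0) :=
    hScont.comp (continuous_update_zero e)
  have hF : Continuous fun z : Edge r n → ℂ =>
      hermitianOf z v i j * (hermitianOf z v ^ d) j i := by
    have h1 : Continuous fun z : Edge r n → ℂ => hermitianOf z v i j :=
      (continuous_hermitianOf v).matrix_elem i j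
    have h2 := continuous_hermitianOf_pow_apply (n := n) v d j i
    exact h1.mul h2
  -- integrate over the entry `e` first: the zeroth order term vanishes, as the entry is centred
  have step1 := 𝓜.norm_integral_le_of_update hF e
    (G := fun z => 1 / n * (5 ^ d * (4 ^ K * S (Function.update z e 0)))) (by fun_prop) (by
      intro z
      set z0 := Function.update z e 0 with hz0
      obtain ⟨h, h1, hhS, hloc⟩ := exists_local_bound (isHermitian_hermitianOf z0 v) K i j
      have hmain : ∀ t : ℂ, ‖t‖ ≤ 2 →
          ‖entry i j t * (hermitianOf (Function.update z e t) v ^ d) j i -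
            entry i j t * (hermitianOf z0 v ^ d) j i‖ ≤
          ‖entry i j t‖ ^ 2 * (5 ^ d * h ^ (2 * K)) := by
        intro t ht
        have hloc' : LocalBound (letters 𝓜.B z0) i j h
            (List.replicate d (Sum.inl v : Fin r ⊕ β)) (2 * K) :=
          localBound_replicate (M := letters 𝓜.B z0) (c := Sum.inl v) hloc d
        have := norm_evalWord_perturbed_sub_le (letters_update 𝓜.B z v i j t)
          ((norm_entry_le i j t).trans ht) h1 (List.replicate d (Sum.inl v)) [] []
          (k := 2 * K) (by simp [hd]) (by simpa using hloc') j i (Or.inr rfl) (Or.inl rfl)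
        simp only [evalWord_nil, one_mul, mul_one, List.nil_append, List.append_nil,
          List.length_nil, List.length_replicate, evalWord_replicate, add_zero, zero_add] at this
        rw [← mul_sub, norm_mul, sq, mul_assoc]
        refine mul_le_mul_of_nonneg_left ?_ (norm_nonneg _)
        rw [← mul_assoc]
        rwa [show d - 1 = 2 * K by omega] at this
      have hcont : Continuous fun t =>
          entry i j t * (hermitianOf (Function.update z e t) v ^ d) j i :=
        (continuous_entry i j).mul ((continuous_hermitianOf_pow_apply v d j i).comp
          ((continuous_update_uncurry e).comp (Continuous.prodMk_right z)))
      have hcont2 : Continuous fun t => entry i j t * (hermitianOf z0 v ^ d) j i :=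
        (continuous_entry i j).mul continuous_const
      have hint : ∫ t, hermitianOf (Function.update z e t) v i j *
          (hermitianOf (Function.update z e t) v ^ d) j i ∂𝓜.ν e =
          ∫ t, (entry i j t * (hermitianOf (Function.update z e t) v ^ d) j i -
            entry i j t * (hermitianOf z0 v ^ d) j i) ∂𝓜.ν e := by
        rw [integral_sub (𝓜.integrable_entry hcont e) (𝓜.integrable_entry hcont2 e),
          integral_mul_const, he, 𝓜.integral_entry v i j, zero_mul, sub_zero]
        refine integral_congr_ae (Eventually.of_forall fun t => ?_)
        simp [hermitianOf]
      rw [hint]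
      calc _ ≤ ∫ t, ‖entry i j t‖ ^ 2 * (5 ^ d * h ^ (2 * K)) ∂𝓜.ν e := by
            refine norm_integral_le_of_norm_le (𝓜.integrable_entry
              (((continuous_entry i j).norm.pow 2).mul continuous_const) e) ?_
            filter_upwards [𝓜.norm_le e] with t ht using hmain t ht
        _ = (∫ t, ‖entry i j t‖ ^ 2 ∂𝓜.ν e) * (5 ^ d * h ^ (2 * K)) := integral_mul_const _ _
        _ ≤ 1 / n * (5 ^ d * (4 ^ K * S z0)) := by
            have := 𝓜.integral_norm_entry_sq_le v i j
            gcongr)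
  -- put the entry back, by the same local bounds for the perturbation that removes it
  have step2 : ∫ z, S (Function.update z e 0) ∂𝓜.law ≤ ∫ z, 3 * 100 ^ K * S z ∂𝓜.law := by
    refine integral_mono_ae (𝓜.integrable hS0cont) (𝓜.integrable (by fun_prop)) ?_
    filter_upwards [𝓜.ae_norm_le] with z hz
    obtain ⟨h, h1, hhS, hloc⟩ := exists_local_bound (isHermitian_hermitianOf z v) K i j
    have hloc' : LocalBound (letters 𝓜.B z) i j h
        (List.replicate (2 * K) (Sum.inl v : Fin r ⊕ β)) (2 * K) :=
      localBound_replicate (M := letters 𝓜.B z) (c := Sum.inl v) hloc _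
    have key : ∀ a, (a = i ∨ a = j) →
        ((hermitianOf (Function.update z e 0) v ^ (2 * K)) a a).re ≤ 100 ^ K * S z := by
      intro a ha
      have := norm_evalWord_perturbed_le (letters_update_zero_eq 𝓜.B z v i j)
        (by rw [norm_neg]; exact (norm_entry_le i j _).trans (hz _)) h1
        (List.replicate (2 * K) (Sum.inl v)) [] [] (k := 2 * K) (by simp) (by simpa using hloc')
        a a ha ha
      simp only [evalWord_nil, one_mul, mul_one, List.length_nil, List.length_replicate,
        evalWord_replicate, add_zero, pow_zero] at this
      refine (Complex.re_le_norm _).trans (this.trans ?_)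
      rw [mul_pow]
      calc (5 : ℝ) ^ (2 * K) * h ^ (2 * K) ≤ 5 ^ (2 * K) * (4 ^ K * S z) := by gcongr
        _ = 100 ^ K * S z := by
            rw [pow_mul, ← mul_assoc, ← mul_pow]; norm_num
    have hS1 : 1 ≤ S z := by
      have hi := re_even_pow_apply_self_nonneg (isHermitian_hermitianOf z v) K i
      have hj := re_even_pow_apply_self_nonneg (isHermitian_hermitianOf z v) K j
      simp only [hS]; linarith
    have h3 : (1 : ℝ) ≤ 100 ^ K * S z := by
      have : (1 : ℝ) ≤ 100 ^ K := one_le_pow₀ (by norm_num)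
      nlinarith
    have h4 := key i (Or.inl rfl)
    have h5 := key j (Or.inr rfl)
    have h6 : S (Function.update z e 0) = 1 +
      ((hermitianOf (Function.update z e 0) v ^ (2 * K)) i i).re +
      ((hermitianOf (Function.update z e 0) v ^ (2 * K)) j j).re := rfl
    rw [h6]
    linarith
  refine step1.trans ?_
  rw [integral_const_mul, integral_const_mul, integral_const_mul]
  rw [integral_const_mul] at step2
  have hn : (0 : ℝ) ≤ 1 / n := by positivity
  calc 1 / (n : ℝ) * (5 ^ d * (4 ^ K * ∫ z, S (Function.update z e 0) ∂𝓜.law))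
      ≤ 1 / (n : ℝ) * (5 ^ d * (4 ^ K * (3 * 100 ^ K * ∫ z, S z ∂𝓜.law))) := by gcongr
    _ = _ := by ring

/-- The expected even moments of the random matrices are of order `n`, by induction on the order:
each of the `n ^ 2` terms of the trace is bounded by `norm_integral_entry_mul_pow_le`. -/
theorem exists_even_moment_bound (r : ℕ) (β : Type*) (θ : ℝ) (k : ℕ) :
    ∃ C : ℝ, 0 ≤ C ∧ ∀ (n : ℕ) (𝓜 : Ensemble r β θ n) (v : Fin r),
      ∫ z, (trace (hermitianOf z v ^ (2 * k))).re ∂𝓜.law ≤ C * n := by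
  induction k with
  | zero => exact ⟨1, zero_le_one, fun n 𝓜 v => by simp⟩
  | succ K ih =>
    obtain ⟨C, hC, hih⟩ := ih
    set D : ℝ := 5 ^ (2 * K + 1) * 4 ^ K * (3 * 100 ^ K) with hD
    have hD0 : 0 ≤ D := by positivity
    clear_value D
    refine ⟨D * (1 + 2 * C), by positivity, fun n 𝓜 v => ?_⟩
    have hS : ∀ i : Fin n, Integrable (fun z => ((hermitianOf z v ^ (2 * K)) i i).re) 𝓜.law :=
      fun i => 𝓜.integrable
        (Complex.continuous_re.comp (continuous_hermitianOf_pow_apply v (2 * K) i i))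
    have hFint : ∀ i j : Fin n, Integrable (fun z =>
        hermitianOf z v i j * (hermitianOf z v ^ (2 * K + 1)) j i) 𝓜.law := fun i j =>
      𝓜.integrable (((continuous_hermitianOf v).matrix_elem i j).mul
        (continuous_hermitianOf_pow_apply v _ j i))
    have h1 : ∀ z : Edge r n → ℂ, trace (hermitianOf z v ^ (2 * (K + 1))) =
        ∑ i, ∑ j, hermitianOf z v i j * (hermitianOf z v ^ (2 * K + 1)) j i := by
      intro z
      rw [show 2 * (K + 1) = 2 * K + 1 + 1 by ring, pow_succ']
      simp [trace, mul_apply]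
    have h2 : ∫ z, (trace (hermitianOf z v ^ (2 * (K + 1)))).re ∂𝓜.law =
        (∑ i, ∑ j, ∫ z, hermitianOf z v i j * (hermitianOf z v ^ (2 * K + 1)) j i ∂𝓜.law).re := by
      simp_rw [h1]
      have hi : Integrable (fun z => ∑ i, ∑ j,
          hermitianOf z v i j * (hermitianOf z v ^ (2 * K + 1)) j i) 𝓜.law :=
        integrable_finsetSum _ fun i _ => integrable_finsetSum _ fun j _ => hFint i j
      have := integral_re hi
      simp only [RCLike.re_to_complex] at this
      rw [this, integral_finsetSum _ fun i _ => integrable_finsetSum _ fun j _ => hFint i j]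
      congr 1
      exact Finset.sum_congr rfl fun i _ => integral_finsetSum _ fun j _ => hFint i j
    rw [h2]
    set s : Fin n → ℝ := fun i => ∫ z, ((hermitianOf z v ^ (2 * K)) i i).re ∂𝓜.law with hs
    have hsum : ∑ i, s i ≤ C * n := by
      refine le_trans (le_of_eq ?_) (hih n 𝓜 v)
      rw [← integral_finsetSum _ fun i _ => hS i]
      simp [trace]
    calc _ ≤ ∑ i : Fin n, ∑ j : Fin n,
          ‖∫ z, hermitianOf z v i j * (hermitianOf z v ^ (2 * K + 1)) j i ∂𝓜.law‖ := by
          refine (Complex.re_le_norm _).trans ((norm_sum_le _ _).trans ?_)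
          exact Finset.sum_le_sum fun i _ => norm_sum_le _ _
      _ ≤ ∑ i : Fin n, ∑ j : Fin n, 1 / n * D * (1 + s i + s j) := by
          refine Finset.sum_le_sum fun i _ => Finset.sum_le_sum fun j _ => ?_
          refine (𝓜.norm_integral_entry_mul_pow_le v i j K).trans (le_of_eq ?_)
          have hi1 : Integrable (fun z => 1 + ((hermitianOf z v ^ (2 * K)) i i).re) 𝓜.law :=
            (integrable_const _).add (hS i)
          rw [integral_add hi1 (hS j), integral_add (integrable_const _) (hS i)]
          simp [hs, hD]
      _ = D * ((1 / n * n) * n + 2 * (1 / n * n) * ∑ i, s i) := by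
          simp only [← Finset.mul_sum, Finset.sum_add_distrib, Finset.sum_const, Finset.card_univ,
            Fintype.card_fin, nsmul_eq_mul, mul_one]
          ring
      _ ≤ D * (1 + 2 * C) * n := by
          rcases Nat.eq_zero_or_pos n with h0 | h0
          · subst h0; simp
          · have : (n : ℝ) ≠ 0 := by positivity
            rw [one_div, inv_mul_cancel₀ this, mul_assoc D]
            refine mul_le_mul_of_nonneg_left ?_ hD0
            linarith

theorem absMoment_conjTranspose {m : Type*} [Fintype m] [DecidableEq m] (k : ℕ)
    (M : Matrix m m ℂ) : absMoment k Mᴴ = absMoment k M := by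
  rw [absMoment, absMoment, conjTranspose_conjTranspose, trace_mul_pow_comm]

theorem continuous_absMoment_letters (k : ℕ) (c : Fin r ⊕ β) :
    Continuous fun z => absMoment k (letters 𝓜.B z c) := by
  have := continuous_letters 𝓜.B c
  unfold absMoment
  exact Complex.continuous_re.comp
    ((this.matrix_mul this.matrix_conjTranspose).pow k).matrix_trace

theorem continuous_absMoment_word (k : ℕ) (w : List (Fin r ⊕ β)) :
    Continuous fun z => absMoment k (𝓜.word z w) := by
  have := 𝓜.continuous_word w
  unfold absMoment
  exact Complex.continuous_re.comp
    ((this.matrix_mul this.matrix_conjTranspose).pow k).matrix_trace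

theorem exists_absMoment_letter_bound (r : ℕ) (β : Type*) (θ : ℝ) (k : ℕ) (c : Fin r ⊕ β) :
    ∃ C : ℝ, ∀ (n : ℕ) (𝓜 : Ensemble r β θ n),
      ∫ z, absMoment k (letters 𝓜.B z c) ∂𝓜.law ≤ C * n := by
  cases c with
  | inl v =>
    obtain ⟨C, -, hC⟩ := exists_even_moment_bound r β θ k
    refine ⟨C, fun n 𝓜 => ?_⟩
    refine le_trans (le_of_eq ?_) (hC n 𝓜 v)
    refine integral_congr_ae (Eventually.of_forall fun z => ?_)
    exact absMoment_of_isHermitian (isHermitian_hermitianOf z v) k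
  | inr b =>
    refine ⟨θ ^ (2 * k), fun n 𝓜 => ?_⟩
    have := 𝓜.absMoment_le b k
    simp only [letters, Sum.elim_inr, integral_const, probReal_univ, one_smul]
    linarith

/-- The absolute moments of a word are bounded by those of its letters. -/
theorem absMoment_evalWord_le {m α : Type*} [Fintype m] [DecidableEq m] (M : α → Matrix m m ℂ)
    (w : List α) (p : ℕ) :
    absMoment p (evalWord M w) ≤
      2 * p * (w.map fun c => absMoment (2 ^ (2 * p * w.length)) (M c)).sum +
        2 ^ (2 * p * w.length + 1) * Fintype.card m := by
  set l := 2 * p * w.length with hl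
  -- write `(W * Wᴴ) ^ p` as a product of letters and adjoints of letters
  have hL : ∀ p : ℕ, ∃ L : List (Matrix m m ℂ), L.length = 2 * p * w.length ∧
      L.prod = (evalWord M w * (evalWord M w)ᴴ) ^ p ∧
      (L.map (absMoment (2 ^ l))).sum =
        2 * p * (w.map fun c => absMoment (2 ^ l) (M c)).sum := by
    intro p
    induction p with
    | zero => exact ⟨[], by simp⟩
    | succ p ih =>
      obtain ⟨L, h1, h2, h3⟩ := ih
      refine ⟨w.map M ++ ((w.map M).map conjTranspose).reverse ++ L, ?_, ?_, ?_⟩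
      · simp [h1]; ring
      · rw [List.prod_append, List.prod_append, h2, ← conjTranspose_list_prod, pow_succ']
        rfl
      · rw [List.map_append, List.map_append, List.sum_append, List.sum_append, h3,
          List.map_reverse, List.sum_reverse, List.map_map, List.map_map, List.map_map]
        have : ((absMoment (2 ^ l) ∘ conjTranspose) ∘ M) = fun c => absMoment (2 ^ l) (M c) := by
          ext c; simp [absMoment_conjTranspose]
        rw [this]
        simp only [Function.comp_def]
        push_cast
        ring
  obtain ⟨L, h1, h2, h3⟩ := hL p
  have h4 := norm_trace_prod_le_sum l L (by
    rw [h1, ← hl, pow_succ]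
    have := (Nat.lt_two_pow_self (n := l)).le
    omega)
  rw [h2, h3] at h4
  exact (Complex.re_le_norm _).trans h4

/-- The expected absolute moments of all words are of order `n`. -/
theorem exists_absMoment_word_bound (r : ℕ) (β : Type*) (θ : ℝ) (p : ℕ) (w : List (Fin r ⊕ β)) :
    ∃ C : ℝ, 0 ≤ C ∧ ∀ (n : ℕ) (𝓜 : Ensemble r β θ n),
      ∫ z, absMoment p (𝓜.word z w) ∂𝓜.law ≤ C * n := by
  set l := 2 * p * w.length with hl
  choose C hC using exists_absMoment_letter_bound r β θ (2 ^ l)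
  refine ⟨|2 * p * (w.map C).sum + 2 ^ (l + 1)|, abs_nonneg _, fun n 𝓜 => ?_⟩
  have hint : ∀ w' : List (Fin r ⊕ β),
      Integrable (fun z => (w'.map fun c => absMoment (2 ^ l) (letters 𝓜.B z c)).sum) 𝓜.law ∧
      ∫ z, (w'.map fun c => absMoment (2 ^ l) (letters 𝓜.B z c)).sum ∂𝓜.law ≤
        (w'.map C).sum * n := by
    intro w'
    induction w' with
    | nil => simp
    | cons c w' ih =>
      have hi := 𝓜.integrable (𝓜.continuous_absMoment_letters (2 ^ l) c)
      simp only [List.map_cons, List.sum_cons]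
      refine ⟨hi.add ih.1, ?_⟩
      rw [integral_add hi ih.1]
      linarith [ih.2, hC c n 𝓜]
  calc ∫ z, absMoment p (𝓜.word z w) ∂𝓜.law
      ≤ ∫ z, (2 * p * (w.map fun c => absMoment (2 ^ l) (letters 𝓜.B z c)).sum +
          2 ^ (l + 1) * n) ∂𝓜.law := by
        refine integral_mono (𝓜.integrable (𝓜.continuous_absMoment_word p w))
          (((hint w).1.const_mul _).add (integrable_const _)) fun z => ?_
        have := absMoment_evalWord_le (letters 𝓜.B z) w p
        rwa [Fintype.card_fin] at this
    _ ≤ (2 * p * (w.map C).sum + 2 ^ (l + 1)) * n := by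
        rw [integral_add ((hint w).1.const_mul _) (integrable_const _), integral_const_mul]
        simp only [integral_const, probReal_univ, one_smul]
        have h2 : (0 : ℝ) ≤ 2 * p := by positivity
        nlinarith [mul_le_mul_of_nonneg_left (hint w).2 h2]
    _ ≤ _ := by gcongr; exact le_abs_self _

end Ensemble

end APriori

end NCProb


namespace NCProb

/-! ### Moments of the local size of a family of matrices -/

section LocalSize

open Matrix

variable {m : Type*} [Fintype m] [DecidableEq m] {α : Type*}

/-- A bound for the entries at the positions `(i, i)`, `(i, j)`, `(j, i)`, `(j, j)` of all subwords
(sublists) of `L`. -/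
noncomputable def locSize (M : α → Matrix m m ℂ) (i j : m) (L : List α) : ℝ :=
  1 + (L.sublists.map fun V => ‖evalWord M V i i‖ + ‖evalWord M V i j‖ + ‖evalWord M V j i‖ +
    ‖evalWord M V j j‖).sum

theorem locSize_term_le (M : α → Matrix m m ℂ) (i j : m) {L V : List α} (hV : V.Sublist L) :
    ‖evalWord M V i i‖ + ‖evalWord M V i j‖ + ‖evalWord M V j i‖ + ‖evalWord M V j j‖ ≤
      locSize M i j L - 1 := by
  unfold locSize
  rw [add_sub_cancel_left]
  refine List.single_le_sum ?_ _ (List.mem_map_of_mem (List.mem_sublists.2 hV))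
  simp only [List.mem_map]
  rintro x ⟨V, -, rfl⟩
  positivity

theorem one_le_locSize (M : α → Matrix m m ℂ) (i j : m) (L : List α) : 1 ≤ locSize M i j L := by
  have := locSize_term_le M i j (L.nil_sublist)
  have h : 0 ≤ ‖evalWord M [] i i‖ + ‖evalWord M [] i j‖ + ‖evalWord M [] j i‖ +
    ‖evalWord M [] j j‖ := by positivity
  linarith

theorem norm_apply_le_locSize (M : α → Matrix m m ℂ) {i j : m} {L V : List α} (hV : V.Sublist L)
    {a b : m} (ha : a = i ∨ a = j) (hb : b = i ∨ b = j) :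
    ‖evalWord M V a b‖ ≤ locSize M i j L := by
  have := locSize_term_le M i j hV
  have h1 := norm_nonneg (evalWord M V i i)
  have h2 := norm_nonneg (evalWord M V i j)
  have h3 := norm_nonneg (evalWord M V j i)
  have h4 := norm_nonneg (evalWord M V j j)
  rcases ha with rfl | rfl <;> rcases hb with rfl | rfl <;> linarith

theorem localBound_locSize (M : α → Matrix m m ℂ) (i j : m) {L L' : List α} (hL : L'.Sublist L)
    (k : ℕ) : LocalBound M i j (locSize M i j L) L' k := by
  intro V hV _ a b ha hb
  have h1 := one_le_locSize M i j L
  cases V with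
  | nil =>
    simp only [evalWord_nil, one_apply, List.length_nil, pow_zero]
    split_ifs <;> simp
  | cons c V =>
    refine (norm_apply_le_locSize M (hV.sublist.trans hL) ha hb).trans ?_
    exact le_self_pow₀ h1 (by simp)

variable {M M₀ : α → Matrix m m ℂ} {ℓ : α} {i j : m} {y : ℂ}

theorem norm_apply_le_five_locSize {L V : List α} (hV : V.Sublist L) {a b : m}
    (ha : a = i ∨ a = j) (hb : b = i ∨ b = j) :
    ‖evalWord M₀ V a b‖ ≤ (5 * locSize M₀ i j L) ^ L.length := by
  have h1 := one_le_locSize M₀ i j L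
  refine (localBound_locSize M₀ i j hV V.length V List.infix_rfl le_rfl a b ha hb).trans ?_
  calc locSize M₀ i j L ^ V.length ≤ locSize M₀ i j L ^ L.length :=
        pow_le_pow_right₀ h1 hV.length_le
    _ ≤ _ := by gcongr; linarith

variable [DecidableEq α]

theorem norm_perturbed_apply_le_five_locSize
    (hM : ∀ c, M c = M₀ c + if c = ℓ then entryPert i j y else 0)
    (hy : ‖y‖ ≤ 2) {L V V' : List α} (hV : (V ++ V').Sublist L) {a b : m}
    (ha : a = i ∨ a = j) (hb : b = i ∨ b = j) :
    ‖(evalWord M V * evalWord M₀ V') a b‖ ≤ (5 * locSize M₀ i j L) ^ L.length := by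
  have h1 := one_le_locSize M₀ i j L
  have h := norm_evalWord_perturbed_le hM hy h1 V [] V' (k := (V ++ V').length) (by simp)
    (localBound_locSize M₀ i j hV _) a b ha hb
  simp only [evalWord_nil, one_mul, List.length_nil, pow_zero] at h
  refine h.trans (pow_le_pow_right₀ (by linarith) ?_)
  simpa using hV.length_le

theorem norm_perturbed_sub_apply_le_five_locSize
    (hM : ∀ c, M c = M₀ c + if c = ℓ then entryPert i j y else 0)
    (hy : ‖y‖ ≤ 2) {L V V' : List α} (hV : (V ++ V').Sublist L) {a b : m}
    (ha : a = i ∨ a = j) (hb : b = i ∨ b = j) :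
    ‖(evalWord M V * evalWord M₀ V') a b - evalWord M₀ (V ++ V') a b‖ ≤
      ‖y‖ * (5 * locSize M₀ i j L) ^ L.length := by
  have h1 := one_le_locSize M₀ i j L
  have h := norm_evalWord_perturbed_sub_le hM hy h1 V [] V' (k := (V ++ V').length) (by simp)
    (localBound_locSize M₀ i j hV _) a b ha hb
  simp only [evalWord_nil, one_mul, List.length_nil, List.nil_append, zero_add] at h
  refine h.trans ?_
  have hl : V.length + V'.length ≤ L.length := by simpa using hV.length_le
  rw [mul_assoc, mul_pow]
  gcongr
  · norm_num
  · omega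

theorem norm_second_order_apply_le_five_locSize
    (hM : ∀ c, M c = M₀ c + if c = ℓ then entryPert i j y else 0)
    (hy : ‖y‖ ≤ 2) {L : List α} {a b : m} (ha : a = i ∨ a = j) (hb : b = i ∨ b = j) :
    ‖(evalWord M L - evalWord M₀ L - linearTerm M₀ ℓ (entryPert i j y) L) a b‖ ≤
      ‖y‖ ^ 2 * (5 * locSize M₀ i j L) ^ L.length := by
  have h := norm_evalWord_second_order_le hM hy (one_le_locSize M₀ i j L) L []
    (localBound_locSize M₀ i j (List.Sublist.refl L) _) a b ha hb
  simpa using h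

theorem list_sum_le_length_mul {l : List ℝ} {B : ℝ} (h : ∀ x ∈ l, x ≤ B) :
    l.sum ≤ l.length * B := by
  have := List.sum_le_card_nsmul l B h
  rwa [nsmul_eq_mul] at this

/-- A perturbation of the entries `(i, j)` and `(j, i)` of one letter changes the local size at most
polynomially. -/
theorem locSize_perturbed_le (hM : ∀ c, M c = M₀ c + if c = ℓ then entryPert i j y else 0)
    (hy : ‖y‖ ≤ 2) (L : List α) :
    locSize M i j L ≤ (1 + 4 * 2 ^ L.length) * (5 * locSize M₀ i j L) ^ L.length := by
  have h1 := one_le_locSize M₀ i j L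
  set Q := (5 * locSize M₀ i j L) ^ L.length with hQ
  have hQ1 : 1 ≤ Q := one_le_pow₀ (by linarith)
  have h : (L.sublists.map fun V => ‖evalWord M V i i‖ + ‖evalWord M V i j‖ + ‖evalWord M V j i‖ +
      ‖evalWord M V j j‖).sum ≤ 2 ^ L.length * (4 * Q) := by
    refine (list_sum_le_length_mul (B := 4 * Q) ?_).trans (le_of_eq (by simp))
    simp only [List.mem_map, List.mem_sublists]
    rintro x ⟨V, hV, rfl⟩
    have key : ∀ a b, (a = i ∨ a = j) → (b = i ∨ b = j) → ‖evalWord M V a b‖ ≤ Q := by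
      intro a b ha hb
      have := norm_perturbed_apply_le_five_locSize hM hy (V := V) (V' := []) (L := L)
        (by simpa using hV) ha hb
      simpa using this
    have k1 := key i i (Or.inl rfl) (Or.inl rfl)
    have k2 := key i j (Or.inl rfl) (Or.inr rfl)
    have k3 := key j i (Or.inr rfl) (Or.inl rfl)
    have k4 := key j j (Or.inr rfl) (Or.inr rfl)
    linarith
  unfold locSize at *
  linarith

theorem one_add_list_sum_pow_le (q : ℕ) (l : List ℝ) (hl : ∀ x ∈ l, 0 ≤ x) :
    (1 + l.sum) ^ q ≤ (1 + l.length) ^ q * (1 + (l.map (· ^ q)).sum) := by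
  have h : ∃ B : ℝ, 1 ≤ B ∧ (∀ x ∈ l, x ≤ B) ∧ B ^ q ≤ 1 + (l.map (· ^ q)).sum := by
    induction l with
    | nil => exact ⟨1, by simp⟩
    | cons a l ih =>
      obtain ⟨B, h1, h2, h3⟩ := ih fun x hx => hl x (by simp [hx])
      have ha : 0 ≤ a := hl a (by simp)
      have hs : 0 ≤ (l.map (· ^ q)).sum := List.sum_nonneg (by
        simp only [List.mem_map]
        rintro x ⟨y, hy, rfl⟩
        have := hl y (by simp [hy])
        positivity)
      refine ⟨max B a, le_max_of_le_left h1, ?_, ?_⟩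
      · intro x hx
        rcases List.mem_cons.1 hx with rfl | hx
        · exact le_max_right _ _
        · exact le_max_of_le_left (h2 x hx)
      · simp only [List.map_cons, List.sum_cons]
        have : 0 ≤ a ^ q := by positivity
        rcases max_choice B a with h | h <;> rw [h] <;> linarith
  obtain ⟨B, h1, h2, h3⟩ := h
  have h4 := list_sum_le_length_mul h2
  have h5 : 0 ≤ l.sum := List.sum_nonneg hl
  calc (1 + l.sum) ^ q ≤ ((1 + l.length) * B) ^ q := by gcongr; nlinarith
    _ = (1 + l.length) ^ q * B ^ q := mul_pow _ _ _
    _ ≤ _ := by gcongr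

/-- The contribution of the row `a` to the moments of the local size. -/
noncomputable def rowSize (M : α → Matrix m m ℂ) (q : ℕ) (L : List α) (a : m) : ℝ :=
  (L.sublists.map fun V => (((evalWord M V * (evalWord M V)ᴴ) ^ q) a a).re).sum

omit [DecidableEq α] in
theorem rowSize_nonneg (M : α → Matrix m m ℂ) (q : ℕ) (L : List α) (a : m) :
    0 ≤ rowSize M q L a := by
  refine List.sum_nonneg ?_
  simp only [List.mem_map]
  rintro x ⟨V, -, rfl⟩
  exact re_pow_apply_self_nonneg _ _ _

omit [DecidableEq α] in
/-- Powers of the local size are bounded by diagonal entries of powers of `W * Wᴴ`, `W` running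
over the subwords: these can be summed to absolute moments. -/
theorem locSize_pow_le (M : α → Matrix m m ℂ) (i j : m) (L : List α) (q : ℕ) :
    locSize M i j L ^ q ≤ ((1 + 2 ^ L.length) ^ q * (4 ^ q * 4 * (1 + 2 ^ L.length))) *
      (1 + rowSize M q L i + rowSize M q L j) := by
  set s : List α → ℝ := fun V => ‖evalWord M V i i‖ + ‖evalWord M V i j‖ + ‖evalWord M V j i‖ +
      ‖evalWord M V j j‖ with hs
  set P : List α → m → ℝ := fun V a => (((evalWord M V * (evalWord M V)ᴴ) ^ q) a a).re with hP
  have hs0 : ∀ V, 0 ≤ s V := fun V => by positivity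
  have hP0 : ∀ V a, 0 ≤ P V a := fun V a => re_pow_apply_self_nonneg _ _ _
  have hent : ∀ V a b, ‖evalWord M V a b‖ ^ q ≤ 1 + P V a := by
    intro V a b
    have h1 : ‖evalWord M V a b‖ ^ (2 * q) ≤ P V a := norm_apply_pow_le _ _ _ _
    rw [mul_comm, pow_mul] at h1
    nlinarith [sq_nonneg (‖evalWord M V a b‖ ^ q - 1)]
  have hsq : ∀ V, s V ^ q ≤ 4 ^ q * (4 + 2 * P V i + 2 * P V j) := by
    intro V
    have hmax : ∃ B, s V ≤ 4 * B ∧ 0 ≤ B ∧ B ^ q ≤ 4 + 2 * P V i + 2 * P V j := by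
      have e1 := hent V i i
      have e2 := hent V i j
      have e3 := hent V j i
      have e4 := hent V j j
      have p1 := hP0 V i
      have p2 := hP0 V j
      refine ⟨max (max ‖evalWord M V i i‖ ‖evalWord M V i j‖)
        (max ‖evalWord M V j i‖ ‖evalWord M V j j‖), ?_, by positivity, ?_⟩
      · have f1 : ‖evalWord M V i i‖ ≤ max (max ‖evalWord M V i i‖ ‖evalWord M V i j‖)
          (max ‖evalWord M V j i‖ ‖evalWord M V j j‖) := by simp
        have f2 : ‖evalWord M V i j‖ ≤ max (max ‖evalWord M V i i‖ ‖evalWord M V i j‖)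
          (max ‖evalWord M V j i‖ ‖evalWord M V j j‖) := by simp
        have f3 : ‖evalWord M V j i‖ ≤ max (max ‖evalWord M V i i‖ ‖evalWord M V i j‖)
          (max ‖evalWord M V j i‖ ‖evalWord M V j j‖) := by simp
        have f4 : ‖evalWord M V j j‖ ≤ max (max ‖evalWord M V i i‖ ‖evalWord M V i j‖)
          (max ‖evalWord M V j i‖ ‖evalWord M V j j‖) := by simp
        simp only [hs]
        linarith
      · rcases max_choice (max ‖evalWord M V i i‖ ‖evalWord M V i j‖)
          (max ‖evalWord M V j i‖ ‖evalWord M V j j‖) with h | h <;> rw [h]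
        · rcases max_choice ‖evalWord M V i i‖ ‖evalWord M V i j‖ with h | h <;> rw [h] <;> linarith
        · rcases max_choice ‖evalWord M V j i‖ ‖evalWord M V j j‖ with h | h <;> rw [h] <;> linarith
    obtain ⟨B, h1, h2, h3⟩ := hmax
    calc s V ^ q ≤ (4 * B) ^ q := pow_le_pow_left₀ (hs0 V) h1 q
      _ = 4 ^ q * B ^ q := mul_pow _ _ _
      _ ≤ _ := by gcongr
  have hlist : ∀ l : List (List α), ((l.map s).map (· ^ q)).sum ≤
      4 ^ q * (4 * l.length + 2 * (l.map fun V => P V i).sum + 2 * (l.map fun V => P V j).sum) := by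
    intro l
    induction l with
    | nil => simp
    | cons V l ih =>
      simp only [List.map_cons, List.sum_cons, List.length_cons]
      push_cast
      have := hsq V
      nlinarith
  have h1 := one_add_list_sum_pow_le q (L.sublists.map s) (by
    simp only [List.mem_map]
    rintro x ⟨V, -, rfl⟩
    exact hs0 V)
  rw [List.length_map, List.length_sublists] at h1
  push_cast at h1
  refine h1.trans ?_
  rw [mul_assoc]
  refine mul_le_mul_of_nonneg_left ?_ (by positivity)
  have h2 := hlist L.sublists
  rw [List.length_sublists] at h2
  push_cast at h2
  have hr1 := rowSize_nonneg M q L i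
  have hr2 := rowSize_nonneg M q L j
  have e1 : rowSize M q L i = (L.sublists.map fun V => P V i).sum := rfl
  have e2 : rowSize M q L j = (L.sublists.map fun V => P V j).sum := rfl
  rw [← e1, ← e2] at h2
  have h4 : (1 : ℝ) ≤ 4 ^ q := one_le_pow₀ (by norm_num)
  have h5 : (1 : ℝ) ≤ 2 ^ L.length := one_le_pow₀ (by norm_num)
  set A : ℝ := 2 ^ L.length
  set R := rowSize M q L i + rowSize M q L j with hR
  have hR0 : 0 ≤ R := by positivity
  have h6 : 1 + 4 ^ q * (4 * A + 2 * R) ≤ 4 ^ q * 4 * (1 + A) * (1 + R) := by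
    have h7 : 1 + (4 * A + 2 * R) ≤ 4 * (1 + A) * (1 + R) := by nlinarith
    calc 1 + 4 ^ q * (4 * A + 2 * R) ≤ 4 ^ q * 1 + 4 ^ q * (4 * A + 2 * R) := by linarith
      _ = 4 ^ q * (1 + (4 * A + 2 * R)) := by ring
      _ ≤ 4 ^ q * (4 * (1 + A) * (1 + R)) := by gcongr
      _ = _ := by ring
  rw [add_assoc 1]
  refine le_trans ?_ h6
  rw [hR]
  linarith

end LocalSize

section LocalMoments

open Matrix

variable {r n : ℕ} {β : Type*} {θ : ℝ}

theorem integral_list_sum {Ω G ι : Type*} [MeasurableSpace Ω] {P : Measure Ω}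
    [NormedAddCommGroup G] [NormedSpace ℝ G] (l : List ι) (f : ι → Ω → G)
    (hf : ∀ q ∈ l, Integrable (f q) P) :
    Integrable (fun z => (l.map fun q => f q z).sum) P ∧
      ∫ z, (l.map fun q => f q z).sum ∂P = (l.map fun q => ∫ z, f q z ∂P).sum := by
  induction l with
  | nil => simp
  | cons q l ih =>
    obtain ⟨h1, h2⟩ := ih fun q' hq' => hf q' (by simp [hq'])
    have h3 := hf q (by simp)
    simp only [List.map_cons, List.sum_cons]
    exact ⟨h3.add h1, by rw [integral_add h3 h1, h2]⟩

namespace Ensemble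

variable (𝓜 : Ensemble r β θ n)

theorem continuous_locSize (i j : Fin n) (L : List (Fin r ⊕ β)) :
    Continuous fun z => locSize (letters 𝓜.B z) i j L := by
  have h : ∀ V a b, Continuous fun z => ‖evalWord (letters 𝓜.B z) V a b‖ := fun V a b =>
    (𝓜.continuous_word_apply V a b).norm
  refine continuous_const.add (continuous_list_sum _ fun V _ => ?_)
  exact (((h V i i).add (h V i j)).add (h V j i)).add (h V j j)

theorem continuous_rowSize (q : ℕ) (L : List (Fin r ⊕ β)) (a : Fin n) :
    Continuous fun z => rowSize (letters 𝓜.B z) q L a := by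
  refine continuous_list_sum _ fun V _ => ?_
  have := 𝓜.continuous_word V
  exact Complex.continuous_re.comp
    (((this.matrix_mul this.matrix_conjTranspose).pow q).matrix_elem a a)

/-- The moments of the local size, computed after an entry has been set to zero, are bounded on
average over the pairs of rows. -/
theorem exists_locSize_moment_bound (r : ℕ) (β : Type*) (θ : ℝ) (L : List (Fin r ⊕ β)) (p : ℕ) :
    ∃ C : ℝ, 0 ≤ C ∧ ∀ (n : ℕ) (𝓜 : Ensemble r β θ n), ∃ U : Fin n → ℝ, (∀ i, 0 ≤ U i) ∧
      ∑ i, U i ≤ C * n ∧ ∀ v i j,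
        ∫ z, (5 * locSize (letters 𝓜.B (Function.update z (edge v i j) 0)) i j L) ^ p ∂𝓜.law ≤
          U i + U j := by
  classical
  set l := L.length with hl
  set q := l * p with hq
  choose C hC0 hC using exists_absMoment_word_bound r β θ q
  set A : ℝ := (5 * ((1 + 4 * 2 ^ l) * 5 ^ l)) ^ p with hA
  set D : ℝ := (1 + 2 ^ l) ^ q * (4 ^ q * 4 * (1 + 2 ^ l)) with hD
  have hA0 : 0 ≤ A := by positivity
  have hD0 : 0 ≤ D := by positivity
  refine ⟨A * D * (1 + (L.sublists.map C).sum), ?_, fun n 𝓜 => ?_⟩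
  · have : 0 ≤ (L.sublists.map C).sum := List.sum_nonneg (by
      simp only [List.mem_map]
      rintro x ⟨V, -, rfl⟩
      exact hC0 V)
    positivity
  have hrow : ∀ i, Integrable (fun z => rowSize (letters 𝓜.B z) q L i) 𝓜.law :=
    fun i => 𝓜.integrable (𝓜.continuous_rowSize q L i)
  refine ⟨fun i => A * D * (1 + ∫ z, rowSize (letters 𝓜.B z) q L i ∂𝓜.law), fun i => ?_, ?_, ?_⟩
  · have : 0 ≤ ∫ z, rowSize (letters 𝓜.B z) q L i ∂𝓜.law :=
      integral_nonneg fun z => rowSize_nonneg _ _ _ _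
    positivity
  · rw [← Finset.mul_sum, mul_assoc (A * D)]
    refine mul_le_mul_of_nonneg_left ?_ (by positivity)
    rw [Finset.sum_add_distrib, ← integral_finsetSum _ fun i _ => hrow i, add_mul]
    simp only [Finset.sum_const, Finset.card_univ, Fintype.card_fin, nsmul_eq_mul, mul_one, one_mul]
    gcongr
    have h1 : ∀ z, ∑ i, rowSize (letters 𝓜.B z) q L i =
        (L.sublists.map fun V => absMoment q (𝓜.word z V)).sum := by
      intro z
      simp only [rowSize]
      generalize L.sublists = S
      induction S with
      | nil => simp
      | cons V S ih =>
        simp only [List.map_cons, List.sum_cons, Finset.sum_add_distrib, ih]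
        rw [sum_re_pow_apply_self]
        rfl
    simp_rw [h1]
    rw [(integral_list_sum _ _ fun V _ => 𝓜.integrable (𝓜.continuous_absMoment_word q V)).2]
    generalize L.sublists = S
    induction S with
    | nil => simp
    | cons V S ih =>
      simp only [List.map_cons, List.sum_cons, add_mul]
      exact add_le_add (hC V n 𝓜) ih
  -- removing the entry changes the local size polynomially, so that the a priori moments apply
  · intro v i j
    calc _ ≤ ∫ z, A * (D * (1 + rowSize (letters 𝓜.B z) q L i +
            rowSize (letters 𝓜.B z) q L j)) ∂𝓜.law := by
          refine integral_mono_ae (𝓜.integrable ?_) (𝓜.integrable ?_) ?_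
          · exact ((((𝓜.continuous_locSize i j L).comp
              (continuous_update_zero (edge v i j))).const_mul 5).pow p)
          · exact (((continuous_const.add (𝓜.continuous_rowSize q L i)).add
              (𝓜.continuous_rowSize q L j)).const_mul D).const_mul A
          filter_upwards [𝓜.ae_norm_le] with z hz
          have h1 := locSize_perturbed_le (letters_update_zero_eq 𝓜.B z v i j)
            (by rw [norm_neg]; exact (norm_entry_le i j _).trans (hz _)) L
          have h2 := locSize_pow_le (letters 𝓜.B z) i j L q
          have h3 := one_le_locSize (letters 𝓜.B (Function.update z (edge v i j) 0)) i j L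
          calc _ ≤ (5 * ((1 + 4 * 2 ^ l) * (5 * locSize (letters 𝓜.B z) i j L) ^ l)) ^ p := by
                gcongr
            _ = A * locSize (letters 𝓜.B z) i j L ^ q := by
                rw [hA, hq, pow_mul, ← mul_pow, mul_pow 5 (locSize _ _ _ _)]
                ring
            _ ≤ _ := by gcongr
      _ ≤ _ := by
          have i1 : Integrable (fun z => 1 + rowSize (letters 𝓜.B z) q L i) 𝓜.law :=
            (integrable_const _).add (hrow i)
          rw [integral_const_mul, integral_const_mul, integral_add i1 (hrow j),
            integral_add (integrable_const _) (hrow i)]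
          simp only [integral_const, probReal_univ, one_smul]
          nlinarith [mul_nonneg hA0 hD0]

end Ensemble

end LocalMoments

end NCProb


namespace NCProb

/-! ### Concentration of the normalized traces of words -/

section Concentration

open Matrix

variable {r n : ℕ} {β : Type*} {θ : ℝ}

theorem normalizedTrace_apply (M : Matrix (Fin n) (Fin n) ℂ) :
    normalizedTrace n M = (n : ℂ)⁻¹ * trace M := by
  simp [normalizedTrace]

theorem normalizedTrace_mul_comm (M N : Matrix (Fin n) (Fin n) ℂ) :
    normalizedTrace n (M * N) = normalizedTrace n (N * M) := by
  rw [normalizedTrace_apply, normalizedTrace_apply, trace_mul_comm]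

theorem list_sum_sq_le {ι : Type*} (l : List ι) (f : ι → ℝ) :
    (l.map f).sum ^ 2 ≤ l.length * (l.map fun q => f q ^ 2).sum := by
  induction l with
  | nil => simp
  | cons a l ih =>
    simp only [List.map_cons, List.sum_cons, List.length_cons]
    push_cast
    have h : ∀ S T N : ℝ, 0 ≤ N → 0 ≤ T → S ^ 2 ≤ N * T →
        (f a + S) ^ 2 ≤ (N + 1) * (f a ^ 2 + T) := by
      intro S T N hN hT h
      rcases eq_or_lt_of_le hN with h0 | h0
      · subst h0
        have : S = 0 := by nlinarith
        subst this; nlinarith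
      · have h3 : 2 * f a * S ≤ N * f a ^ 2 + T := by
          have h4 : 0 ≤ (N * f a - S) ^ 2 := sq_nonneg _
          have h5 : N * (2 * f a * S) ≤ N * (N * f a ^ 2 + T) := by nlinarith
          exact le_of_mul_le_mul_left h5 h0
        nlinarith
    exact h _ _ _ (by positivity) (List.sum_nonneg (by
      simp only [List.mem_map]
      rintro x ⟨y, -, rfl⟩
      positivity)) ih

theorem norm_list_sum_le {ι G : Type*} [NormedAddCommGroup G] (l : List ι) (f : ι → G) :
    ‖(l.map f).sum‖ ≤ (l.map fun q => ‖f q‖).sum := by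
  induction l with
  | nil => simp
  | cons a l ih =>
    simp only [List.map_cons, List.sum_cons]
    exact (norm_add_le _ _).trans (by gcongr)

theorem list_sum_map_le {ι : Type*} (l : List ι) {f g : ι → ℝ} (h : ∀ q ∈ l, f q ≤ g q) :
    (l.map f).sum ≤ (l.map g).sum :=
  List.sum_le_sum h

theorem list_sum_map_const {ι : Type*} (l : List ι) (c : ℝ) :
    (l.map fun _ => c).sum = l.length * c := by
  simp

theorem sum_errorBound_mul {U : Fin n → ℝ} :
    ∑ i, ∑ j, Ensemble.errorBound θ i j * (U i + U j) =
      (2 * n * (θ / (n * √n)) + 4 / n) * ∑ i, U i := by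
  unfold Ensemble.errorBound
  simp only [add_mul, mul_add, Finset.sum_add_distrib, ite_mul, zero_mul, Finset.sum_ite_eq,
    Finset.mem_univ, if_true, ← Finset.mul_sum, Finset.sum_const, Finset.card_univ,
    Fintype.card_fin, nsmul_eq_mul]
  ring

theorem sum_errorBound_mul_le {U : Fin n → ℝ} (hθ : 0 ≤ θ) {C : ℝ} (hC : 0 ≤ C)
    (hU : ∑ i, U i ≤ C * n) :
    ∑ i, ∑ j, Ensemble.errorBound θ i j * (U i + U j) ≤ (2 * θ + 4) * C * √n := by
  rw [sum_errorBound_mul]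
  rcases Nat.eq_zero_or_pos n with h0 | h0
  · subst h0; simp
  have hn : (0 : ℝ) < n := by exact_mod_cast h0
  have hs : 1 ≤ √(n : ℝ) := Real.one_le_sqrt.2 (by exact_mod_cast h0)
  have hsq : √(n : ℝ) * √n = n := Real.mul_self_sqrt hn.le
  calc _ ≤ (2 * n * (θ / (n * √n)) + 4 / n) * (C * n) := by gcongr
    _ = 2 * θ * C * (n / √n) + 4 * C := by field_simp
    _ = 2 * θ * C * √n + 4 * C := by rw [Real.div_sqrt]
    _ ≤ (2 * θ + 4) * C * √n := by nlinarith

namespace Ensemble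

variable (𝓜 : Ensemble r β θ n)

/-- The normalized trace of a word. -/
noncomputable def ntr (w : List (Fin r ⊕ β)) (z : Edge r n → ℂ) : ℂ :=
  normalizedTrace n (𝓜.word z w)

theorem continuous_ntr (w : List (Fin r ⊕ β)) : Continuous (𝓜.ntr w) := by
  unfold ntr
  simp only [normalizedTrace_apply]
  exact continuous_const.mul (𝓜.continuous_word w).matrix_trace

theorem inv_mul_inv_sqrt_le_errorBound (hθ : 1 ≤ θ) (i j : Fin n) :
    1 / (n : ℝ) * (1 / √n) ≤ errorBound θ i j := by
  unfold errorBound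
  have h1 : 1 / (n : ℝ) * (1 / √n) ≤ θ / (n * √n) := by
    rw [one_div_mul_one_div]
    gcongr
  have h2 : (0 : ℝ) ≤ if i = j then (2 : ℝ) / n else 0 := by split_ifs <;> positivity
  linarith

theorem inv_sq_le_errorBound (hθ : 1 ≤ θ) (i j : Fin n) :
    1 / (n : ℝ) * (1 / n) ≤ errorBound θ i j := by
  refine le_trans ?_ (inv_mul_inv_sqrt_le_errorBound hθ i j)
  have h0 : 0 < n := i.pos
  have hn : (0 : ℝ) < n := by exact_mod_cast h0
  have h1 : 1 ≤ (n : ℝ) := by exact_mod_cast h0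
  gcongr
  exact Real.sqrt_le_iff.2 ⟨by positivity, by nlinarith⟩

theorem errorBound_nonneg (hθ : 1 ≤ θ) (i j : Fin n) : 0 ≤ errorBound θ i j :=
  le_trans (by positivity) (inv_sq_le_errorBound hθ i j)

/-- The local bound on words in the letters of `L`, after an entry has been set to zero. -/
noncomputable def locPow (v : Fin r) (i j : Fin n) (L : List (Fin r ⊕ β)) (z : Edge r n → ℂ) : ℝ :=
  (5 * locSize (letters 𝓜.B (Function.update z (edge v i j) 0)) i j L) ^ L.length

theorem continuous_locPow (v : Fin r) (i j : Fin n) (L : List (Fin r ⊕ β)) :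
    Continuous (𝓜.locPow v i j L) :=
  (((𝓜.continuous_locSize i j L).comp (continuous_update_zero (edge v i j))).const_mul 5).pow _

theorem one_le_locPow (v : Fin r) (i j : Fin n) (L : List (Fin r ⊕ β)) (z : Edge r n → ℂ) :
    1 ≤ 𝓜.locPow v i j L z := by
  have := one_le_locSize (letters 𝓜.B (Function.update z (edge v i j) 0)) i j L
  exact one_le_pow₀ (by linarith)

theorem locPow_update (v : Fin r) (i j : Fin n) (L : List (Fin r ⊕ β)) (z : Edge r n → ℂ) (t : ℂ) :
    𝓜.locPow v i j L (Function.update z (edge v i j) t) = 𝓜.locPow v i j L z := by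
  simp [locPow]

theorem exists_locPow_bound (r : ℕ) (β : Type*) (θ : ℝ) (L : List (Fin r ⊕ β)) :
    ∃ C : ℝ, 0 ≤ C ∧ ∀ (n : ℕ) (𝓜 : Ensemble r β θ n), ∃ U : Fin n → ℝ, (∀ i, 0 ≤ U i) ∧
      ∑ i, U i ≤ C * n ∧ ∀ v i j, ∫ z, 𝓜.locPow v i j L z ^ 2 ∂𝓜.law ≤ U i + U j := by
  obtain ⟨C, hC, h⟩ := exists_locSize_moment_bound r β θ L (L.length * 2)
  refine ⟨C, hC, fun n 𝓜 => ?_⟩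
  obtain ⟨U, h1, h2, h3⟩ := h n 𝓜
  refine ⟨U, h1, h2, fun v i j => ?_⟩
  simp only [locPow, ← pow_mul]
  exact h3 v i j

/-- Setting one entry to zero changes second moments of the local entries of words only
slightly. -/
theorem integral_norm_word_update_zero_sq_le (v : Fin r) (i j : Fin n) {L R : List (Fin r ⊕ β)}
    (hR : R.Sublist L) {a b : Fin n} (ha : a = i ∨ a = j) (hb : b = i ∨ b = j) :
    ∫ z, ‖𝓜.word (Function.update z (edge v i j) 0) R a b‖ ^ 2 ∂𝓜.law ≤
      2 * ∫ z, ‖𝓜.word z R a b‖ ^ 2 ∂𝓜.law +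
        2 / n * ∫ z, 𝓜.locPow v i j L z ^ 2 ∂𝓜.law := by
  classical
  set e : Edge r n := edge v i j with he
  have hw := 𝓜.continuous_word_apply R a b
  have hw0 : Continuous fun z => 𝓜.word (Function.update z e 0) R a b :=
    hw.comp (continuous_update_zero e)
  have hQ := 𝓜.continuous_locPow v i j L
  have hy : Continuous fun z : Edge r n → ℂ => entry i j (z e) :=
    (continuous_entry i j).comp (continuous_apply e)
  have h1 : ∫ z, ‖entry i j (z e)‖ ^ 2 * 𝓜.locPow v i j L z ^ 2 ∂𝓜.law ≤
      ∫ z, 1 / n * 𝓜.locPow v i j L z ^ 2 ∂𝓜.law := by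
    refine 𝓜.integral_le_of_update (by fun_prop) e (by fun_prop) fun z => ?_
    simp only [Function.update_self]
    simp_rw [he, 𝓜.locPow_update]
    rw [integral_mul_const]
    gcongr
    exact 𝓜.integral_norm_entry_sq_le v i j
  have i1 : Integrable (fun z => 2 * ‖𝓜.word z R a b‖ ^ 2) 𝓜.law := 𝓜.integrable (by fun_prop)
  have i2 : Integrable (fun z => 2 * (‖entry i j (z e)‖ ^ 2 * 𝓜.locPow v i j L z ^ 2)) 𝓜.law :=
    𝓜.integrable (by fun_prop)
  calc _ ≤ ∫ z, (2 * ‖𝓜.word z R a b‖ ^ 2 +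
        2 * (‖entry i j (z e)‖ ^ 2 * 𝓜.locPow v i j L z ^ 2)) ∂𝓜.law := by
        refine integral_mono_ae (𝓜.integrable (by fun_prop)) (i1.add i2) ?_
        filter_upwards [𝓜.ae_norm_le] with z hz
        have h := norm_perturbed_sub_apply_le_five_locSize (letters_eq_update 𝓜.B z v i j)
          ((norm_entry_le i j _).trans (hz _)) (L := L) (V := R) (V' := []) (by simpa using hR)
          ha hb
        simp only [evalWord_nil, mul_one, List.append_nil] at h
        set x := evalWord (letters 𝓜.B z) R a b
        set x0 := evalWord (letters 𝓜.B (Function.update z (edge v i j) 0)) R a b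
        have h2 : ‖x0‖ ≤ ‖x‖ + ‖entry i j (z e)‖ * 𝓜.locPow v i j L z := by
          have := norm_sub_norm_le x0 x
          rw [norm_sub_rev] at this
          have h' : ‖x - x0‖ ≤ ‖entry i j (z e)‖ * 𝓜.locPow v i j L z := h
          linarith
        have h3 : ‖x0‖ ^ 2 ≤ 2 * ‖x‖ ^ 2 +
            2 * (‖entry i j (z e)‖ ^ 2 * 𝓜.locPow v i j L z ^ 2) := by
          have := pow_le_pow_left₀ (norm_nonneg _) h2 2
          nlinarith [sq_nonneg (‖x‖ - ‖entry i j (z e)‖ * 𝓜.locPow v i j L z)]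
        exact h3
    _ = 2 * ∫ z, ‖𝓜.word z R a b‖ ^ 2 ∂𝓜.law +
        2 * ∫ z, ‖entry i j (z e)‖ ^ 2 * 𝓜.locPow v i j L z ^ 2 ∂𝓜.law := by
        rw [integral_add i1 i2, integral_const_mul, integral_const_mul]
    _ ≤ 2 * ∫ z, ‖𝓜.word z R a b‖ ^ 2 ∂𝓜.law +
        2 * ∫ z, 1 / n * 𝓜.locPow v i j L z ^ 2 ∂𝓜.law := by gcongr
    _ = _ := by rw [integral_const_mul]; ring

theorem sum_integral_norm_word_sq (R : List (Fin r ⊕ β)) :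
    ∑ i, ∑ j, ∫ z, ‖𝓜.word z R i j‖ ^ 2 ∂𝓜.law = ∫ z, absMoment 1 (𝓜.word z R) ∂𝓜.law := by
  have hi : ∀ i j, Integrable (fun z => ‖𝓜.word z R i j‖ ^ 2) 𝓜.law := fun i j =>
    𝓜.integrable (by have := 𝓜.continuous_word_apply R i j; fun_prop)
  simp_rw [absMoment_one]
  rw [integral_finsetSum _ fun i _ => integrable_finsetSum _ fun j _ => hi i j]
  exact Finset.sum_congr rfl fun i _ => (integral_finsetSum _ fun j _ => hi i j).symm

/-- The rotations `s₂ s₁` of a word around the occurrences of a letter are sublists of the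
doubled word. -/
theorem rotation_sublist {α : Type*} [DecidableEq α] {ℓ : α} {w : List α}
    {q : List α × List α} (hq : q ∈ splits ℓ w) : (q.2 ++ q.1).Sublist (w ++ w) := by
  have h := eq_of_mem_splits hq
  refine List.Sublist.append ?_ ?_
  · rw [h]
    exact (List.sublist_cons_self _ _).trans (List.sublist_append_right _ _)
  · rw [h]
    exact List.sublist_append_left _ _

/-- The effect on a normalized trace of setting one entry to zero. -/
theorem norm_ntr_sub_sq_le [DecidableEq β] (v : Fin r) (i j : Fin n) (w : List (Fin r ⊕ β))
    (z : Edge r n → ℂ) {t : ℂ} (ht : ‖t‖ ≤ 2) :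
    ‖𝓜.ntr w (Function.update z (edge v i j) t) - 𝓜.ntr w (Function.update z (edge v i j) 0)‖ ^ 2 ≤
      (3 * (splits (Sum.inl v) w).length * (1 / n) ^ 2) *
        (‖entry i j t‖ ^ 2 * ((splits (Sum.inl v) w).map fun q =>
          ‖𝓜.word (Function.update z (edge v i j) 0) (q.2 ++ q.1) j i‖ ^ 2 +
          ‖𝓜.word (Function.update z (edge v i j) 0) (q.2 ++ q.1) i j‖ ^ 2).sum +
        8 * (splits (Sum.inl v) w).length *
          (‖entry i j t‖ ^ 3 * 𝓜.locPow v i j (w ++ w) z ^ 2)) := by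
  set e : Edge r n := edge v i j with he
  set y := entry i j t with hy
  have hy2 : ‖y‖ ≤ 2 := (norm_entry_le i j t).trans ht
  set Q := 𝓜.locPow v i j (w ++ w) z with hQ
  set S := splits (Sum.inl v : Fin r ⊕ β) w with hS
  set R : List (Fin r ⊕ β) × List (Fin r ⊕ β) → Fin n → Fin n → ℝ := fun q a b =>
    ‖𝓜.word (Function.update z e 0) (q.2 ++ q.1) a b‖ with hR
  have hQ0 : 0 ≤ Q := zero_le_one.trans (𝓜.one_le_locPow _ _ _ _ _)
  have h1 : ‖𝓜.ntr w (Function.update z e t) - 𝓜.ntr w (Function.update z e 0)‖ ≤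
      1 / n * (‖y‖ * (S.map fun q => R q j i + R q i j + 2 * ‖y‖ * Q).sum) := by
    rw [ntr, ntr, normalizedTrace_apply, normalizedTrace_apply, ← mul_sub, ← trace_sub, word, word,
      evalWord_sub_evalWord (letters_update 𝓜.B z v i j t), norm_mul, norm_inv,
      Complex.norm_natCast, ← one_div, trace_list_sum]
    refine mul_le_mul_of_nonneg_left ?_ (by positivity)
    rw [List.map_map, ← List.sum_map_mul_left]
    refine (norm_list_sum_le _ _).trans (list_sum_map_le _ fun q hq => ?_)
    have hsub := rotation_sublist hq
    have hbound : ∀ a b, (a = i ∨ a = j) → (b = i ∨ b = j) →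
        ‖(evalWord (letters 𝓜.B (Function.update z e t)) q.2 *
          evalWord (letters 𝓜.B (Function.update z e 0)) q.1) a b‖ ≤ R q a b + ‖y‖ * Q := by
      intro a b ha hb
      have h := norm_perturbed_sub_apply_le_five_locSize (letters_update 𝓜.B z v i j t) hy2 hsub
        ha hb
      have h2 := norm_le_norm_add_norm_sub'
        ((evalWord (letters 𝓜.B (Function.update z e t)) q.2 *
          evalWord (letters 𝓜.B (Function.update z e 0)) q.1) a b)
        (evalWord (letters 𝓜.B (Function.update z e 0)) (q.2 ++ q.1) a b)
      exact h2.trans (add_le_add le_rfl h)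
    simp only [Function.comp_apply]
    rw [mul_assoc, trace_mul_comm, mul_assoc]
    refine (norm_trace_entryPert_mul_le _ i j y).trans ?_
    refine mul_le_mul_of_nonneg_left ?_ (norm_nonneg _)
    have b1 := hbound j i (Or.inr rfl) (Or.inl rfl)
    have b2 := hbound i j (Or.inl rfl) (Or.inr rfl)
    linarith
  have hR0 : ∀ q a b, 0 ≤ R q a b := fun q a b => norm_nonneg _
  have h2 : (S.map fun q => R q j i + R q i j + 2 * ‖y‖ * Q).sum ^ 2 ≤
      3 * S.length * ((S.map fun q => R q j i ^ 2 + R q i j ^ 2).sum +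
        S.length * (4 * ‖y‖ ^ 2 * Q ^ 2)) := by
    refine (list_sum_sq_le _ _).trans ?_
    rw [mul_comm 3, mul_assoc (S.length : ℝ)]
    refine mul_le_mul_of_nonneg_left ?_ (by positivity)
    rw [← list_sum_map_const, ← List.sum_map_add, ← List.sum_map_mul_left]
    refine list_sum_map_le _ fun q _ => ?_
    nlinarith [sq_nonneg (R q j i - R q i j), sq_nonneg (R q j i - 2 * ‖y‖ * Q),
      sq_nonneg (R q i j - 2 * ‖y‖ * Q)]
  have hS0 : 0 ≤ (S.map fun q => R q j i + R q i j + 2 * ‖y‖ * Q).sum := List.sum_nonneg (by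
    simp only [List.mem_map]
    rintro x ⟨q, -, rfl⟩
    have := hR0 q j i
    have := hR0 q i j
    positivity)
  -- `‖y‖ ≤ 2` leaves the third power, whose mean is of order `n ^ (-3/2)`
  have h3 : ‖y‖ ^ 2 * ‖y‖ ^ 2 ≤ 2 * ‖y‖ ^ 3 := by
    have : 0 ≤ ‖y‖ ^ 3 := by positivity
    nlinarith
  calc _ ≤ (1 / n * (‖y‖ * (S.map fun q => R q j i + R q i j + 2 * ‖y‖ * Q).sum)) ^ 2 := by
        gcongr
    _ = (1 / (n : ℝ)) ^ 2 *
          (‖y‖ ^ 2 * (S.map fun q => R q j i + R q i j + 2 * ‖y‖ * Q).sum ^ 2) := by ring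
    _ ≤ (1 / (n : ℝ)) ^ 2 * (‖y‖ ^ 2 * (3 * S.length *
          ((S.map fun q => R q j i ^ 2 + R q i j ^ 2).sum +
          S.length * (4 * ‖y‖ ^ 2 * Q ^ 2)))) := by gcongr
    _ = (3 * S.length * (1 / n) ^ 2) * (‖y‖ ^ 2 * (S.map fun q => R q j i ^ 2 + R q i j ^ 2).sum +
          4 * S.length * ((‖y‖ ^ 2 * ‖y‖ ^ 2) * Q ^ 2)) := by ring
    _ ≤ (3 * S.length * (1 / n) ^ 2) * (‖y‖ ^ 2 * (S.map fun q => R q j i ^ 2 + R q i j ^ 2).sum +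
          4 * S.length * ((2 * ‖y‖ ^ 3) * Q ^ 2)) := by gcongr
    _ = _ := by ring

/-- The effect of one entry on a normalized trace, in mean square: the linear term contributes
second moments of entries of words, and all further terms are absorbed in the local size. -/
theorem integral_norm_ntr_sub_sq_le [DecidableEq β] (hθ : 1 ≤ θ) (v : Fin r) (i j : Fin n)
    (w : List (Fin r ⊕ β)) :
    ∫ z, ‖𝓜.ntr w z - 𝓜.ntr w (Function.update z (edge v i j) 0)‖ ^ 2 ∂𝓜.law ≤
      (3 * (splits (Sum.inl v) w).length * (1 / n) ^ 2) *
        (2 / n * ((splits (Sum.inl v) w).map fun q =>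
          ∫ z, ‖𝓜.word z (q.2 ++ q.1) j i‖ ^ 2 ∂𝓜.law +
            ∫ z, ‖𝓜.word z (q.2 ++ q.1) i j‖ ^ 2 ∂𝓜.law).sum +
        12 * (splits (Sum.inl v) w).length *
          (errorBound θ i j * ∫ z, 𝓜.locPow v i j (w ++ w) z ^ 2 ∂𝓜.law)) := by
  set e : Edge r n := edge v i j with he
  set S := splits (Sum.inl v : Fin r ⊕ β) w with hS
  set I := ∫ z, 𝓜.locPow v i j (w ++ w) z ^ 2 ∂𝓜.law with hI
  have hI0 : 0 ≤ I := integral_nonneg fun z => sq_nonneg _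
  have hm := 𝓜.continuous_ntr w
  have hQ := 𝓜.continuous_locPow v i j (w ++ w)
  have hm0 : Continuous fun z => 𝓜.ntr w (Function.update z e 0) :=
    hm.comp (continuous_update_zero e)
  have hword : ∀ (R : List (Fin r ⊕ β)) a b, Continuous fun z =>
      ‖𝓜.word (Function.update z e 0) R a b‖ ^ 2 := fun R a b =>
    (((𝓜.continuous_word_apply R a b).comp (continuous_update_zero e)).norm.pow 2)
  set ρ : (Edge r n → ℂ) → ℝ := fun z => (S.map fun q =>
    ‖𝓜.word (Function.update z e 0) (q.2 ++ q.1) j i‖ ^ 2 +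
    ‖𝓜.word (Function.update z e 0) (q.2 ++ q.1) i j‖ ^ 2).sum with hρ
  have hρc : Continuous ρ := continuous_list_sum _ fun q _ =>
    (hword (q.2 ++ q.1) j i).add (hword (q.2 ++ q.1) i j)
  have hρ0 : ∀ z, 0 ≤ ρ z := fun z => List.sum_nonneg (by
    simp only [List.mem_map]
    rintro x ⟨q, -, rfl⟩
    positivity)
  set A : ℝ := 3 * S.length * (1 / n) ^ 2 with hA
  have hA0 : 0 ≤ A := by positivity
  have step1 : ∫ z, ‖𝓜.ntr w z - 𝓜.ntr w (Function.update z e 0)‖ ^ 2 ∂𝓜.law ≤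
      ∫ z, A * (1 / n * ρ z + 8 * S.length *
        (errorBound θ i j * 𝓜.locPow v i j (w ++ w) z ^ 2)) ∂𝓜.law := by
    refine 𝓜.integral_le_of_update (by fun_prop) e (by fun_prop) fun z => ?_
    simp only [Function.update_idem]
    have hent := continuous_entry i j
    have hc : Continuous fun t => 𝓜.ntr w (Function.update z e t) :=
      hm.comp ((continuous_update_uncurry e).comp (Continuous.prodMk_right z))
    have j1 : Integrable (fun t => ‖entry i j t‖ ^ 2 * ρ z) (𝓜.ν e) :=
      𝓜.integrable_entry (by fun_prop) e
    have j2 : Integrable (fun t => 8 * S.length *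
        (‖entry i j t‖ ^ 3 * 𝓜.locPow v i j (w ++ w) z ^ 2)) (𝓜.ν e) :=
      𝓜.integrable_entry (by fun_prop) e
    calc _ ≤ ∫ t, A * (‖entry i j t‖ ^ 2 * ρ z + 8 * S.length *
          (‖entry i j t‖ ^ 3 * 𝓜.locPow v i j (w ++ w) z ^ 2)) ∂𝓜.ν e := by
          refine integral_mono_ae (𝓜.integrable_entry (by fun_prop) e)
            ((j1.add j2).const_mul A) ?_
          filter_upwards [𝓜.norm_le e] with t ht
          exact 𝓜.norm_ntr_sub_sq_le v i j w z ht
      _ = A * ((∫ t, ‖entry i j t‖ ^ 2 ∂𝓜.ν e) * ρ z + 8 * S.length *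
          ((∫ t, ‖entry i j t‖ ^ 3 ∂𝓜.ν e) * 𝓜.locPow v i j (w ++ w) z ^ 2)) := by
          rw [integral_const_mul, integral_add j1 j2, integral_mul_const, integral_const_mul,
            integral_mul_const]
      _ ≤ _ := by
          have h1 := 𝓜.integral_norm_entry_sq_le v i j
          have h2 := 𝓜.integral_norm_entry_cube_le (by linarith) v i j
          have h3 := hρ0 z
          gcongr
  refine step1.trans ?_
  have i1 : Integrable (fun z => 1 / n * ρ z) 𝓜.law := 𝓜.integrable (by fun_prop)
  have i2 : Integrable (fun z => 8 * S.length *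
        (errorBound θ i j * 𝓜.locPow v i j (w ++ w) z ^ 2)) 𝓜.law := 𝓜.integrable (by fun_prop)
  rw [integral_const_mul, integral_add i1 i2, integral_const_mul, integral_const_mul,
    integral_const_mul]
  refine mul_le_mul_of_nonneg_left ?_ hA0
  have step2 : ∫ z, ρ z ∂𝓜.law ≤ 2 * (S.map fun q =>
          ∫ z, ‖𝓜.word z (q.2 ++ q.1) j i‖ ^ 2 ∂𝓜.law +
            ∫ z, ‖𝓜.word z (q.2 ++ q.1) i j‖ ^ 2 ∂𝓜.law).sum + S.length * (4 / n * I) := by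
    have hl := (integral_list_sum (P := 𝓜.law) S (fun q z =>
      ‖𝓜.word (Function.update z e 0) (q.2 ++ q.1) j i‖ ^ 2 +
      ‖𝓜.word (Function.update z e 0) (q.2 ++ q.1) i j‖ ^ 2) fun q _ => 𝓜.integrable
      ((hword (q.2 ++ q.1) j i).add (hword (q.2 ++ q.1) i j))).2
    rw [show ∫ z, ρ z ∂𝓜.law = _ from hl, ← list_sum_map_const,
      ← List.sum_map_mul_left, ← List.sum_map_add]
    refine list_sum_map_le _ fun q hq => ?_
    rw [integral_add (𝓜.integrable (hword _ _ _)) (𝓜.integrable (hword _ _ _))]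
    have b1 := 𝓜.integral_norm_word_update_zero_sq_le v i j (rotation_sublist hq)
      (a := j) (b := i) (Or.inr rfl) (Or.inl rfl)
    have b2 := 𝓜.integral_norm_word_update_zero_sq_le v i j (rotation_sublist hq)
      (a := i) (b := j) (Or.inl rfl) (Or.inr rfl)
    rw [← hI] at b1 b2
    have : 4 / n * I = 2 / n * I + 2 / n * I := by ring
    linarith
  have h3 := mul_le_mul_of_nonneg_right (inv_sq_le_errorBound hθ i j) hI0
  have hn : (0 : ℝ) ≤ 1 / n := by positivity
  have h4 := mul_le_mul_of_nonneg_left step2 hn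
  have h5 : (0 : ℝ) ≤ 4 * S.length := by positivity
  have h6 := mul_le_mul_of_nonneg_left h3 h5
  refine (add_le_add_left h4 _).trans ?_
  ring_nf at h6 ⊢
  linarith

/-- The variance of the normalized trace of a word is of order `n ^ (-3/2)`. -/
theorem exists_variance_bound [DecidableEq β] (r : ℕ) (hθ : 1 ≤ θ) (w : List (Fin r ⊕ β)) :
    ∃ C : ℝ, ∀ (n : ℕ) (𝓜 : Ensemble r β θ n),
      ∫ z, ‖𝓜.ntr w z - ∫ z', 𝓜.ntr w z' ∂𝓜.law‖ ^ 2 ∂𝓜.law ≤ C / (n * √n) := by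
  choose C hC0 hC using fun R => exists_absMoment_word_bound r β θ 1 R
  obtain ⟨D, hD0, hD⟩ := exists_locPow_bound r β θ (w ++ w)
  set N : Fin r → ℝ := fun v => (splits (Sum.inl v : Fin r ⊕ β) w).length with hN
  have hN0 : ∀ v, 0 ≤ N v := fun v => by positivity
  set T : Fin r → ℝ := fun v =>
    ((splits (Sum.inl v : Fin r ⊕ β) w).map fun q => C (q.2 ++ q.1)).sum with hT
  have hT0 : ∀ v, 0 ≤ T v := fun v => List.sum_nonneg (by
    simp only [List.mem_map]
    rintro x ⟨q, -, rfl⟩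
    exact hC0 _)
  refine ⟨∑ v, 3 * N v * (4 * T v + 12 * N v * ((2 * θ + 4) * D)), fun n 𝓜 => ?_⟩
  rcases Nat.eq_zero_or_pos n with h0 | h0
  · subst h0
    simp [ntr, normalizedTrace_apply]
  have hn : (0 : ℝ) < n := by exact_mod_cast h0
  have hn1 : (1 : ℝ) ≤ n := by exact_mod_cast h0
  have hs : 1 ≤ √(n : ℝ) := Real.one_le_sqrt.2 hn1
  obtain ⟨U, hU0, hUsum, hU⟩ := hD n 𝓜
  -- compare with the functions obtained by setting one entry to zero
  have hES := efronStein 𝓜.ν 𝓜.norm_le (𝓜.continuous_ntr w)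
    (G := fun e z => 𝓜.ntr w (Function.update z e 0))
    (fun e => (𝓜.continuous_ntr w).comp (continuous_update_zero e)) (by simp)
  have hedge : ∀ e : Edge r n, edge e.1.1 e.1.2.1 e.1.2.2 = e := by
    intro e
    unfold edge
    rw [dif_pos e.2]
  set F : Fin r × Fin n × Fin n → ℝ := fun p =>
    ∫ z, ‖𝓜.ntr w z - 𝓜.ntr w (Function.update z (edge p.1 p.2.1 p.2.2) 0)‖ ^ 2 ∂𝓜.law with hF
  have hF0 : ∀ p, 0 ≤ F p := fun p => integral_nonneg fun z => by positivity
  -- extend the sum over the independent entries to all pairs `(i, j)`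
  have h1 : ∑ e : Edge r n, ∫ z, ‖𝓜.ntr w z - 𝓜.ntr w (Function.update z e 0)‖ ^ 2 ∂Measure.pi 𝓜.ν ≤
      ∑ v, ∑ i, ∑ j, F (v, i, j) := by
    have : ∀ e : Edge r n, ∫ z, ‖𝓜.ntr w z - 𝓜.ntr w (Function.update z e 0)‖ ^ 2
        ∂Measure.pi 𝓜.ν = F e.1 := by
      intro e
      simp only [hF, hedge]
      rfl
    simp_rw [this]
    have h2 : ∑ v, ∑ i, ∑ j, F (v, i, j) = ∑ p, F p := by
      rw [Fintype.sum_prod_type]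
      exact Finset.sum_congr rfl fun v _ => (Fintype.sum_prod_type (fun q => F (v, q))).symm
    rw [h2]
    calc ∑ e : Edge r n, F e.1 = ∑ p ∈ Finset.univ.map (Function.Embedding.subtype _), F p :=
          (Finset.sum_map Finset.univ (Function.Embedding.subtype _) F).symm
      _ ≤ _ := Finset.sum_le_sum_of_subset_of_nonneg (Finset.subset_univ _) fun p _ _ => hF0 p
  refine hES.trans (h1.trans ?_)
  rw [Finset.sum_div]
  refine Finset.sum_le_sum fun v _ => ?_
  set S := splits (Sum.inl v : Fin r ⊕ β) w with hS
  have h2 : ∀ i j, F (v, i, j) ≤ (3 * N v * (1 / n) ^ 2) *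
        (2 / n * (S.map fun q =>
          ∫ z, ‖𝓜.word z (q.2 ++ q.1) j i‖ ^ 2 ∂𝓜.law +
            ∫ z, ‖𝓜.word z (q.2 ++ q.1) i j‖ ^ 2 ∂𝓜.law).sum +
        12 * N v * (errorBound θ i j * (U i + U j))) := by
    intro i j
    refine (𝓜.integral_norm_ntr_sub_sq_le hθ v i j w).trans ?_
    have := hU v i j
    have := errorBound_nonneg hθ i j
    gcongr
  -- summed over all positions, the second moments of the entries of a word give an absolute moment
  have h3 : ∑ i, ∑ j, (S.map fun q =>
          ∫ z, ‖𝓜.word z (q.2 ++ q.1) j i‖ ^ 2 ∂𝓜.law +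
            ∫ z, ‖𝓜.word z (q.2 ++ q.1) i j‖ ^ 2 ∂𝓜.law).sum ≤ 2 * T v * n := by
    simp only [hT, ← hS]
    generalize S = S'
    induction S' with
    | nil => simp
    | cons q S' ih =>
      simp only [List.map_cons, List.sum_cons, Finset.sum_add_distrib] at ih ⊢
      have e1 := 𝓜.sum_integral_norm_word_sq (q.2 ++ q.1)
      have e2 : ∑ i, ∑ j, ∫ z, ‖𝓜.word z (q.2 ++ q.1) j i‖ ^ 2 ∂𝓜.law =
        ∫ z, absMoment 1 (𝓜.word z (q.2 ++ q.1)) ∂𝓜.law := by rw [Finset.sum_comm, e1]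
      have e3 := hC (q.2 ++ q.1) n 𝓜
      rw [e1, e2]
      linarith
  have h4 := sum_errorBound_mul_le (n := n) (zero_le_one.trans hθ) hD0 hUsum
  have hNv := hN0 v
  calc ∑ i, ∑ j, F (v, i, j) ≤ ∑ i, ∑ j, (3 * N v * (1 / n) ^ 2) *
        (2 / n * (S.map fun q =>
          ∫ z, ‖𝓜.word z (q.2 ++ q.1) j i‖ ^ 2 ∂𝓜.law +
            ∫ z, ‖𝓜.word z (q.2 ++ q.1) i j‖ ^ 2 ∂𝓜.law).sum +
        12 * N v * (errorBound θ i j * (U i + U j))) :=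
        Finset.sum_le_sum fun i _ => Finset.sum_le_sum fun j _ => h2 i j
    _ = (3 * N v * (1 / n) ^ 2) * (2 / n * (∑ i, ∑ j, (S.map fun q =>
          ∫ z, ‖𝓜.word z (q.2 ++ q.1) j i‖ ^ 2 ∂𝓜.law +
            ∫ z, ‖𝓜.word z (q.2 ++ q.1) i j‖ ^ 2 ∂𝓜.law).sum) +
        12 * N v * (∑ i, ∑ j, errorBound θ i j * (U i + U j))) := by
        simp only [← Finset.mul_sum, Finset.sum_add_distrib]
    _ ≤ (3 * N v * (1 / n) ^ 2) * (2 / n * (2 * T v * n) +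
        12 * N v * ((2 * θ + 4) * D * √n)) := by gcongr
    _ = (3 * N v * (1 / n) ^ 2) * (4 * T v * 1 + 12 * N v * ((2 * θ + 4) * D) * √n) := by
        field_simp
        ring
    _ ≤ (3 * N v * (1 / n) ^ 2) * (4 * T v * √n + 12 * N v * ((2 * θ + 4) * D) * √n) := by
        have := hT0 v
        gcongr
    _ = 3 * N v * (4 * T v + 12 * N v * ((2 * θ + 4) * D)) * (√n / n * (1 / n)) := by ring
    _ = _ := by
        rw [Real.sqrt_div_self]
        field_simp

end Ensemble

end Concentration

end NCProb


namespace NCProb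

/-! ### The approximate Schwinger–Dyson equation -/

section SchwingerDyson

open Matrix

variable {r n : ℕ} {β : Type*} {θ : ℝ}

theorem matrix_list_sum_apply {ι m : Type*} (l : List ι) (f : ι → Matrix m m ℂ) (a b : m) :
    (l.map f).sum a b = (l.map fun q => f q a b).sum := by
  induction l with
  | nil => simp
  | cons q l ih => simp [ih]

theorem list_sum_map_sub {ι : Type*} (l : List ι) (f g : ι → ℂ) :
    (l.map fun q => f q - g q).sum = (l.map f).sum - (l.map g).sum := by
  induction l with
  | nil => simp
  | cons q l ih => simp only [List.map_cons, List.sum_cons, ih]; ring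

theorem mul_entryPert_entry_mul_apply (U V : Matrix (Fin n) (Fin n) ℂ) (i j : Fin n) (t : ℂ) :
    (U * entryPert i j (entry i j t) * V) j i =
      star (entry i j t) * (U j j * V i i) +
        if i = j then 0 else entry i j t * (U j i * V j i) := by
  rw [mul_entryPert_mul_apply]
  split_ifs with h
  · subst h
    rw [star_entry]
    ring
  · ring

namespace Ensemble

variable (𝓜 : Ensemble r β θ n)

theorem integral_norm_entry_le (v : Fin r) (i j : Fin n) :
    ∫ t, ‖entry i j t‖ ∂𝓜.ν (edge v i j) ≤ 1 / √n := by
  have hent := continuous_entry i j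
  have h := integral_sq_le_of_probability (𝓜.ν (edge v i j)) (f := fun t => ‖entry i j t‖)
    (𝓜.integrable_entry (by fun_prop) _) (𝓜.integrable_entry (by fun_prop) _)
  have h2 := h.trans (𝓜.integral_norm_entry_sq_le v i j)
  refine (Real.le_sqrt_of_sq_le h2).trans (le_of_eq ?_)
  rw [Real.sqrt_div zero_le_one, Real.sqrt_one]

/-- The defect in the Schwinger–Dyson equation attached to the `(i, j)` entry. -/
noncomputable def sdDefect [DecidableEq β] (v : Fin r) (i j : Fin n) (w : List (Fin r ⊕ β))
    (z : Edge r n → ℂ) : ℂ :=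
  hermitianOf z v i j * 𝓜.word z w j i -
    (n : ℂ)⁻¹ * ((splits (Sum.inl v) w).map fun q => 𝓜.word z q.1 j j * 𝓜.word z q.2 i i).sum

theorem continuous_sdDefect [DecidableEq β] (v : Fin r) (i j : Fin n) (w : List (Fin r ⊕ β)) :
    Continuous (𝓜.sdDefect v i j w) := by
  have h1 : Continuous fun z : Edge r n → ℂ => hermitianOf z v i j :=
    (continuous_hermitianOf v).matrix_elem i j
  refine (h1.mul (𝓜.continuous_word_apply w j i)).sub (continuous_const.mul ?_)
  exact continuous_list_sum _ fun q _ =>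
    (𝓜.continuous_word_apply q.1 j j).mul (𝓜.continuous_word_apply q.2 i i)

theorem sublist_of_mem_splits {α : Type*} [DecidableEq α] {ℓ : α} {w : List α}
    {q : List α × List α} (hq : q ∈ splits ℓ w) : q.1.Sublist w ∧ q.2.Sublist w := by
  have h := eq_of_mem_splits hq
  constructor
  · rw [h]; exact List.sublist_append_left _ _
  · rw [h]; exact (List.sublist_cons_self _ _).trans (List.sublist_append_right _ _)

/-- The second order expansion of the Schwinger–Dyson defect in the `(i, j)` entry `y`. The terms
of order one vanish on average, and those of order two are `|y|² - 1/n`, of small mean, and `y²`,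
whose coefficient involves only entries away from the diagonal. -/
theorem norm_sdDefect_sub_le [DecidableEq β] (v : Fin r) (i j : Fin n) (w : List (Fin r ⊕ β))
    (z : Edge r n → ℂ) {t : ℂ} (ht : ‖t‖ ≤ 2) :
    ‖𝓜.sdDefect v i j w (Function.update z (edge v i j) t) -
      (entry i j t * 𝓜.word (Function.update z (edge v i j) 0) w j i +
      ((‖entry i j t‖ ^ 2 : ℝ) - (n : ℂ)⁻¹) * ((splits (Sum.inl v) w).map fun q =>
        𝓜.word (Function.update z (edge v i j) 0) q.1 j j *
          𝓜.word (Function.update z (edge v i j) 0) q.2 i i).sum +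
      entry i j t ^ 2 * if i = j then 0 else ((splits (Sum.inl v) w).map fun q =>
        𝓜.word (Function.update z (edge v i j) 0) q.1 j i *
          𝓜.word (Function.update z (edge v i j) 0) q.2 j i).sum)‖ ≤
    ‖entry i j t‖ ^ 3 * 𝓜.locPow v i j w z +
      1 / n * ((splits (Sum.inl v) w).length * (2 * ‖entry i j t‖ * 𝓜.locPow v i j w z ^ 2)) := by
  set e : Edge r n := edge v i j with he
  set y := entry i j t with hy
  have hy2 : ‖y‖ ≤ 2 := (norm_entry_le i j t).trans ht
  set Q := 𝓜.locPow v i j w z with hQ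
  have hQ1 : 1 ≤ Q := 𝓜.one_le_locPow _ _ _ _ _
  set S := splits (Sum.inl v : Fin r ⊕ β) w with hS
  set M := letters 𝓜.B (Function.update z e t) with hM
  set M₀ := letters 𝓜.B (Function.update z e 0) with hM₀
  have hMM : ∀ c, M c = M₀ c + if c = Sum.inl v then entryPert i j y else 0 :=
    letters_update 𝓜.B z v i j t
  have hY : hermitianOf (Function.update z e t) v i j = y := by simp [hermitianOf, hy, he]
  have hlin : linearTerm M₀ (Sum.inl v) (entryPert i j y) w j i =
      star y * (S.map fun q => evalWord M₀ q.1 j j * evalWord M₀ q.2 i i).sum +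
      y * if i = j then 0 else (S.map fun q => evalWord M₀ q.1 j i * evalWord M₀ q.2 j i).sum := by
    rw [linearTerm, matrix_list_sum_apply, ← hS, ← List.sum_map_mul_left]
    simp_rw [hy, mul_entryPert_entry_mul_apply]
    split_ifs
    · simp
    · rw [List.sum_map_add, ← List.sum_map_mul_left]
  have hyy : y * star y = ((‖y‖ ^ 2 : ℝ) : ℂ) := by
    rw [Complex.ofReal_pow]; exact Complex.mul_conj' y
  have hid : 𝓜.sdDefect v i j w (Function.update z e t) -
      (y * evalWord M₀ w j i +
      (((‖y‖ ^ 2 : ℝ) : ℂ) - (n : ℂ)⁻¹) *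
        (S.map fun q => evalWord M₀ q.1 j j * evalWord M₀ q.2 i i).sum +
      y ^ 2 * if i = j then 0 else (S.map fun q => evalWord M₀ q.1 j i * evalWord M₀ q.2 j i).sum) =
      y * (evalWord M w - evalWord M₀ w - linearTerm M₀ (Sum.inl v) (entryPert i j y) w) j i -
      (n : ℂ)⁻¹ * (S.map fun q => evalWord M q.1 j j * evalWord M q.2 i i -
        evalWord M₀ q.1 j j * evalWord M₀ q.2 i i).sum := by
    rw [sdDefect, hY, Matrix.sub_apply, Matrix.sub_apply, hlin, ← hyy, list_sum_map_sub]
    simp only [word, ← hM, ← hS]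
    ring
  change ‖𝓜.sdDefect v i j w (Function.update z e t) -
      (y * evalWord M₀ w j i +
      (((‖y‖ ^ 2 : ℝ) : ℂ) - (n : ℂ)⁻¹) *
        (S.map fun q => evalWord M₀ q.1 j j * evalWord M₀ q.2 i i).sum +
      y ^ 2 * if i = j then 0 else
        (S.map fun q => evalWord M₀ q.1 j i * evalWord M₀ q.2 j i).sum)‖ ≤ _
  rw [hid]
  refine (norm_sub_le _ _).trans (add_le_add ?_ ?_)
  · rw [norm_mul]
    have h := norm_second_order_apply_le_five_locSize hMM hy2 (L := w) (a := j) (b := i)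
      (Or.inr rfl) (Or.inl rfl)
    calc _ ≤ ‖y‖ * (‖y‖ ^ 2 * Q) := mul_le_mul_of_nonneg_left h (norm_nonneg _)
      _ = _ := by ring
  · rw [norm_mul, norm_inv, Complex.norm_natCast, ← one_div]
    refine mul_le_mul_of_nonneg_left ?_ (by positivity)
    rw [← list_sum_map_const]
    refine (norm_list_sum_le _ _).trans (list_sum_map_le _ fun q hq => ?_)
    obtain ⟨hq1, hq2⟩ := sublist_of_mem_splits hq
    have b1 := norm_perturbed_apply_le_five_locSize hMM hy2 (L := w) (V := q.1) (V' := [])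
      (by simpa using hq1) (a := j) (b := j) (Or.inr rfl) (Or.inr rfl)
    have b2 := norm_apply_le_five_locSize (M₀ := M₀) (i := i) (j := j) hq2 (a := i) (b := i)
      (Or.inl rfl) (Or.inl rfl)
    have b3 := norm_perturbed_sub_apply_le_five_locSize hMM hy2 (L := w) (V := q.1) (V' := [])
      (by simpa using hq1) (a := j) (b := j) (Or.inr rfl) (Or.inr rfl)
    have b4 := norm_perturbed_sub_apply_le_five_locSize hMM hy2 (L := w) (V := q.2) (V' := [])
      (by simpa using hq2) (a := i) (b := i) (Or.inl rfl) (Or.inl rfl)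
    simp only [evalWord_nil, mul_one, List.append_nil] at b1 b3 b4
    set x := evalWord M q.1 j j
    set x' := evalWord M q.2 i i
    set x₀ := evalWord M₀ q.1 j j
    set x₀' := evalWord M₀ q.2 i i
    have hsplit : x * x' - x₀ * x₀' = x * (x' - x₀') + (x - x₀) * x₀' := by ring
    rw [hsplit]
    refine (norm_add_le _ _).trans ?_
    rw [norm_mul, norm_mul]
    have c1 : ‖x‖ * ‖x' - x₀'‖ ≤ Q * (‖y‖ * Q) := mul_le_mul b1 b4 (norm_nonneg _) (by linarith)
    have c2 : ‖x - x₀‖ * ‖x₀'‖ ≤ (‖y‖ * Q) * Q := mul_le_mul b3 b2 (norm_nonneg _) (by positivity)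
    nlinarith

/-- Integration of the defect over one entry, the others being fixed. In the expansion in that entry
the constant term vanishes by centring; the main second order term is cancelled up to the error in
the variance, and the term with the square of the entry, which need not vanish for complex entries,
is bounded by squares of off-diagonal entries of words. -/
theorem norm_integral_sdDefect_update_le [DecidableEq β] (hθ : 1 ≤ θ) (v : Fin r) (i j : Fin n)
    (w : List (Fin r ⊕ β)) (z : Edge r n → ℂ) :
    ‖∫ t, 𝓜.sdDefect v i j w (Function.update z (edge v i j) t) ∂𝓜.ν (edge v i j)‖ ≤
      (1 + 3 * (splits (Sum.inl v) w).length) * (errorBound θ i j * 𝓜.locPow v i j w z ^ 2) +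
      1 / (2 * n) * ((splits (Sum.inl v) w).map fun q =>
        ‖𝓜.word (Function.update z (edge v i j) 0) q.1 j i‖ ^ 2 +
          ‖𝓜.word (Function.update z (edge v i j) 0) q.2 j i‖ ^ 2).sum := by
  set e : Edge r n := edge v i j with he
  set Q := 𝓜.locPow v i j w z with hQ
  have hQ1 : 1 ≤ Q := 𝓜.one_le_locPow _ _ _ _ _
  set S := splits (Sum.inl v : Fin r ⊕ β) w with hS
  set W : List (Fin r ⊕ β) → Matrix (Fin n) (Fin n) ℂ := 𝓜.word (Function.update z e 0) with hW
  set X := (S.map fun q => W q.1 j j * W q.2 i i).sum with hX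
  set P := if i = j then 0 else (S.map fun q => W q.1 j i * W q.2 j i).sum with hP
  set κ := errorBound θ i j with hκ
  have hκ0 : 0 ≤ κ := errorBound_nonneg hθ i j
  have hent := continuous_entry i j
  have hT : Continuous fun t => 𝓜.sdDefect v i j w (Function.update z e t) :=
    (𝓜.continuous_sdDefect v i j w).comp
      ((continuous_update_uncurry e).comp (Continuous.prodMk_right z))
  have hc1 : Continuous fun t => entry i j t * W w j i := by fun_prop
  have hc2 : Continuous fun t => (((‖entry i j t‖ ^ 2 : ℝ) : ℂ) - (n : ℂ)⁻¹) * X := by fun_prop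
  have hc3 : Continuous fun t => entry i j t ^ 2 * P := by fun_prop
  have I1 := 𝓜.integrable_entry hc1 e
  have I2 := 𝓜.integrable_entry hc2 e
  have I3 := 𝓜.integrable_entry hc3 e
  have I12 : Integrable (fun t => entry i j t * W w j i +
    (((‖entry i j t‖ ^ 2 : ℝ) : ℂ) - (n : ℂ)⁻¹) * X) (𝓜.ν e) := I1.add I2
  have I123 : Integrable (fun t => entry i j t * W w j i +
    (((‖entry i j t‖ ^ 2 : ℝ) : ℂ) - (n : ℂ)⁻¹) * X + entry i j t ^ 2 * P) (𝓜.ν e) := I12.add I3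
  have IT := 𝓜.integrable_entry hT e
  set s := ∫ t, ‖entry i j t‖ ^ 2 ∂𝓜.ν e with hs
  have hmain : ∫ t, 𝓜.sdDefect v i j w (Function.update z e t) ∂𝓜.ν e =
      ∫ t, (𝓜.sdDefect v i j w (Function.update z e t) - (entry i j t * W w j i +
        (((‖entry i j t‖ ^ 2 : ℝ) : ℂ) - (n : ℂ)⁻¹) * X + entry i j t ^ 2 * P)) ∂𝓜.ν e +
      (((s : ℂ) - (n : ℂ)⁻¹) * X + (∫ t, entry i j t ^ 2 ∂𝓜.ν e) * P) := by
    rw [integral_sub IT I123, integral_add I12 I3, integral_add I1 I2, integral_mul_const,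
      integral_mul_const, integral_mul_const, he, 𝓜.integral_entry v i j, ← he,
      integral_sub (𝓜.integrable_entry (by fun_prop) e) (integrable_const _),
      integral_complex_ofReal]
    simp [← hs]
  have hE : ‖∫ t, (𝓜.sdDefect v i j w (Function.update z e t) - (entry i j t * W w j i +
        (((‖entry i j t‖ ^ 2 : ℝ) : ℂ) - (n : ℂ)⁻¹) * X + entry i j t ^ 2 * P)) ∂𝓜.ν e‖ ≤
      κ * Q + 1 / n * (S.length * (2 * (1 / √n) * Q ^ 2)) := by
    have K1 : Integrable (fun t => ‖entry i j t‖ ^ 3 * Q) (𝓜.ν e) :=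
      𝓜.integrable_entry (by fun_prop) e
    have K2 : Integrable (fun t => ‖entry i j t‖ * (1 / n * (S.length * (2 * Q ^ 2)))) (𝓜.ν e) :=
      𝓜.integrable_entry (by fun_prop) e
    calc _ ≤ ∫ t, (‖entry i j t‖ ^ 3 * Q +
          ‖entry i j t‖ * (1 / n * (S.length * (2 * Q ^ 2)))) ∂𝓜.ν e := by
          refine norm_integral_le_of_norm_le (K1.add K2) ?_
          filter_upwards [𝓜.norm_le e] with t ht
          refine (𝓜.norm_sdDefect_sub_le v i j w z ht).trans (le_of_eq ?_)
          rw [← hQ]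
          ring
      _ = (∫ t, ‖entry i j t‖ ^ 3 ∂𝓜.ν e) * Q +
          (∫ t, ‖entry i j t‖ ∂𝓜.ν e) * (1 / n * (S.length * (2 * Q ^ 2))) := by
          rw [integral_add K1 K2, integral_mul_const, integral_mul_const]
      _ ≤ κ * Q + (1 / √n) * (1 / n * (S.length * (2 * Q ^ 2))) := by
          have h1 := 𝓜.integral_norm_entry_cube_le (by linarith) v i j
          have h2 := 𝓜.integral_norm_entry_le v i j
          gcongr
      _ = _ := by ring
  have hXb : ‖X‖ ≤ S.length * Q ^ 2 := by
    rw [← list_sum_map_const]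
    refine (norm_list_sum_le _ _).trans (list_sum_map_le _ fun q hq => ?_)
    obtain ⟨hq1, hq2⟩ := sublist_of_mem_splits hq
    have b1 := norm_apply_le_five_locSize (M₀ := letters 𝓜.B (Function.update z e 0))
      (i := i) (j := j) hq1 (a := j) (b := j) (Or.inr rfl) (Or.inr rfl)
    have b2 := norm_apply_le_five_locSize (M₀ := letters 𝓜.B (Function.update z e 0))
      (i := i) (j := j) hq2 (a := i) (b := i) (Or.inl rfl) (Or.inl rfl)
    rw [norm_mul, sq]
    exact mul_le_mul b1 b2 (norm_nonneg _) (by linarith)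
  have hPb : ‖P‖ ≤ 1 / 2 * (S.map fun q => ‖W q.1 j i‖ ^ 2 + ‖W q.2 j i‖ ^ 2).sum := by
    have hpos : 0 ≤ (S.map fun q => ‖W q.1 j i‖ ^ 2 + ‖W q.2 j i‖ ^ 2).sum := List.sum_nonneg (by
      simp only [List.mem_map]
      rintro x ⟨q, -, rfl⟩
      positivity)
    rw [hP]
    split_ifs
    · rw [norm_zero]; positivity
    · rw [← List.sum_map_mul_left]
      refine (norm_list_sum_le _ _).trans (list_sum_map_le _ fun q hq => ?_)
      rw [norm_mul]
      nlinarith [sq_nonneg (‖W q.1 j i‖ - ‖W q.2 j i‖)]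
  have hs1 : ‖(s : ℂ) - (n : ℂ)⁻¹‖ ≤ κ := by
    have h := 𝓜.abs_sub_integral_norm_entry_sq_le (by linarith) v i j
    rw [show (s : ℂ) - (n : ℂ)⁻¹ = ((s - 1 / n : ℝ) : ℂ) by push_cast; ring, Complex.norm_real,
      Real.norm_eq_abs, abs_sub_comm]
    exact h
  have hy2 : ‖∫ t, entry i j t ^ 2 ∂𝓜.ν e‖ ≤ 1 / n := by
    refine (norm_integral_le_integral_norm _).trans ?_
    simp_rw [norm_pow]
    exact 𝓜.integral_norm_entry_sq_le v i j
  rw [hmain]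
  have hκ2 : 1 / (n : ℝ) * (1 / √n) ≤ κ := inv_mul_inv_sqrt_le_errorBound hθ i j
  have hQQ : Q ≤ Q ^ 2 := by nlinarith
  calc _ ≤ (κ * Q + 1 / n * (S.length * (2 * (1 / √n) * Q ^ 2))) + (κ * (S.length * Q ^ 2) +
        1 / n * (1 / 2 * (S.map fun q => ‖W q.1 j i‖ ^ 2 + ‖W q.2 j i‖ ^ 2).sum)) := by
        refine (norm_add_le _ _).trans (add_le_add hE ((norm_add_le _ _).trans ?_))
        rw [norm_mul, norm_mul]
        gcongr
    _ = κ * Q + (1 / n * (1 / √n)) * (2 * S.length * Q ^ 2) + κ * (S.length * Q ^ 2) +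
        1 / (2 * n) * (S.map fun q => ‖W q.1 j i‖ ^ 2 + ‖W q.2 j i‖ ^ 2).sum := by ring
    _ ≤ κ * Q ^ 2 + κ * (2 * S.length * Q ^ 2) + κ * (S.length * Q ^ 2) +
        1 / (2 * n) * (S.map fun q => ‖W q.1 j i‖ ^ 2 + ‖W q.2 j i‖ ^ 2).sum := by gcongr
    _ = _ := by ring

/-- The expected defect, in terms of the words with the entry `(i, j)` put back. -/
theorem norm_integral_sdDefect_le [DecidableEq β] (hθ : 1 ≤ θ) (v : Fin r) (i j : Fin n)
    (w : List (Fin r ⊕ β)) :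
    ‖∫ z, 𝓜.sdDefect v i j w z ∂𝓜.law‖ ≤
      (1 + 5 * (splits (Sum.inl v) w).length) *
        (errorBound θ i j * ∫ z, 𝓜.locPow v i j w z ^ 2 ∂𝓜.law) +
      1 / n * ((splits (Sum.inl v) w).map fun q =>
        ∫ z, ‖𝓜.word z q.1 j i‖ ^ 2 ∂𝓜.law + ∫ z, ‖𝓜.word z q.2 j i‖ ^ 2 ∂𝓜.law).sum := by
  set e : Edge r n := edge v i j with he
  set S := splits (Sum.inl v : Fin r ⊕ β) w with hS
  set I := ∫ z, 𝓜.locPow v i j w z ^ 2 ∂𝓜.law with hI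
  have hI0 : 0 ≤ I := integral_nonneg fun z => sq_nonneg _
  have hQ := 𝓜.continuous_locPow v i j w
  have hword : ∀ (R : List (Fin r ⊕ β)) a b, Continuous fun z =>
      ‖𝓜.word (Function.update z e 0) R a b‖ ^ 2 := fun R a b =>
    (((𝓜.continuous_word_apply R a b).comp (continuous_update_zero e)).norm.pow 2)
  set ρ : (Edge r n → ℂ) → ℝ := fun z => (S.map fun q =>
    ‖𝓜.word (Function.update z e 0) q.1 j i‖ ^ 2 +
    ‖𝓜.word (Function.update z e 0) q.2 j i‖ ^ 2).sum with hρ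
  have hρc : Continuous ρ := continuous_list_sum _ fun q _ => (hword q.1 j i).add (hword q.2 j i)
  have step1 := 𝓜.norm_integral_le_of_update (𝓜.continuous_sdDefect v i j w) e
    (G := fun z => (1 + 3 * S.length) * (errorBound θ i j * 𝓜.locPow v i j w z ^ 2) +
      1 / (2 * n) * ρ z) (by fun_prop)
    (fun z => 𝓜.norm_integral_sdDefect_update_le hθ v i j w z)
  have i1 : Integrable (fun z => (1 + 3 * S.length) *
    (errorBound θ i j * 𝓜.locPow v i j w z ^ 2)) 𝓜.law := 𝓜.integrable (by fun_prop)
  have i2 : Integrable (fun z => 1 / (2 * n) * ρ z) 𝓜.law := 𝓜.integrable (by fun_prop)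
  rw [integral_add i1 i2, integral_const_mul, integral_const_mul, integral_const_mul] at step1
  have step2 : ∫ z, ρ z ∂𝓜.law ≤ 2 * (S.map fun q =>
          ∫ z, ‖𝓜.word z q.1 j i‖ ^ 2 ∂𝓜.law + ∫ z, ‖𝓜.word z q.2 j i‖ ^ 2 ∂𝓜.law).sum +
          S.length * (4 / n * I) := by
    have hl := (integral_list_sum (P := 𝓜.law) S (fun q z =>
      ‖𝓜.word (Function.update z e 0) q.1 j i‖ ^ 2 +
      ‖𝓜.word (Function.update z e 0) q.2 j i‖ ^ 2) fun q _ => 𝓜.integrable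
      ((hword q.1 j i).add (hword q.2 j i))).2
    rw [show ∫ z, ρ z ∂𝓜.law = _ from hl, ← list_sum_map_const, ← List.sum_map_mul_left,
      ← List.sum_map_add]
    refine list_sum_map_le _ fun q hq => ?_
    rw [integral_add (𝓜.integrable (hword _ _ _)) (𝓜.integrable (hword _ _ _))]
    obtain ⟨hq1, hq2⟩ := sublist_of_mem_splits hq
    have b1 := 𝓜.integral_norm_word_update_zero_sq_le v i j hq1
      (a := j) (b := i) (Or.inr rfl) (Or.inl rfl)
    have b2 := 𝓜.integral_norm_word_update_zero_sq_le v i j hq2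
      (a := j) (b := i) (Or.inr rfl) (Or.inl rfl)
    rw [← hI] at b1 b2
    have : 4 / n * I = 2 / n * I + 2 / n * I := by ring
    linarith
  have h3 := mul_le_mul_of_nonneg_right (inv_sq_le_errorBound hθ i j) hI0
  have hn : (0 : ℝ) ≤ 1 / (2 * n) := by positivity
  have h4 := mul_le_mul_of_nonneg_left step2 hn
  have h5 : (0 : ℝ) ≤ 2 * S.length := by positivity
  have h6 := mul_le_mul_of_nonneg_left h3 h5
  refine step1.trans ((add_le_add_right h4 _).trans ?_)
  ring_nf at h6 ⊢
  linarith

/-- The Schwinger–Dyson equation for expected normalized traces, up to an error of order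
`n ^ (-1/2)`. -/
theorem exists_schwingerDyson_bound [DecidableEq β] (r : ℕ) (hθ : 1 ≤ θ) (v : Fin r)
    (w : List (Fin r ⊕ β)) :
    ∃ C : ℝ, ∀ (n : ℕ) (𝓜 : Ensemble r β θ n),
      ‖∫ z, 𝓜.ntr (Sum.inl v :: w) z ∂𝓜.law - ((splits (Sum.inl v) w).map fun q =>
        ∫ z, 𝓜.ntr q.1 z * 𝓜.ntr q.2 z ∂𝓜.law).sum‖ ≤ C / √n := by
  choose C hC0 hC using fun R => exists_absMoment_word_bound r β θ 1 R
  obtain ⟨D, hD0, hD⟩ := exists_locPow_bound r β θ w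
  set S := splits (Sum.inl v : Fin r ⊕ β) w with hS
  obtain ⟨N, hN⟩ : ∃ N : ℝ, N = (S.length : ℝ) := ⟨_, rfl⟩
  have hN0 : 0 ≤ N := hN ▸ Nat.cast_nonneg _
  set T : ℝ := (S.map fun q => C q.1 + C q.2).sum with hT
  have hT0 : 0 ≤ T := List.sum_nonneg (by
    simp only [List.mem_map]
    rintro x ⟨q, -, rfl⟩
    exact add_nonneg (hC0 _) (hC0 _))
  refine ⟨(1 + 5 * N) * ((2 * θ + 4) * D) + T, fun n 𝓜 => ?_⟩
  rcases Nat.eq_zero_or_pos n with h0 | h0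
  · subst h0
    simp [ntr, normalizedTrace_apply]
  have hn : (0 : ℝ) < n := by exact_mod_cast h0
  have hn1 : (1 : ℝ) ≤ n := by exact_mod_cast h0
  have hs : 1 ≤ √(n : ℝ) := Real.one_le_sqrt.2 hn1
  obtain ⟨U, hU0, hUsum, hU⟩ := hD n 𝓜
  have hTi : ∀ i j, Integrable (𝓜.sdDefect v i j w) 𝓜.law := fun i j =>
    𝓜.integrable (𝓜.continuous_sdDefect v i j w)
  -- writing out the first factor of the trace, the equation becomes a sum of defects of entries
  have hpt : ∀ z, 𝓜.ntr (Sum.inl v :: w) z - (S.map fun q => 𝓜.ntr q.1 z * 𝓜.ntr q.2 z).sum =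
      (n : ℂ)⁻¹ * ∑ i, ∑ j, 𝓜.sdDefect v i j w z := by
    intro z
    have e1 : 𝓜.ntr (Sum.inl v :: w) z =
        (n : ℂ)⁻¹ * ∑ i, ∑ j, hermitianOf z v i j * 𝓜.word z w j i := by
      rw [ntr, normalizedTrace_apply, word, evalWord_cons, trace]
      simp [mul_apply, letters, word]
    have e2 : ∑ i, ∑ j, (S.map fun q => 𝓜.word z q.1 j j * 𝓜.word z q.2 i i).sum =
        (S.map fun q => trace (𝓜.word z q.1) * trace (𝓜.word z q.2)).sum := by
      generalize S = S'
      induction S' with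
      | nil => simp
      | cons q S' ih =>
        simp only [List.map_cons, List.sum_cons, Finset.sum_add_distrib, ih]
        rw [trace, trace, Finset.sum_mul_sum, Finset.sum_comm]
        rfl
    have e3 : (S.map fun q => 𝓜.ntr q.1 z * 𝓜.ntr q.2 z).sum = (n : ℂ)⁻¹ * ((n : ℂ)⁻¹ *
        (S.map fun q => trace (𝓜.word z q.1) * trace (𝓜.word z q.2)).sum) := by
      rw [← List.sum_map_mul_left, ← List.sum_map_mul_left]
      congr 1
      refine List.map_congr_left fun q _ => ?_
      rw [ntr, ntr, normalizedTrace_apply, normalizedTrace_apply]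
      ring
    rw [e1, e3, ← e2]
    simp only [sdDefect, Finset.sum_sub_distrib, ← Finset.mul_sum, ← hS]
    ring
  have hint1 := 𝓜.integrable (𝓜.continuous_ntr (Sum.inl v :: w))
  have hint2 := integral_list_sum (P := 𝓜.law) S (fun q z => 𝓜.ntr q.1 z * 𝓜.ntr q.2 z)
    fun q _ => 𝓜.integrable ((𝓜.continuous_ntr q.1).mul (𝓜.continuous_ntr q.2))
  rw [← hint2.2, ← integral_sub hint1 hint2.1]
  simp_rw [hpt]
  rw [integral_const_mul, integral_finsetSum _ fun i _ => integrable_finsetSum _ fun j _ => hTi i j]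
  simp_rw [integral_finsetSum Finset.univ fun j _ => hTi _ j]
  rw [norm_mul, norm_inv, Complex.norm_natCast]
  have h2 : ∀ i j, ‖∫ z, 𝓜.sdDefect v i j w z ∂𝓜.law‖ ≤
      (1 + 5 * N) * (errorBound θ i j * (U i + U j)) +
      1 / n * (S.map fun q =>
        ∫ z, ‖𝓜.word z q.1 j i‖ ^ 2 ∂𝓜.law + ∫ z, ‖𝓜.word z q.2 j i‖ ^ 2 ∂𝓜.law).sum := by
    intro i j
    refine (𝓜.norm_integral_sdDefect_le hθ v i j w).trans ?_
    have := hU v i j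
    have := errorBound_nonneg hθ i j
    rw [← hS, ← hN]
    gcongr
  have h3 : ∑ i, ∑ j, (S.map fun q =>
        ∫ z, ‖𝓜.word z q.1 j i‖ ^ 2 ∂𝓜.law + ∫ z, ‖𝓜.word z q.2 j i‖ ^ 2 ∂𝓜.law).sum ≤ T * n := by
    simp only [hT]
    generalize S = S'
    induction S' with
    | nil => simp
    | cons q S' ih =>
      simp only [List.map_cons, List.sum_cons, Finset.sum_add_distrib] at ih ⊢
      have e : ∀ R, ∑ i, ∑ j, ∫ z, ‖𝓜.word z R j i‖ ^ 2 ∂𝓜.law =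
        ∫ z, absMoment 1 (𝓜.word z R) ∂𝓜.law := fun R => by
          rw [Finset.sum_comm, 𝓜.sum_integral_norm_word_sq R]
      have e3 := hC q.1 n 𝓜
      have e4 := hC q.2 n 𝓜
      rw [e, e]
      linarith
  have h4 := sum_errorBound_mul_le (n := n) (zero_le_one.trans hθ) hD0 hUsum
  calc _ ≤ (n : ℝ)⁻¹ * ∑ i, ∑ j, ((1 + 5 * N) * (errorBound θ i j * (U i + U j)) +
      1 / n * (S.map fun q =>
        ∫ z, ‖𝓜.word z q.1 j i‖ ^ 2 ∂𝓜.law + ∫ z, ‖𝓜.word z q.2 j i‖ ^ 2 ∂𝓜.law).sum) := by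
        refine mul_le_mul_of_nonneg_left ?_ (by positivity)
        refine (norm_sum_le _ _).trans (Finset.sum_le_sum fun i _ => ?_)
        exact (norm_sum_le _ _).trans (Finset.sum_le_sum fun j _ => h2 i j)
    _ = (n : ℝ)⁻¹ * ((1 + 5 * N) * (∑ i, ∑ j, errorBound θ i j * (U i + U j)) +
      1 / n * ∑ i, ∑ j, (S.map fun q =>
        ∫ z, ‖𝓜.word z q.1 j i‖ ^ 2 ∂𝓜.law + ∫ z, ‖𝓜.word z q.2 j i‖ ^ 2 ∂𝓜.law).sum) := by
        simp only [← Finset.mul_sum, Finset.sum_add_distrib]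
    _ ≤ (n : ℝ)⁻¹ * ((1 + 5 * N) * ((2 * θ + 4) * D * √n) + 1 / n * (T * n)) := by gcongr
    _ = (n : ℝ)⁻¹ * ((1 + 5 * N) * ((2 * θ + 4) * D) * √n + T * 1) := by field_simp
    _ ≤ (n : ℝ)⁻¹ * ((1 + 5 * N) * ((2 * θ + 4) * D) * √n + T * √n) := by gcongr
    _ = ((1 + 5 * N) * ((2 * θ + 4) * D) + T) * (√n / n) := by ring
    _ = _ := by rw [Real.sqrt_div_self']; ring

end Ensemble

end SchwingerDyson

end NCProb


namespace NCProb

/-! ### Freeness and the Schwinger–Dyson equation -/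

section FreeSide

variable {α K : Type*}

/-- The word `w`, as a monomial of the free algebra. -/
noncomputable def monomialWord (w : List α) : FreeAlgebra ℂ α := evalWord (FreeAlgebra.ι ℂ) w

@[simp] theorem monomialWord_nil : monomialWord ([] : List α) = 1 := rfl

theorem monomialWord_cons (c : α) (w : List α) :
    monomialWord (c :: w) = FreeAlgebra.ι ℂ c * monomialWord w := evalWord_cons _ _ _

theorem monomialWord_append (u w : List α) :
    monomialWord (u ++ w) = monomialWord u * monomialWord w := evalWord_append _ _ _

theorem map_monomialWord {A : Type*} [Ring A] [Algebra ℂ A] (f : FreeAlgebra ℂ α →ₐ[ℂ] A)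
    (w : List α) : f (monomialWord w) = evalWord (fun c => f (FreeAlgebra.ι ℂ c)) w := by
  induction w with
  | nil => simp
  | cons c w ih => rw [monomialWord_cons, map_mul, ih, evalWord_cons]

theorem basisFreeMonoid_apply (w : List α) :
    FreeAlgebra.basisFreeMonoid ℂ α (FreeMonoid.ofList w) = monomialWord w := by
  simp [FreeAlgebra.basisFreeMonoid, FreeAlgebra.equivMonoidAlgebraFreeMonoid, monomialWord,
    evalWord, FreeMonoid.lift_apply]

theorem span_range_monomialWord :
    Submodule.span ℂ (Set.range (monomialWord (α := α))) = ⊤ := by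
  rw [← (FreeAlgebra.basisFreeMonoid ℂ α).span_eq]
  congr 1
  ext f
  constructor
  · rintro ⟨w, rfl⟩
    exact ⟨_, basisFreeMonoid_apply w⟩
  · rintro ⟨w, rfl⟩
    exact ⟨w.toList, (basisFreeMonoid_apply _).symm⟩

theorem linearMap_ext_monomialWord {f g : FreeAlgebra ℂ α →ₗ[ℂ] ℂ}
    (h : ∀ w, f (monomialWord w) = g (monomialWord w)) : f = g :=
  LinearMap.ext_on_range span_range_monomialWord h

/-- A submodule of the free algebra that contains `1` and is stable under left multiplication
by the generators is everything. -/
theorem mem_of_forall_generator_mul_mem (N : Submodule ℂ (FreeAlgebra ℂ α)) (h1 : 1 ∈ N)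
    (h : ∀ c, ∀ f ∈ N, FreeAlgebra.ι ℂ c * f ∈ N) (f : FreeAlgebra ℂ α) : f ∈ N := by
  have hw : ∀ w : List α, monomialWord w ∈ N := fun w => by
    induction w with
    | nil => exact h1
    | cons c w ih => rw [monomialWord_cons]; exact h c _ ih
  have hle : Submodule.span ℂ (Set.range (monomialWord (α := α))) ≤ N :=
    Submodule.span_le.2 (by rintro _ ⟨w, rfl⟩; exact hw w)
  exact hle (span_range_monomialWord (α := α) ▸ Submodule.mem_top)

/-- The polynomials in the letters of kind `k`: the span of the words in these letters. -/
noncomputable def kindSpan (κ : α → K) (k : K) : Submodule ℂ (FreeAlgebra ℂ α) :=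
  Submodule.span ℂ (monomialWord '' {w | ∀ c ∈ w, κ c = k})

variable {κ : α → K} {k : K}

theorem monomialWord_mem_kindSpan {w : List α} (hw : ∀ c ∈ w, κ c = k) :
    monomialWord w ∈ kindSpan κ k := Submodule.subset_span ⟨w, hw, rfl⟩

theorem one_mem_kindSpan : (1 : FreeAlgebra ℂ α) ∈ kindSpan κ k :=
  monomialWord_mem_kindSpan (w := []) (by simp)

theorem generator_mul_mem_kindSpan {c : α} (hc : κ c = k) {f : FreeAlgebra ℂ α}
    (hf : f ∈ kindSpan κ k) : FreeAlgebra.ι ℂ c * f ∈ kindSpan κ k := by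
  have hle : kindSpan κ k ≤
      (kindSpan κ k).comap (LinearMap.mulLeft ℂ (FreeAlgebra.ι ℂ c)) := by
    refine Submodule.span_le.2 ?_
    rintro _ ⟨w, hw, rfl⟩
    change FreeAlgebra.ι ℂ c * monomialWord w ∈ kindSpan κ k
    rw [← monomialWord_cons]
    refine monomialWord_mem_kindSpan ?_
    simpa [hc] using hw
  exact hle hf

theorem sub_smul_one_mem_kindSpan {f : FreeAlgebra ℂ α} (hf : f ∈ kindSpan κ k) (s : ℂ) :
    f - s • 1 ∈ kindSpan κ k :=
  Submodule.sub_mem _ hf (Submodule.smul_mem _ _ one_mem_kindSpan)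

/-- The list `l` of polynomials, each tagged with a kind, is alternating (neighbours have different
kinds), each polynomial involves only letters of its kind, and is centred for `φ`. -/
def IsAlternating (κ : α → K) (φ : FreeAlgebra ℂ α →ₗ[ℂ] ℂ) (l : List (K × FreeAlgebra ℂ α)) :
    Prop :=
  l.IsChain (fun a b => a.1 ≠ b.1) ∧ ∀ q ∈ l, q.2 ∈ kindSpan κ q.1 ∧ φ q.2 = 0

/-- Freeness, for `φ`, of the algebras generated by the letters of the various kinds. -/
def IsFreeKinds (κ : α → K) (φ : FreeAlgebra ℂ α →ₗ[ℂ] ℂ) : Prop :=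
  ∀ l, l ≠ [] → IsAlternating κ φ l → φ (l.map Prod.snd).prod = 0

variable {φ : FreeAlgebra ℂ α →ₗ[ℂ] ℂ}

theorem IsAlternating.nil : IsAlternating κ φ [] := ⟨List.isChain_nil, by simp⟩

theorem isAlternating_cons_iff {q : K × FreeAlgebra ℂ α} {l : List (K × FreeAlgebra ℂ α)} :
    IsAlternating κ φ (q :: l) ↔ (∀ q' ∈ l.head?, q.1 ≠ q'.1) ∧ q.2 ∈ kindSpan κ q.1 ∧ φ q.2 = 0 ∧
      IsAlternating κ φ l := by
  simp only [IsAlternating, List.isChain_cons, List.mem_cons, forall_eq_or_imp]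
  tauto

/-- The alternating products of centred polynomials span. -/
theorem span_isAlternating (hφ : φ 1 = 1) (f : FreeAlgebra ℂ α) :
    f ∈ Submodule.span ℂ ((fun l : List (K × FreeAlgebra ℂ α) => (l.map Prod.snd).prod) ''
      {l | IsAlternating κ φ l}) := by
  set N := Submodule.span ℂ ((fun l : List (K × FreeAlgebra ℂ α) => (l.map Prod.snd).prod) ''
      {l | IsAlternating κ φ l}) with hN
  have hmem : ∀ l : List (K × FreeAlgebra ℂ α), IsAlternating κ φ l → (l.map Prod.snd).prod ∈ N :=
    fun l hl => Submodule.subset_span ⟨l, hl, rfl⟩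
  clear_value N
  refine mem_of_forall_generator_mul_mem N (hmem [] IsAlternating.nil)
    (fun c f hf => ?_) f
  have hadd : ∀ (l : List (K × FreeAlgebra ℂ α)) (u : FreeAlgebra ℂ α), IsAlternating κ φ l →
      (∀ q ∈ l.head?, κ c ≠ q.1) → u ∈ kindSpan κ (κ c) → u * (l.map Prod.snd).prod ∈ N := by
    intro l u hl hc hu
    have e : u * (l.map Prod.snd).prod =
        (((κ c, u - φ u • 1) :: l).map Prod.snd).prod + φ u • (l.map Prod.snd).prod := by
      simp [sub_mul]
    rw [e]
    exact Submodule.add_mem _ (hmem _ (isAlternating_cons_iff.2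
      ⟨hc, sub_smul_one_mem_kindSpan hu _, by simp [hφ], hl⟩))
      (Submodule.smul_mem _ _ (hmem l hl))
  have hle : N ≤ N.comap (LinearMap.mulLeft ℂ (FreeAlgebra.ι ℂ c)) := by
    rw [hN]
    refine Submodule.span_le.2 ?_
    rintro _ ⟨l, hl, rfl⟩
    change FreeAlgebra.ι ℂ c * (l.map Prod.snd).prod ∈ Submodule.span _ _
    rw [← hN]
    rcases l with _ | ⟨q, l⟩
    · exact hadd [] _ IsAlternating.nil (by simp)
        (mul_one (FreeAlgebra.ι ℂ c) ▸ generator_mul_mem_kindSpan rfl one_mem_kindSpan)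
    · by_cases hq : κ c = q.1
      · obtain ⟨h1, h2, -, h4⟩ := isAlternating_cons_iff.1 hl
        rw [List.map_cons, List.prod_cons, ← mul_assoc]
        exact hadd l _ h4 (by rwa [hq]) (generator_mul_mem_kindSpan rfl (by rwa [hq]))
      · exact hadd (q :: l) _ hl (by simpa using hq)
          (mul_one (FreeAlgebra.ι ℂ c) ▸ generator_mul_mem_kindSpan rfl one_mem_kindSpan)
  exact hle hf

variable [DecidableEq α]

theorem splits_append (ℓ : α) (w p : List α) :
    splits ℓ (w ++ p) = ((splits ℓ w).map fun q => (q.1, q.2 ++ p)) ++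
      (splits ℓ p).map fun q => (w ++ q.1, q.2) := by
  induction w with
  | nil => simp [splits]
  | cons c s ih =>
    simp only [List.cons_append, splits, ih, List.map_append, List.map_map, List.append_assoc]
    congr 1
    split_ifs <;> simp

/-- The functional `(ψ ⊗ χ) ∘ ∂`, where `∂` is the free difference quotient with respect to the
letter `v`: on a word it is the sum of `ψ s₁ * χ s₂` over the decompositions `s₁ v s₂`. -/
noncomputable def splitFunctional (v : α) (ψ χ : FreeAlgebra ℂ α →ₗ[ℂ] ℂ) :
    FreeAlgebra ℂ α →ₗ[ℂ] ℂ :=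
  (FreeAlgebra.basisFreeMonoid ℂ α).constr ℂ fun w =>
    ((splits v (FreeMonoid.toList w)).map fun q => ψ (monomialWord q.1) * χ (monomialWord q.2)).sum

variable {v : α} {ψ ψ' χ χ' : FreeAlgebra ℂ α →ₗ[ℂ] ℂ}

theorem splitFunctional_monomialWord (v : α) (ψ χ : FreeAlgebra ℂ α →ₗ[ℂ] ℂ) (w : List α) :
    splitFunctional v ψ χ (monomialWord w) =
      ((splits v w).map fun q => ψ (monomialWord q.1) * χ (monomialWord q.2)).sum := by
  rw [← basisFreeMonoid_apply, splitFunctional, Module.Basis.constr_basis, FreeMonoid.toList_ofList]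

theorem splitFunctional_add_left :
    splitFunctional v (ψ + ψ') χ = splitFunctional v ψ χ + splitFunctional v ψ' χ :=
  linearMap_ext_monomialWord fun w => by
    simp only [splitFunctional_monomialWord, LinearMap.add_apply, add_mul, List.sum_map_add]

theorem splitFunctional_smul_left (s : ℂ) :
    splitFunctional v (s • ψ) χ = s • splitFunctional v ψ χ :=
  linearMap_ext_monomialWord fun w => by
    simp only [splitFunctional_monomialWord, LinearMap.smul_apply, smul_eq_mul, mul_assoc,
      List.sum_map_mul_left]

theorem splitFunctional_smul_right (s : ℂ) :
    splitFunctional v ψ (s • χ) = s • splitFunctional v ψ χ :=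
  linearMap_ext_monomialWord fun w => by
    simp only [splitFunctional_monomialWord, LinearMap.smul_apply, smul_eq_mul, mul_left_comm _ s,
      List.sum_map_mul_left]

theorem splitFunctional_add_right :
    splitFunctional v ψ (χ + χ') = splitFunctional v ψ χ + splitFunctional v ψ χ' :=
  linearMap_ext_monomialWord fun w => by
    simp only [splitFunctional_monomialWord, LinearMap.add_apply, mul_add, List.sum_map_add]

/-- The Leibniz rule for the free difference quotient. -/
theorem splitFunctional_mul (f g : FreeAlgebra ℂ α) :
    splitFunctional v ψ χ (f * g) =
      splitFunctional v ψ (χ ∘ₗ LinearMap.mulRight ℂ g) f +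
      splitFunctional v (ψ ∘ₗ LinearMap.mulLeft ℂ f) χ g := by
  have hf : f ∈ Submodule.span ℂ (Set.range (monomialWord (α := α))) :=
    span_range_monomialWord (α := α) ▸ Submodule.mem_top
  have hg : g ∈ Submodule.span ℂ (Set.range (monomialWord (α := α))) :=
    span_range_monomialWord (α := α) ▸ Submodule.mem_top
  induction hf using Submodule.span_induction with
  | zero =>
    rw [zero_mul, map_zero, map_zero]
    have : ψ ∘ₗ LinearMap.mulLeft ℂ (0 : FreeAlgebra ℂ α) = (0 : ℂ) • ψ := by ext; simp
    rw [this, splitFunctional_smul_left]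
    simp
  | add f f' _ _ h h' =>
    have : ψ ∘ₗ LinearMap.mulLeft ℂ (f + f') =
        ψ ∘ₗ LinearMap.mulLeft ℂ f + ψ ∘ₗ LinearMap.mulLeft ℂ f' := by
      ext x; simp [add_mul]
    rw [add_mul, map_add, map_add, h, h', this, splitFunctional_add_left, LinearMap.add_apply]
    ring
  | smul s f _ h =>
    have : ψ ∘ₗ LinearMap.mulLeft ℂ (s • f) = s • (ψ ∘ₗ LinearMap.mulLeft ℂ f) := by
      ext x; simp
    rw [smul_mul_assoc, map_smul, map_smul, h, this, splitFunctional_smul_left,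
      LinearMap.smul_apply, smul_add]
  | mem f hf =>
    obtain ⟨w, rfl⟩ := hf
    induction hg using Submodule.span_induction with
    | zero =>
      rw [mul_zero, map_zero, map_zero]
      have : χ ∘ₗ LinearMap.mulRight ℂ (0 : FreeAlgebra ℂ α) = (0 : ℂ) • χ := by ext; simp
      rw [this, splitFunctional_smul_right]
      simp
    | add g g' _ _ h h' =>
      have : χ ∘ₗ LinearMap.mulRight ℂ (g + g') =
          χ ∘ₗ LinearMap.mulRight ℂ g + χ ∘ₗ LinearMap.mulRight ℂ g' := by
        ext x; simp [mul_add]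
      rw [mul_add, map_add, map_add, h, h', this, splitFunctional_add_right, LinearMap.add_apply]
      ring
    | smul s g _ h =>
      have : χ ∘ₗ LinearMap.mulRight ℂ (s • g) = s • (χ ∘ₗ LinearMap.mulRight ℂ g) := by
        ext x; simp
      rw [mul_smul_comm, map_smul, map_smul, h, this, splitFunctional_smul_right,
        LinearMap.smul_apply, smul_add]
    | mem g hg =>
      obtain ⟨p, rfl⟩ := hg
      simp [← monomialWord_append, splitFunctional_monomialWord, splits_append, Function.comp_def]

theorem splitFunctional_congr {f : FreeAlgebra ℂ α} (hf : f ∈ kindSpan κ k)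
    (h : κ v = k → ∀ u ∈ kindSpan κ k, ∀ u' ∈ kindSpan κ k, ψ u * χ u' = ψ' u * χ' u') :
    splitFunctional v ψ χ f = splitFunctional v ψ' χ' f := by
  have hle : kindSpan κ k ≤ LinearMap.eqLocus
      (splitFunctional v ψ χ) (splitFunctional v ψ' χ') := by
    refine Submodule.span_le.2 ?_
    rintro _ ⟨w, hw, rfl⟩
    change splitFunctional v ψ χ _ = splitFunctional v ψ' χ' _
    rw [splitFunctional_monomialWord, splitFunctional_monomialWord]
    congr 1
    refine List.map_congr_left fun q hq => ?_
    have e := eq_of_mem_splits hq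
    subst e
    simp only [Set.mem_ofPred_eq, List.mem_append, List.mem_cons] at hw
    exact h (hw v (by simp)) _ (monomialWord_mem_kindSpan fun c hc => hw c (by simp [hc])) _
      (monomialWord_mem_kindSpan fun c hc => hw c (by simp [hc]))
  exact hle hf

theorem splitFunctional_zero_left : splitFunctional v 0 χ = 0 := by
  simpa using splitFunctional_smul_left (v := v) (ψ := 0) (χ := χ) 0

/-- Behind a nonempty prefix, the free difference quotient of an alternating product
of centred polynomials is killed by `φ ⊗ χ`: each left leg is alternating and centred up to
multiples of its last factor. -/
theorem splitFunctional_prefix_eq_zero (hφ : φ 1 = 1) (hfree : IsFreeKinds κ φ)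
    (l s : List (K × FreeAlgebra ℂ α)) (hl : l ≠ []) (h : IsAlternating κ φ (l ++ s)) :
    splitFunctional v (φ ∘ₗ LinearMap.mulLeft ℂ (l.map Prod.snd).prod) χ
      (s.map Prod.snd).prod = 0 := by
  induction s generalizing l χ with
  | nil =>
    have := splitFunctional_monomialWord v
      (φ ∘ₗ LinearMap.mulLeft ℂ (l.map Prod.snd).prod) χ []
    simpa [splits] using this
  | cons q s ih =>
    rw [List.map_cons, List.prod_cons, splitFunctional_mul]
    have hq := h.2 q (by simp)
    have hch := List.isChain_append.1 h.1
    have hlalt : IsAlternating κ φ l := ⟨hch.1, fun q' hq' => h.2 q' (by simp [hq'])⟩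
    have e1 : splitFunctional v (φ ∘ₗ LinearMap.mulLeft ℂ (l.map Prod.snd).prod)
        (χ ∘ₗ LinearMap.mulRight ℂ (s.map Prod.snd).prod) q.2 = 0 := by
      rw [splitFunctional_congr (ψ' := 0) (χ' := 0) hq.1 fun hv u hu u' _ => ?_,
        splitFunctional_zero_left, LinearMap.zero_apply]
      have h1 : φ ((l ++ [(q.1, u - φ u • 1)]).map Prod.snd).prod = 0 := by
        refine hfree _ (by simp) ⟨List.isChain_append.2 ⟨hch.1, by simp, ?_⟩, ?_⟩
        · intro a ha b hb
          simp only [List.head?_cons, Option.mem_def, Option.some.injEq] at hb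
          subst hb
          exact hch.2.2 a ha q (by simp)
        · simp only [List.mem_append, List.mem_singleton]
          rintro q' (h' | rfl)
          · exact hlalt.2 _ h'
          · exact ⟨sub_smul_one_mem_kindSpan hu _, by simp [hφ]⟩
      have h2 := hfree l hl hlalt
      simp only [List.map_append, List.map_cons, List.map_nil, List.prod_append,
        List.prod_singleton, mul_sub, map_sub, mul_smul_comm, mul_one, map_smul, h2,
        smul_zero, sub_zero] at h1
      simp [h1]
    have e2 := ih (χ := χ) (l ++ [q]) (by simp) (by simpa using h)
    rw [e1, zero_add]
    convert e2 using 3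
    ext x
    simp

/-- The Schwinger–Dyson equation passes from the algebra generated by the letters of
one kind to the whole algebra, behind any prefix `p` that is free from that algebra. -/
theorem schwingerDyson_of_isFreeKinds (hφ : φ 1 = 1) (hfree : IsFreeKinds κ φ)
    (hv : φ (FreeAlgebra.ι ℂ v) = 0)
    (hbase : ∀ f ∈ kindSpan κ (κ v), φ (FreeAlgebra.ι ℂ v * f) = splitFunctional v φ φ f)
    {p : FreeAlgebra ℂ α} (hp : ∀ u l, IsAlternating κ φ ((κ v, u) :: l) →
      φ (p * (u * (l.map Prod.snd).prod)) = 0) (f : FreeAlgebra ℂ α) :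
    φ (p * (FreeAlgebra.ι ℂ v * f)) =
      splitFunctional v φ (φ ∘ₗ LinearMap.mulLeft ℂ p) f := by
  -- behind `p`, a leading factor of the kind of `v` is split off by freeness
  have hkey : ∀ u l, u ∈ kindSpan κ (κ v) → IsAlternating κ φ l → (∀ q ∈ l.head?, κ v ≠ q.1) →
      φ (p * (u * (l.map Prod.snd).prod)) = φ u * φ (p * (l.map Prod.snd).prod) := by
    intro u l hu hl hh
    have := hp (u - φ u • 1) l (isAlternating_cons_iff.2
      ⟨hh, sub_smul_one_mem_kindSpan hu _, by simp [hφ], hl⟩)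
    simpa [sub_mul, mul_sub, sub_eq_zero] using this
  have hgen : FreeAlgebra.ι ℂ v ∈ kindSpan κ (κ v) :=
    mul_one (FreeAlgebra.ι ℂ v) ▸ generator_mul_mem_kindSpan rfl one_mem_kindSpan
  have hle : Submodule.span ℂ ((fun l : List (K × FreeAlgebra ℂ α) => (l.map Prod.snd).prod) ''
      {l | IsAlternating κ φ l}) ≤ LinearMap.eqLocus
      (φ ∘ₗ LinearMap.mulLeft ℂ p ∘ₗ LinearMap.mulLeft ℂ (FreeAlgebra.ι ℂ v))
      (splitFunctional v φ (φ ∘ₗ LinearMap.mulLeft ℂ p)) := by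
    refine Submodule.span_le.2 ?_
    rintro _ ⟨l, hl, rfl⟩
    change φ (p * (FreeAlgebra.ι ℂ v * (l.map Prod.snd).prod)) =
      splitFunctional v φ (φ ∘ₗ LinearMap.mulLeft ℂ p) (l.map Prod.snd).prod
    rcases l with _ | ⟨q, s⟩
    · rw [hkey _ [] hgen hl (by simp), hv]
      have := splitFunctional_monomialWord v φ (φ ∘ₗ LinearMap.mulLeft ℂ p) []
      simpa [splits] using this.symm
    · obtain ⟨h1, h2, h3, h4⟩ := isAlternating_cons_iff.1 hl
      have hpre : splitFunctional v (φ ∘ₗ LinearMap.mulLeft ℂ q.2) (φ ∘ₗ LinearMap.mulLeft ℂ p)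
          (s.map Prod.snd).prod = 0 := by
        simpa using splitFunctional_prefix_eq_zero (v := v) (χ := φ ∘ₗ LinearMap.mulLeft ℂ p)
          hφ hfree [q] s (by simp) (by simpa using hl)
      rw [List.map_cons, List.prod_cons, splitFunctional_mul, hpre, add_zero]
      by_cases hq : κ v = q.1
      · rw [← hq] at h2 h1
        have e3 : splitFunctional v φ ((φ ∘ₗ LinearMap.mulLeft ℂ p) ∘ₗ
            LinearMap.mulRight ℂ (s.map Prod.snd).prod) q.2 =
            splitFunctional v φ (φ (p * (s.map Prod.snd).prod) • φ) q.2 := by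
          refine splitFunctional_congr h2 fun _ u hu u' hu' => ?_
          change φ u * φ (p * (u' * (s.map Prod.snd).prod)) =
            φ u * (φ (p * (s.map Prod.snd).prod) * φ u')
          rw [hkey _ s hu' h4 h1]
          ring
        rw [← mul_assoc (FreeAlgebra.ι ℂ v), hkey _ s (generator_mul_mem_kindSpan rfl h2) h4 h1,
          hbase _ h2, e3, splitFunctional_smul_right, LinearMap.smul_apply, smul_eq_mul]
        ring
      · rw [splitFunctional_congr (ψ' := 0) (χ' := 0) h2 fun hv' => absurd hv' hq,
          splitFunctional_zero_left, LinearMap.zero_apply]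
        have := hkey _ (q :: s) hgen hl (by simpa using hq)
        rwa [hv, zero_mul] at this
  exact hle (span_isAlternating hφ f)

end FreeSide

end NCProb


namespace NCProb

/-! ### The moments of the semicircular law -/

section SemicircleMoments

theorem integral_pow_semicircleMeasure (k : ℕ) : ∫ t, t ^ k ∂semicircleMeasure =
    1 / (2 * Real.pi) * ∫ t in (-2 : ℝ)..2, t ^ k * √(4 - t ^ 2) := by
  have hm : Measurable fun t : ℝ => ENNReal.ofReal ((Set.Icc (-2 : ℝ) 2).indicator
      (fun s => 1 / (2 * Real.pi) * Real.sqrt (4 - s ^ 2)) t) :=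
    ((by fun_prop : Measurable fun s : ℝ => 1 / (2 * Real.pi) * Real.sqrt (4 - s ^ 2)).indicator
      measurableSet_Icc).ennreal_ofReal
  rw [semicircleMeasure, integral_withDensity_eq_integral_toReal_smul hm (by simp),
    intervalIntegral.integral_of_le (by norm_num), ← integral_Icc_eq_integral_Ioc,
    ← integral_const_mul, ← integral_indicator measurableSet_Icc]
  congr 1
  ext t
  have hp : (0 : ℝ) ≤ (Set.Icc (-2 : ℝ) 2).indicator
      (fun s => 1 / (2 * Real.pi) * Real.sqrt (4 - s ^ 2)) t :=
    Set.indicator_nonneg (fun s _ => by positivity) t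
  rw [ENNReal.toReal_ofReal hp]
  by_cases ht : t ∈ Set.Icc (-2 : ℝ) 2
  · rw [Set.indicator_of_mem ht, Set.indicator_of_mem ht, smul_eq_mul]
    ring
  · rw [Set.indicator_of_notMem ht, Set.indicator_of_notMem ht, zero_smul]

/-- Integration of the derivative of `t ^ (k + 1) * (4 - t ^ 2) ^ (3 / 2)` over `[-2, 2]`. -/
theorem integral_pow_mul_sqrt_recursion (k : ℕ) :
    (k + 4) * ∫ t in (-2 : ℝ)..2, t ^ (k + 2) * √(4 - t ^ 2) =
      4 * (k + 1) * ∫ t in (-2 : ℝ)..2, t ^ k * √(4 - t ^ 2) := by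
  have hftc := intervalIntegral.integral_eq_sub_of_hasDerivAt_of_le (a := -2) (b := 2)
    (f := fun t : ℝ => t ^ (k + 1) * ((4 - t ^ 2) * √(4 - t ^ 2)))
    (f' := fun t : ℝ => 4 * (k + 1) * (t ^ k * √(4 - t ^ 2)) -
      (k + 4) * (t ^ (k + 2) * √(4 - t ^ 2))) (by norm_num) (by fun_prop) ?_
    (Continuous.intervalIntegrable (by fun_prop) _ _)
  · rw [intervalIntegral.integral_sub (Continuous.intervalIntegrable (by fun_prop) _ _)
      (Continuous.intervalIntegrable (by fun_prop) _ _), intervalIntegral.integral_const_mul,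
      intervalIntegral.integral_const_mul] at hftc
    norm_num at hftc
    linarith
  · intro t ht
    have hpos : 0 < 4 - t ^ 2 := by nlinarith [ht.1, ht.2]
    have h1 : HasDerivAt (fun t : ℝ => 4 - t ^ 2) (-(2 * t)) t := by
      simpa using (hasDerivAt_pow 2 t).const_sub 4
    have h2 := (hasDerivAt_pow (k + 1) t).mul (h1.mul (h1.sqrt hpos.ne'))
    refine h2.congr_deriv ?_
    have hs : √(4 - t ^ 2) ≠ 0 := (Real.sqrt_pos.2 hpos).ne'
    have hsq : √(4 - t ^ 2) ^ 2 = 4 - t ^ 2 := Real.sq_sqrt hpos.le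
    have e : (4 - t ^ 2) * (-(2 * t) / (2 * √(4 - t ^ 2))) = -t * √(4 - t ^ 2) := by
      field_simp
      rw [hsq]
    change _ * ((4 - t ^ 2) * √(4 - t ^ 2)) + _ = _
    rw [e, add_tsub_cancel_right]
    push_cast
    ring

theorem integral_sqrt_four_sub_sq : ∫ t in (-2 : ℝ)..2, √(4 - t ^ 2) = 2 * Real.pi := by
  have h := intervalIntegral.mul_integral_comp_mul_left (a := -1) (b := 1) (c := 2)
    (f := fun t : ℝ => √(4 - t ^ 2))
  have e : ∀ x : ℝ, √(4 - (2 * x) ^ 2) = 2 * √(1 - x ^ 2) := fun x => by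
    rw [show 4 - (2 * x) ^ 2 = 2 ^ 2 * (1 - x ^ 2) by ring, Real.sqrt_mul (by norm_num),
      Real.sqrt_sq (by norm_num)]
  simp only [e, intervalIntegral.integral_const_mul, integral_sqrt_one_sub_sq] at h
  norm_num at h
  rw [← h]
  ring

/-- The `k`-th moment of the semicircular law. -/
noncomputable def semicircleMoment (k : ℕ) : ℝ := ∫ t, t ^ k ∂semicircleMeasure

theorem semicircleMoment_zero : semicircleMoment 0 = 1 := by
  rw [semicircleMoment, integral_pow_semicircleMeasure]
  simp only [pow_zero, one_mul, integral_sqrt_four_sub_sq]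
  field_simp

theorem semicircleMoment_one : semicircleMoment 1 = 0 := by
  rw [semicircleMoment, integral_pow_semicircleMeasure]
  have h := intervalIntegral.integral_comp_neg (a := -2) (b := 2)
    (f := fun t : ℝ => t ^ 1 * √(4 - t ^ 2))
  simp only [pow_one, neg_neg, neg_mul, intervalIntegral.integral_neg, even_two,
    Even.neg_pow] at h
  simp only [pow_one]
  have : ∫ t in (-2 : ℝ)..2, t * √(4 - t ^ 2) = 0 := by linarith
  rw [this, mul_zero]

theorem semicircleMoment_add_two (k : ℕ) :
    (k + 4) * semicircleMoment (k + 2) = 4 * (k + 1) * semicircleMoment k := by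
  rw [semicircleMoment, semicircleMoment, integral_pow_semicircleMeasure,
    integral_pow_semicircleMeasure]
  linear_combination 1 / (2 * Real.pi) * integral_pow_mul_sqrt_recursion k

theorem semicircleMoment_odd (l : ℕ) : semicircleMoment (2 * l + 1) = 0 := by
  induction l with
  | zero => exact semicircleMoment_one
  | succ l ih =>
    have h := semicircleMoment_add_two (2 * l + 1)
    rw [ih, mul_zero] at h
    refine (mul_eq_zero.1 h).resolve_left ?_
    positivity

theorem semicircleMoment_even (l : ℕ) : semicircleMoment (2 * l) = catalan l := by
  induction l with
  | zero => simp [semicircleMoment_zero]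
  | succ l ih =>
    have h := semicircleMoment_add_two (2 * l)
    have h1 : ((l + 1 : ℕ) : ℝ) * catalan l = l.centralBinom := by
      exact_mod_cast succ_mul_catalan_eq_centralBinom l
    have h2 : ((l + 2 : ℕ) : ℝ) * catalan (l + 1) = (l + 1).centralBinom := by
      exact_mod_cast succ_mul_catalan_eq_centralBinom (l + 1)
    have h3 : ((l + 1 : ℕ) : ℝ) * (l + 1).centralBinom = 2 * (2 * l + 1) * l.centralBinom := by
      exact_mod_cast Nat.succ_mul_centralBinom_succ l
    rw [ih] at h
    have h4 : (l + 1 : ℝ) * ((l + 2) * semicircleMoment (2 * (l + 1))) =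
        (l + 1) * ((l + 2) * catalan (l + 1)) := by
      push_cast at h1 h2 h3 h
      rw [show 2 * (l + 1) = 2 * l + 2 by ring]
      linear_combination (l + 1 : ℝ) / 2 * h - (l + 1 : ℝ) * h2 - h3 + 2 * (2 * l + 1) * h1
    have h5 : (l + 1 : ℝ) ≠ 0 := by positivity
    have h6 : (l + 2 : ℝ) ≠ 0 := by positivity
    exact mul_left_cancel₀ h6 (mul_left_cancel₀ h5 h4)

theorem sum_range_odd_eq_zero_terms (f : ℕ → ℝ) (hf : ∀ i, f (2 * i + 1) = 0) (l : ℕ) :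
    ∑ j ∈ Finset.range (2 * l + 1), f j = ∑ i ∈ Finset.range (l + 1), f (2 * i) := by
  induction l with
  | zero => simp
  | succ l ih =>
    rw [show 2 * (l + 1) + 1 = 2 * l + 1 + 1 + 1 by ring, Finset.sum_range_succ,
      Finset.sum_range_succ, ih, hf, Finset.sum_range_succ _ (l + 1)]
    simp [mul_add]

/-- The Catalan recursion, in terms of the moments of the semicircular law. -/
theorem semicircleMoment_succ (k : ℕ) : semicircleMoment (k + 1) =
    ∑ j ∈ Finset.range k, semicircleMoment j * semicircleMoment (k - 1 - j) := by
  rcases Nat.even_or_odd' k with ⟨l, rfl | rfl⟩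
  · rw [semicircleMoment_odd, eq_comm]
    refine Finset.sum_eq_zero fun j hj => ?_
    have hj := Finset.mem_range.1 hj
    rcases Nat.even_or_odd' j with ⟨i, rfl | rfl⟩
    · rw [show 2 * l - 1 - 2 * i = 2 * (l - 1 - i) + 1 by omega, semicircleMoment_odd, mul_zero]
    · rw [semicircleMoment_odd, zero_mul]
  · rw [sum_range_odd_eq_zero_terms _ (fun i => by rw [semicircleMoment_odd, zero_mul]),
      show 2 * l + 1 + 1 = 2 * (l + 1) by ring, semicircleMoment_even, catalan_succ]
    push_cast
    rw [Finset.sum_range]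
    refine Finset.sum_congr rfl fun i _ => ?_
    rw [semicircleMoment_even, show 2 * l - 2 * (i : ℕ) = 2 * (l - i) by omega,
      semicircleMoment_even]

end SemicircleMoments

/-! ### The Schwinger–Dyson equation for a free semicircular system -/

section SemicircularSystem

theorem sum_splits_replicate {α : Type*} [DecidableEq α] (v : α) (k : ℕ) (F : ℕ → ℕ → ℂ) :
    ((splits v (List.replicate k v)).map fun q => F q.1.length q.2.length).sum =
      ∑ j ∈ Finset.range k, F j (k - 1 - j) := by
  induction k generalizing F with
  | zero => simp [splits]
  | succ k ih =>
    have := ih fun a b => F (a + 1) b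
    rw [List.replicate_succ, splits, if_pos rfl, List.map_append, List.sum_append,
      Finset.sum_range_succ']
    simp only [List.map_map, Function.comp_def, List.length_cons, this]
    simp only [List.map_cons, List.map_nil, List.sum_singleton, List.length_nil,
      List.length_replicate, add_tsub_cancel_right, tsub_zero]
    rw [add_comm]
    congr 1
    refine Finset.sum_congr rfl fun j _ => ?_
    congr 1
    omega

theorem splits_map {α α' : Type*} [DecidableEq α] [DecidableEq α'] {f : α → α'}
    (hf : Function.Injective f) (v : α) (w : List α) :
    splits (f v) (w.map f) = (splits v w).map fun q => (q.1.map f, q.2.map f) := by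
  induction w with
  | nil => rfl
  | cons c w ih =>
    simp only [List.map_cons, splits, ih, List.map_append, List.map_map, hf.eq_iff]
    congr 1
    split_ifs <;> simp

variable {𝒜 : Type*} [Ring 𝒜] [StarRing 𝒜] [Algebra ℂ 𝒜] [StarModule ℂ 𝒜]

theorem evalWord_mem_starAdjoin {α : Type*} {S : Set 𝒜} {g : α → 𝒜} {w : List α}
    (hw : ∀ c ∈ w, g c ∈ StarAlgebra.adjoin ℂ S) :
    evalWord g w ∈ StarAlgebra.adjoin ℂ S := by
  induction w with
  | nil => exact one_mem _
  | cons c w ih =>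
    rw [evalWord_cons]
    exact mul_mem (hw c (by simp)) (ih fun c hc => hw c (by simp [hc]))

/-- Substituting free random variables for the letters makes the letters free. -/
theorem isFreeKinds_of_isFree {α K : Type*} {κ : α → K} {τ : 𝒜 →ₗ[ℂ] ℂ} {S : K → Set 𝒜}
    (h : IsFree τ S) {g : α → 𝒜} (hg : ∀ c, g c ∈ StarAlgebra.adjoin ℂ (S (κ c))) :
    IsFreeKinds κ (τ ∘ₗ (FreeAlgebra.lift ℂ g).toLinearMap) := by
  intro l hl halt
  have hmem : ∀ k, ∀ f ∈ kindSpan κ k, FreeAlgebra.lift ℂ g f ∈ StarAlgebra.adjoin ℂ (S k) := by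
    intro k f hf
    have hle : kindSpan κ k ≤
        (Subalgebra.toSubmodule (StarAlgebra.adjoin ℂ (S k)).toSubalgebra).comap
        (FreeAlgebra.lift ℂ g).toLinearMap := by
      refine Submodule.span_le.2 ?_
      rintro _ ⟨w, hw, rfl⟩
      change FreeAlgebra.lift ℂ g (monomialWord w) ∈ StarAlgebra.adjoin ℂ (S k)
      rw [map_monomialWord]
      exact evalWord_mem_starAdjoin fun c hc => by simpa [← hw c hc] using hg c
    exact hle hf
  obtain ⟨k, hk⟩ : ∃ k, l.length = k + 1 := ⟨l.length - 1, by
    have := List.length_pos_iff.2 hl; omega⟩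
  have e := h k (fun j => (l.get (j.cast hk.symm)).1)
    (fun j => FreeAlgebra.lift ℂ g (l.get (j.cast hk.symm)).2) ?_ ?_ ?_
  · change τ (FreeAlgebra.lift ℂ g _) = 0
    rw [← e, map_list_prod]
    congr 2
    refine List.ext_get (by simp [hk]) fun n h1 h2 => by simp [-List.ofFn_succ]
  · intro j
    exact List.isChain_iff_getElem.1 halt.1 j (by have := j.2; omega)
  · intro j
    exact hmem _ _ (halt.2 _ (List.get_mem _ _)).1
  · intro j
    exact (halt.2 _ (List.get_mem _ _)).2

variable {r : ℕ} {τ : 𝒜 →ₗ[ℂ] ℂ} {x : Fin r → 𝒜}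

/-- The Schwinger–Dyson equation for a semicircular system. For one variable it is the recursion of
the Catalan numbers; freeness extends it to several. -/
theorem schwingerDyson_of_isSemicircularSystem (hτ : τ 1 = 1) (hx : IsSemicircularSystem τ x)
    (v : Fin r) (w : List (Fin r)) :
    τ (x v * evalWord x w) =
      ((splits v w).map fun q => τ (evalWord x q.1) * τ (evalWord x q.2)).sum := by
  have hφ : (τ ∘ₗ (FreeAlgebra.lift ℂ x).toLinearMap) 1 = 1 := by simp [hτ]
  have hfree : IsFreeKinds id (τ ∘ₗ (FreeAlgebra.lift ℂ x).toLinearMap) :=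
    isFreeKinds_of_isFree hx.free fun c => StarAlgebra.subset_adjoin _ _ rfl
  have hmom : ∀ k, τ (x v ^ k) = semicircleMoment k := hx.moments v
  have h := schwingerDyson_of_isFreeKinds (v := v) hφ hfree ?_ ?_ (p := 1)
    (fun u l hl => by simpa using hfree _ (by simp) hl) (monomialWord w)
  · rw [splitFunctional_monomialWord] at h
    simpa [map_monomialWord] using h
  · have := hmom 1
    rw [semicircleMoment_one] at this
    simpa using this
  · intro f hf
    have hle : kindSpan id v ≤ LinearMap.eqLocus
        ((τ ∘ₗ (FreeAlgebra.lift ℂ x).toLinearMap) ∘ₗ LinearMap.mulLeft ℂ (FreeAlgebra.ι ℂ v))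
        (splitFunctional v (τ ∘ₗ (FreeAlgebra.lift ℂ x).toLinearMap)
          (τ ∘ₗ (FreeAlgebra.lift ℂ x).toLinearMap)) := by
      refine Submodule.span_le.2 ?_
      rintro _ ⟨w, hw, rfl⟩
      obtain ⟨k, rfl⟩ : ∃ k, w = List.replicate k v := ⟨_, List.eq_replicate_of_mem hw⟩
      change τ (FreeAlgebra.lift ℂ x (FreeAlgebra.ι ℂ v * monomialWord (List.replicate k v))) =
        splitFunctional v _ _ (monomialWord _)
      rw [splitFunctional_monomialWord]
      have e : ∀ q ∈ splits v (List.replicate k v),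
          (τ ∘ₗ (FreeAlgebra.lift ℂ x).toLinearMap) (monomialWord q.1) *
          (τ ∘ₗ (FreeAlgebra.lift ℂ x).toLinearMap) (monomialWord q.2) =
          (semicircleMoment q.1.length : ℂ) * semicircleMoment q.2.length := by
        intro q hq
        have hq := eq_of_mem_splits hq
        have h1 : q.1 = List.replicate q.1.length v := List.eq_replicate_of_mem fun c hc =>
          List.eq_of_mem_replicate (hq ▸ List.mem_append_left _ hc)
        have h2 : q.2 = List.replicate q.2.length v := List.eq_replicate_of_mem fun c hc =>
          List.eq_of_mem_replicate
            (hq ▸ List.mem_append_right _ (List.mem_cons_of_mem _ hc))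
        rw [← hmom, ← hmom]
        conv_lhs => rw [h1, h2]
        simp [map_monomialWord, evalWord_replicate]
      rw [List.map_congr_left e, sum_splits_replicate v k fun a b =>
        (semicircleMoment a : ℂ) * semicircleMoment b, map_mul, map_monomialWord]
      simp only [FreeAlgebra.lift_ι_apply, evalWord_replicate]
      rw [← pow_succ', hmom, semicircleMoment_succ]
      push_cast
      rfl
    exact hle hf

/-- The Schwinger–Dyson equation for a semicircular system `x` free from `a`, where the
letters `inr b` stand for elements of the `*`-algebra generated by `a`. -/
theorem schwingerDyson_of_isFree {β : Type*} [DecidableEq β] {T : Set 𝒜} (hτ : τ 1 = 1)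
    (hx : IsSemicircularSystem τ x) (hxa : IsFree τ ![Set.range x, T]) {b : β → 𝒜}
    (hb : ∀ c, b c ∈ StarAlgebra.adjoin ℂ T) (v : Fin r) (p : List β)
    (w : List (Fin r ⊕ β)) :
    τ (evalWord (Sum.elim x b) (p.map Sum.inr ++ Sum.inl v :: w)) =
      ((splits (Sum.inl v) w).map fun q => τ (evalWord (Sum.elim x b) q.1) *
        τ (evalWord (Sum.elim x b) (p.map Sum.inr ++ q.2))).sum := by
  set g := Sum.elim x b with hg
  set κ : Fin r ⊕ β → Fin 2 := Sum.elim (fun _ => 0) (fun _ => 1) with hκ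
  set φ := τ ∘ₗ (FreeAlgebra.lift ℂ g).toLinearMap with hφdef
  have hφ : φ 1 = 1 := by simp [hφdef, hτ]
  have hφw : ∀ w, φ (monomialWord w) = τ (evalWord g w) := fun w => by
    simp [hφdef, map_monomialWord]
  have hfree : IsFreeKinds κ φ := isFreeKinds_of_isFree hxa (by
    rintro (c | c)
    · exact StarAlgebra.subset_adjoin _ _ ⟨c, rfl⟩
    · exact hb c)
  have h := schwingerDyson_of_isFreeKinds (v := Sum.inl v) hφ hfree ?_ ?_
    (p := monomialWord (p.map Sum.inr)) ?_ (monomialWord w)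
  · rw [splitFunctional_monomialWord] at h
    simp only [LinearMap.comp_apply, LinearMap.mulLeft_apply, ← monomialWord_cons,
      ← monomialWord_append, hφw] at h
    simpa [hφdef, map_monomialWord] using h
  · have := hx.moments v 1
    change _ = ((semicircleMoment 1 : ℝ) : ℂ) at this
    rw [semicircleMoment_one] at this
    simpa [hφdef, hg] using this
  · intro f hf
    have hle : kindSpan κ (κ (Sum.inl v)) ≤ LinearMap.eqLocus
        (φ ∘ₗ LinearMap.mulLeft ℂ (FreeAlgebra.ι ℂ (Sum.inl v)))
        (splitFunctional (Sum.inl v) φ φ) := by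
      refine Submodule.span_le.2 ?_
      rintro _ ⟨w, hw, rfl⟩
      obtain ⟨u, rfl⟩ : ∃ u : List (Fin r), w = u.map Sum.inl := by
        clear hf
        induction w with
        | nil => exact ⟨[], rfl⟩
        | cons c w ih =>
          obtain ⟨u, rfl⟩ := ih fun c hc => hw c (List.mem_cons_of_mem _ hc)
          rcases c with c | c
          · exact ⟨c :: u, rfl⟩
          · exact absurd (hw (Sum.inr c) (by simp)) (by simp [hκ])
      change φ (FreeAlgebra.ι ℂ (Sum.inl v) * monomialWord (u.map Sum.inl)) =
        splitFunctional _ φ φ (monomialWord _)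
      rw [splitFunctional_monomialWord, splits_map Sum.inl_injective, ← monomialWord_cons]
      have e : ∀ u : List (Fin r),
          φ (monomialWord (u.map Sum.inl)) = τ (evalWord x u) := fun u => by
        rw [hφw]
        simp [evalWord, hg, Function.comp_def]
      have := schwingerDyson_of_isSemicircularSystem hτ hx v u
      rw [← List.map_cons, e, evalWord_cons, this, List.map_map]
      simp only [Function.comp_def, e]
    exact hle hf
  · intro u l hl
    have hp : monomialWord (p.map Sum.inr) ∈ kindSpan κ 1 := monomialWord_mem_kindSpan (by
      simp [hκ])
    have h1 := hfree ((1, monomialWord (p.map Sum.inr) -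
      φ (monomialWord (p.map Sum.inr)) • 1) :: (κ (Sum.inl v), u) :: l) (by simp)
      (isAlternating_cons_iff.2 ⟨by simp [hκ], sub_smul_one_mem_kindSpan hp _, by simp [hφ], hl⟩)
    have h2 := hfree _ (by simp) hl
    simp only [List.map_cons, List.prod_cons] at h1 h2
    simpa [sub_mul, h2] using h1

end SemicircularSystem

end NCProb


namespace NCProb

/-! ### Convergence of the normalized traces -/

section Convergence

open Matrix

variable {r : ℕ} {β : Type*} {θ : ℝ}

theorem exists_eq_map_inr_append {γ δ : Type*} (w : List (γ ⊕ δ)) :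
    ∃ p : List δ, w = p.map Sum.inr ∨ ∃ v s, w = p.map Sum.inr ++ Sum.inl v :: s := by
  induction w with
  | nil => exact ⟨[], Or.inl rfl⟩
  | cons c w ih =>
    obtain v | d := c
    · exact ⟨[], Or.inr ⟨v, w, rfl⟩⟩
    · obtain ⟨p, rfl | ⟨v, s, rfl⟩⟩ := ih
      · exact ⟨d :: p, Or.inl rfl⟩
      · exact ⟨d :: p, Or.inr ⟨v, s, rfl⟩⟩

namespace Ensemble

variable {n : ℕ} (𝓜 : Ensemble r β θ n)

instance : IsProbabilityMeasure 𝓜.law :=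
  haveI := 𝓜.prob
  inferInstanceAs (IsProbabilityMeasure (Measure.pi 𝓜.ν))

/-- The covariance is bounded by the variances. -/
theorem norm_integral_mul_sub_le {f g : (Edge r n → ℂ) → ℂ} (hf : Continuous f)
    (hg : Continuous g) :
    ‖∫ z, f z * g z ∂𝓜.law - (∫ z, f z ∂𝓜.law) * ∫ z, g z ∂𝓜.law‖ ≤
      ∫ z, ‖f z - ∫ z', f z' ∂𝓜.law‖ ^ 2 ∂𝓜.law + ∫ z, ‖g z - ∫ z', g z' ∂𝓜.law‖ ^ 2 ∂𝓜.law := by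
  obtain ⟨a, ha⟩ : ∃ a, a = ∫ z, f z ∂𝓜.law := ⟨_, rfl⟩
  obtain ⟨b, hb⟩ : ∃ b, b = ∫ z, g z ∂𝓜.law := ⟨_, rfl⟩
  rw [← ha, ← hb]
  have e : ∫ z, f z * g z ∂𝓜.law - a * b = ∫ z, (f z - a) * (g z - b) ∂𝓜.law := by
    have i1 : Integrable (fun z => f z * g z) 𝓜.law := 𝓜.integrable (hf.mul hg)
    have i2 : Integrable (fun z => a * g z) 𝓜.law := 𝓜.integrable (by fun_prop)
    have i3 : Integrable (fun z => f z * b) 𝓜.law := 𝓜.integrable (by fun_prop)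
    have i4 : Integrable (fun _ => a * b) 𝓜.law := integrable_const _
    have h1 : ∀ z, (f z - a) * (g z - b) = f z * g z - a * g z - f z * b + a * b := fun z => by
      ring
    simp_rw [h1]
    have i5 : Integrable (fun z => f z * g z - a * g z) 𝓜.law := i1.sub i2
    have i6 : Integrable (fun z => f z * g z - a * g z - f z * b) 𝓜.law := i5.sub i3
    rw [integral_add i6 i4, integral_sub i5 i3, integral_sub i1 i2,
      integral_const_mul, integral_mul_const, ← ha, ← hb, integral_const]
    simp
  have j1 : Integrable (fun z => ‖f z - a‖ ^ 2) 𝓜.law := 𝓜.integrable (by fun_prop)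
  have j2 : Integrable (fun z => ‖g z - b‖ ^ 2) 𝓜.law := 𝓜.integrable (by fun_prop)
  rw [e, ← integral_add j1 j2]
  refine (norm_integral_le_integral_norm _).trans (integral_mono (𝓜.integrable (by fun_prop))
    (j1.add j2) fun z => ?_)
  simp only [norm_mul]
  nlinarith [sq_nonneg (‖f z - a‖ - ‖g z - b‖), sq_nonneg ‖f z - a‖, sq_nonneg ‖g z - b‖]

theorem ntr_append_comm (u w : List (Fin r ⊕ β)) (z : Edge r n → ℂ) :
    𝓜.ntr (u ++ w) z = 𝓜.ntr (w ++ u) z := by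
  rw [ntr, ntr, word, word, evalWord_append, evalWord_append, normalizedTrace_mul_comm]

end Ensemble

theorem tendsto_const_div_sqrt (C : ℝ) : Tendsto (fun n : ℕ => C / √n) atTop (𝓝 0) :=
  (Real.tendsto_sqrt_atTop.comp tendsto_natCast_atTop_atTop).const_div_atTop C

theorem div_mul_sqrt_eq (C : ℝ) (n : ℕ) : C / (n * √n) = C * (1 / (n : ℝ) ^ (3 / 2 : ℝ)) := by
  rcases Nat.eq_zero_or_pos n with rfl | hn
  · simp
  · have hn : (0 : ℝ) < n := by exact_mod_cast hn
    rw [show (3 / 2 : ℝ) = 1 + 1 / 2 by norm_num, Real.rpow_add hn, Real.rpow_one,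
      ← Real.sqrt_eq_rpow]
    ring

theorem summable_const_div_mul_sqrt (C : ℝ) : Summable fun n : ℕ => C / (n * √n) := by
  simp_rw [div_mul_sqrt_eq]
  exact (Real.summable_one_div_nat_rpow.2 (by norm_num)).mul_left C

variable {𝒜 : Type*} [Ring 𝒜] [StarRing 𝒜] [Algebra ℂ 𝒜] [StarModule ℂ 𝒜]
  {τ : 𝒜 →ₗ[ℂ] ℂ} {x : Fin r → 𝒜} {T : Set 𝒜} {b : β → 𝒜}

/-- The expected normalized traces converge: the Schwinger–Dyson equation, with asymptotic
factorization, determines the limit by induction on the number of Wigner letters. -/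
theorem tendsto_integral_ntr [DecidableEq β] (hθ : 1 ≤ θ) (hτ : τ 1 = 1)
    (hx : IsSemicircularSystem τ x) (hxa : IsFree τ ![Set.range x, T])
    (hb : ∀ c, b c ∈ StarAlgebra.adjoin ℂ T) (𝓜 : ∀ n, Ensemble r β θ n)
    (hB : ∀ p : List β, Tendsto (fun n => normalizedTrace n (evalWord (𝓜 n).B p)) atTop
      (𝓝 (τ (evalWord b p)))) (w : List (Fin r ⊕ β)) :
    Tendsto (fun n => ∫ z, (𝓜 n).ntr w z ∂(𝓜 n).law) atTop
      (𝓝 (τ (evalWord (Sum.elim x b) w))) := by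
  obtain ⟨m, hm⟩ : ∃ m, w.countP Sum.isLeft = m := ⟨_, rfl⟩
  induction m using Nat.strong_induction_on generalizing w with
  | _ m ih =>
  obtain ⟨p, rfl | ⟨v, s, rfl⟩⟩ := exists_eq_map_inr_append w
  · have e1 : ∀ n z, (𝓜 n).ntr (p.map Sum.inr) z = normalizedTrace n (evalWord (𝓜 n).B p) :=
      fun n z => by
        simp [Ensemble.ntr, Ensemble.word, evalWord, letters, Function.comp_def]
    have e2 : evalWord (Sum.elim x b) (p.map Sum.inr) = evalWord b p := by
      simp [evalWord, Function.comp_def]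
    simp_rw [e1, integral_const, probReal_univ, one_smul]
    rw [e2]
    exact hB p
  · rw [schwingerDyson_of_isFree hτ hx hxa hb v p s]
    obtain ⟨C, hC⟩ := Ensemble.exists_schwingerDyson_bound (β := β) r hθ v (s ++ p.map Sum.inr)
    rw [splits_append_of_notMem (by simp)] at hC
    simp only [List.map_map, Function.comp_def] at hC
    have hinr : (p.map (Sum.inr : β → Fin r ⊕ β)).countP Sum.isLeft = 0 := by
      simp [List.countP_eq_zero]
    have hsum : Tendsto (fun n => ((splits (Sum.inl v) s).map fun q =>
        ∫ z, (𝓜 n).ntr q.1 z * (𝓜 n).ntr (q.2 ++ p.map Sum.inr) z ∂(𝓜 n).law).sum) atTop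
        (𝓝 ((splits (Sum.inl v) s).map fun q => τ (evalWord (Sum.elim x b) q.1) *
          τ (evalWord (Sum.elim x b) (p.map Sum.inr ++ q.2))).sum) := by
      refine tendsto_list_sum _ fun q hq => ?_
      have hsplit := eq_of_mem_splits hq
      have hcount : q.1.countP Sum.isLeft + q.2.countP Sum.isLeft + 2 = m := by
        rw [← hm, hsplit, List.countP_append, hinr, List.countP_cons_of_pos rfl,
          List.countP_append, List.countP_cons_of_pos rfl]
        ring
      have hcount' : (p.map Sum.inr ++ q.2).countP Sum.isLeft = q.2.countP Sum.isLeft := by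
        rw [List.countP_append, hinr, zero_add]
      have h1 := ih _ (by omega) q.1 rfl
      have h2 := ih _ (by omega) (p.map Sum.inr ++ q.2) rfl
      simp_rw [(𝓜 _).ntr_append_comm (p.map Sum.inr)] at h2
      obtain ⟨C₁, hC₁⟩ := Ensemble.exists_variance_bound r hθ q.1
      obtain ⟨C₂, hC₂⟩ := Ensemble.exists_variance_bound r hθ (q.2 ++ p.map Sum.inr)
      have hcov : Tendsto (fun n => ∫ z, (𝓜 n).ntr q.1 z * (𝓜 n).ntr (q.2 ++ p.map Sum.inr) z
          ∂(𝓜 n).law - (∫ z, (𝓜 n).ntr q.1 z ∂(𝓜 n).law) *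
          ∫ z, (𝓜 n).ntr (q.2 ++ p.map Sum.inr) z ∂(𝓜 n).law) atTop (𝓝 0) := by
        refine squeeze_zero_norm (fun n => ((𝓜 n).norm_integral_mul_sub_le ((𝓜 n).continuous_ntr _)
          ((𝓜 n).continuous_ntr _)).trans (add_le_add (hC₁ n (𝓜 n)) (hC₂ n (𝓜 n)))) ?_
        simpa using (summable_const_div_mul_sqrt C₁).tendsto_atTop_zero.add
          (summable_const_div_mul_sqrt C₂).tendsto_atTop_zero
      simpa using hcov.add (h1.mul h2)
    have hdiff := squeeze_zero_norm (fun n => hC n (𝓜 n)) (tendsto_const_div_sqrt C)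
    have hfin := hdiff.add hsum
    simp only [sub_add_cancel, zero_add] at hfin
    refine hfin.congr fun n => ?_
    simp_rw [(𝓜 n).ntr_append_comm (p.map Sum.inr), List.cons_append]

/-- Almost sure convergence of the normalized traces, by summability of the variances. -/
theorem ae_tendsto_ntr [DecidableEq β] [Countable β] (hθ : 1 ≤ θ) (hτ : τ 1 = 1)
    (hx : IsSemicircularSystem τ x) (hxa : IsFree τ ![Set.range x, T])
    (hb : ∀ c, b c ∈ StarAlgebra.adjoin ℂ T) (𝓜 : ∀ n, Ensemble r β θ n)
    (hB : ∀ p : List β, Tendsto (fun n => normalizedTrace n (evalWord (𝓜 n).B p)) atTop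
      (𝓝 (τ (evalWord b p))))
    {Ω : Type*} [MeasurableSpace Ω] {μ : Measure Ω} {Z : ∀ n, Ω → Edge r n → ℂ}
    (hZ : ∀ n, Measurable (Z n)) (hlaw : ∀ n, μ.map (Z n) = (𝓜 n).law) :
    ∀ᵐ ω ∂μ, ∀ w, Tendsto (fun n => (𝓜 n).ntr w (Z n ω)) atTop
      (𝓝 (τ (evalWord (Sum.elim x b) w))) := by
  rw [ae_all_iff]
  intro w
  have hmean := tendsto_integral_ntr hθ hτ hx hxa hb 𝓜 hB w
  obtain ⟨C, hC⟩ := Ensemble.exists_variance_bound r hθ w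
  obtain ⟨e, he⟩ : ∃ e : ℕ → ℂ, e = fun n => ∫ z, (𝓜 n).ntr w z ∂(𝓜 n).law := ⟨_, rfl⟩
  have hcont : ∀ n, Continuous fun z => ‖(𝓜 n).ntr w z - e n‖ ^ 2 := fun n => by
    have := (𝓜 n).continuous_ntr w
    fun_prop
  have hmeas : ∀ n, Measurable fun z => ENNReal.ofReal (‖(𝓜 n).ntr w z - e n‖ ^ 2) := fun n =>
    (hcont n).measurable.ennreal_ofReal
  have hmeas' : ∀ n, Measurable fun ω => ENNReal.ofReal (‖(𝓜 n).ntr w (Z n ω) - e n‖ ^ 2) :=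
    fun n => (hmeas n).comp (hZ n)
  have hlint : ∀ n, ∫⁻ ω, ENNReal.ofReal (‖(𝓜 n).ntr w (Z n ω) - e n‖ ^ 2) ∂μ ≤
      ENNReal.ofReal (C / (n * √n)) := by
    intro n
    rw [← lintegral_map (hmeas n) (hZ n), hlaw n, ← ofReal_integral_eq_lintegral_ofReal
      ((𝓜 n).integrable (hcont n)) (Eventually.of_forall fun z => by positivity)]
    refine ENNReal.ofReal_le_ofReal ?_
    rw [he]
    exact hC n (𝓜 n)
  have htsum : ∫⁻ ω, ∑' n, ENNReal.ofReal (‖(𝓜 n).ntr w (Z n ω) - e n‖ ^ 2) ∂μ ≠ ⊤ := by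
    rw [lintegral_tsum fun n => (hmeas' n).aemeasurable]
    refine ne_top_of_le_ne_top ?_ (ENNReal.tsum_le_tsum hlint)
    exact (summable_const_div_mul_sqrt C).tsum_ofReal_ne_top
  have hae := ae_lt_top (Measurable.tsum hmeas') htsum
  filter_upwards [hae] with ω hω
  have h1 := ENNReal.tendsto_atTop_zero_of_tsum_ne_top hω.ne
  have h2 : Tendsto (fun n => ‖(𝓜 n).ntr w (Z n ω) - e n‖ ^ 2) atTop (𝓝 0) := by
    have := (ENNReal.tendsto_toReal ENNReal.zero_ne_top).comp h1
    refine this.congr fun n => ?_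
    rw [Function.comp_apply]
    exact ENNReal.toReal_ofReal (by positivity)
  have h3 : Tendsto (fun n => (𝓜 n).ntr w (Z n ω) - e n) atTop (𝓝 0) := by
    rw [tendsto_zero_iff_norm_tendsto_zero]
    have := h2.sqrt
    simpa [Real.sqrt_sq] using this
  have h4 := h3.add hmean
  simpa [he] using h4

end Convergence

end NCProb


namespace NCProb

/-! ### The spectral norm -/

section SpectralNorm

open Matrix

variable {n : ℕ}

theorem matrixSpectralNorm_nonneg (M : Matrix (Fin n) (Fin n) ℂ) : 0 ≤ matrixSpectralNorm M :=
  norm_nonneg _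

theorem matrixSpectralNorm_mul_le (M N : Matrix (Fin n) (Fin n) ℂ) :
    matrixSpectralNorm (M * N) ≤ matrixSpectralNorm M * matrixSpectralNorm N := by
  rw [matrixSpectralNorm, map_mul]
  exact norm_mul_le _ _

theorem matrixSpectralNorm_one_le : matrixSpectralNorm (1 : Matrix (Fin n) (Fin n) ℂ) ≤ 1 := by
  rw [matrixSpectralNorm, map_one]
  exact ContinuousLinearMap.norm_id_le

theorem matrixSpectralNorm_conjTranspose (M : Matrix (Fin n) (Fin n) ℂ) :
    matrixSpectralNorm Mᴴ = matrixSpectralNorm M := by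
  rw [matrixSpectralNorm, ← star_eq_conjTranspose, map_star, ContinuousLinearMap.star_eq_adjoint,
    LinearIsometryEquiv.norm_map, matrixSpectralNorm]

theorem matrixSpectralNorm_pow_le (M : Matrix (Fin n) (Fin n) ℂ) (k : ℕ) :
    matrixSpectralNorm (M ^ k) ≤ matrixSpectralNorm M ^ k := by
  induction k with
  | zero => simpa using matrixSpectralNorm_one_le
  | succ k ih =>
    rw [pow_succ, pow_succ]
    exact (matrixSpectralNorm_mul_le _ _).trans
      (mul_le_mul_of_nonneg_right ih (matrixSpectralNorm_nonneg _))

theorem norm_apply_le_matrixSpectralNorm (M : Matrix (Fin n) (Fin n) ℂ) (i j : Fin n) :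
    ‖M i j‖ ≤ matrixSpectralNorm M := by
  have h := (toEuclideanCLM (n := Fin n) (𝕜 := ℂ) M).le_opNorm (EuclideanSpace.single j 1)
  rw [PiLp.norm_single, norm_one, mul_one] at h
  refine le_trans ?_ ((PiLp.norm_apply_le _ i).trans h)
  rw [ofLp_toEuclideanCLM]
  simp

theorem norm_trace_le_matrixSpectralNorm (M : Matrix (Fin n) (Fin n) ℂ) :
    ‖trace M‖ ≤ n * matrixSpectralNorm M := by
  refine (norm_sum_le _ _).trans ?_
  calc ∑ i, ‖diag M i‖ ≤ ∑ _i : Fin n, matrixSpectralNorm M :=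
        Finset.sum_le_sum fun i _ => norm_apply_le_matrixSpectralNorm M i i
    _ = _ := by simp

theorem norm_normalizedTrace_le (M : Matrix (Fin n) (Fin n) ℂ) :
    ‖normalizedTrace n M‖ ≤ matrixSpectralNorm M := by
  rw [normalizedTrace_apply, norm_mul, norm_inv, Complex.norm_natCast]
  rcases Nat.eq_zero_or_pos n with rfl | hn
  · simpa using matrixSpectralNorm_nonneg M
  · have hn : (0 : ℝ) < n := by exact_mod_cast hn
    rw [inv_mul_le_iff₀ hn]
    exact norm_trace_le_matrixSpectralNorm M

theorem absMoment_le_matrixSpectralNorm (M : Matrix (Fin n) (Fin n) ℂ) (k : ℕ) :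
    absMoment k M ≤ n * matrixSpectralNorm M ^ (2 * k) := by
  refine (Complex.re_le_norm _).trans ((norm_trace_le_matrixSpectralNorm _).trans ?_)
  refine mul_le_mul_of_nonneg_left ((matrixSpectralNorm_pow_le _ _).trans ?_) (Nat.cast_nonneg _)
  rw [pow_mul, sq]
  refine pow_le_pow_left₀ (matrixSpectralNorm_nonneg _) ?_ k
  exact (matrixSpectralNorm_mul_le _ _).trans_eq (by rw [matrixSpectralNorm_conjTranspose])

/-- The spectral norm is at most the Hilbert–Schmidt norm. -/
theorem matrixSpectralNorm_le_sqrt (M : Matrix (Fin n) (Fin n) ℂ) :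
    matrixSpectralNorm M ≤ √(∑ i, ∑ j, ‖M i j‖ ^ 2) := by
  refine ContinuousLinearMap.opNorm_le_bound _ (Real.sqrt_nonneg _) fun y => ?_
  rw [EuclideanSpace.norm_eq, EuclideanSpace.norm_eq, ← Real.sqrt_mul (by positivity),
    Finset.sum_mul]
  refine Real.sqrt_le_sqrt (Finset.sum_le_sum fun i _ => ?_)
  rw [ofLp_toEuclideanCLM, mulVec, dotProduct]
  calc ‖∑ j, M i j * y j‖ ^ 2 ≤ (∑ j, ‖M i j‖ * ‖y j‖) ^ 2 := by
        refine pow_le_pow_left₀ (norm_nonneg _) ((norm_sum_le _ _).trans_eq ?_) 2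
        simp
    _ ≤ _ := Finset.sum_mul_sq_le_sq_mul_sq _ _ _

theorem matrixSpectralNorm_evalWord_le {β : Type*} {B : β → Matrix (Fin n) (Fin n) ℂ} {θ : ℝ}
    (hB : ∀ b, matrixSpectralNorm (B b) ≤ θ) (p : List β) :
    matrixSpectralNorm (evalWord B p) ≤ θ ^ p.length := by
  induction p with
  | nil => simpa using matrixSpectralNorm_one_le
  | cons b p ih =>
    rw [evalWord_cons, List.length_cons, pow_succ']
    exact (matrixSpectralNorm_mul_le _ _).trans (mul_le_mul (hB b) ih (matrixSpectralNorm_nonneg _)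
      ((matrixSpectralNorm_nonneg _).trans (hB b)))

end SpectralNorm

/-! ### Truncation of the entries -/

section Truncation

/-- The truncation of a complex number at the level `T`. -/
noncomputable def trunc (T : ℝ) (y : ℂ) : ℂ := if ‖y‖ ≤ T then y else 0

variable {T : ℝ}

theorem trunc_of_le {y : ℂ} (h : ‖y‖ ≤ T) : trunc T y = y := if_pos h

theorem measurable_trunc (T : ℝ) : Measurable (trunc T) :=
  Measurable.ite (measurableSet_le measurable_norm measurable_const) measurable_id measurable_const

theorem norm_trunc_le (hT : 0 ≤ T) (y : ℂ) : ‖trunc T y‖ ≤ T := by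
  unfold trunc
  split_ifs with h
  · exact h
  · simpa using hT

theorem norm_trunc_le_norm (y : ℂ) : ‖trunc T y‖ ≤ ‖y‖ := by
  unfold trunc
  split_ifs with h
  · exact le_rfl
  · simp

theorem trunc_star (y : ℂ) : trunc T (star y) = star (trunc T y) := by
  simp only [trunc, norm_star]
  split_ifs <;> simp

theorem norm_sub_trunc_le (hT : 0 < T) (y : ℂ) (k : ℕ) :
    ‖y - trunc T y‖ ≤ ‖y‖ ^ (k + 1) / T ^ k := by
  unfold trunc
  split_ifs with h
  · simp only [sub_self, norm_zero]; positivity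
  · rw [sub_zero, le_div_iff₀ (by positivity), pow_succ']
    exact mul_le_mul_of_nonneg_left (pow_le_pow_left₀ hT.le (not_le.1 h).le k) (norm_nonneg _)

theorem sq_sub_sq_trunc_le (hT : 0 < T) (y : ℂ) :
    ‖y‖ ^ 2 - ‖trunc T y‖ ^ 2 ≤ ‖y‖ ^ 3 / T := by
  unfold trunc
  split_ifs with h
  · simp only [sub_self]; positivity
  · rw [norm_zero, le_div_iff₀ hT]
    nlinarith [norm_nonneg y, sq_nonneg ‖y‖, not_le.1 h]

variable {Ω : Type*} [MeasurableSpace Ω] {μ : Measure Ω} [IsProbabilityMeasure μ] {Y : Ω → ℂ}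

theorem integrable_of_norm_le {G : Type*} [NormedAddCommGroup G] {f : Ω → G} {C : ℝ}
    (hf : AEStronglyMeasurable f μ) (h : ∀ ω, ‖f ω‖ ≤ C) : Integrable f μ :=
  Integrable.of_bound hf C (Eventually.of_forall h)

theorem integrable_trunc (hY : Measurable Y) (hT : 0 ≤ T) :
    Integrable (fun ω => trunc T (Y ω)) μ :=
  integrable_of_norm_le ((measurable_trunc T).comp hY).aestronglyMeasurable fun _ =>
    norm_trunc_le hT _

theorem norm_integral_trunc_le_one (hY : Measurable Y) (hT : 0 ≤ T) (hL2 : MemLp Y 2 μ)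
    (hvar : ∫ ω, ‖Y ω‖ ^ 2 ∂μ = 1) : ‖∫ ω, trunc T (Y ω) ∂μ‖ ≤ 1 := by
  have h1 : Integrable (fun ω => ‖Y ω‖) μ := (hL2.integrable (by norm_num)).norm
  have h2 : Integrable (fun ω => ‖Y ω‖ ^ 2) μ := hL2.norm.integrable_sq
  have h3 := integral_sq_le_of_probability μ h1 h2
  rw [hvar] at h3
  have h4 : ∫ ω, ‖Y ω‖ ∂μ ≤ 1 := by nlinarith
  refine (norm_integral_le_integral_norm _).trans (le_trans ?_ h4)
  exact integral_mono (integrable_trunc hY hT).norm h1 fun ω => norm_trunc_le_norm _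

/-- Centring turns the mean of the truncated variable into that of the discarded part. -/
theorem norm_integral_trunc_le (hY : Measurable Y) (hT : 0 < T) (hi : Integrable Y μ)
    (hcent : ∫ ω, Y ω ∂μ = 0) {k : ℕ} (hk : Integrable (fun ω => ‖Y ω‖ ^ (k + 1)) μ) :
    ‖∫ ω, trunc T (Y ω) ∂μ‖ ≤ (∫ ω, ‖Y ω‖ ^ (k + 1) ∂μ) / T ^ k := by
  have ht := integrable_trunc (μ := μ) hY hT.le
  have e : ∫ ω, trunc T (Y ω) ∂μ = -∫ ω, (Y ω - trunc T (Y ω)) ∂μ := by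
    rw [integral_sub hi ht, hcent, zero_sub, neg_neg]
  rw [e, norm_neg, ← integral_div]
  exact (norm_integral_le_integral_norm _).trans
    (integral_mono (hi.sub ht).norm (hk.div_const _) fun ω => norm_sub_trunc_le hT _ k)

omit [IsProbabilityMeasure μ] in
theorem one_sub_integral_trunc_sq_le (hY : Measurable Y) (hT : 0 < T) (hL2 : MemLp Y 2 μ)
    (hvar : ∫ ω, ‖Y ω‖ ^ 2 ∂μ = 1) (h3 : Integrable (fun ω => ‖Y ω‖ ^ 3) μ) :
    1 - ∫ ω, ‖trunc T (Y ω)‖ ^ 2 ∂μ ≤ (∫ ω, ‖Y ω‖ ^ 3 ∂μ) / T := by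
  have h2 : Integrable (fun ω => ‖Y ω‖ ^ 2) μ := hL2.norm.integrable_sq
  have ht : Integrable (fun ω => ‖trunc T (Y ω)‖ ^ 2) μ :=
    h2.mono' (((measurable_trunc T).comp hY).norm.pow_const 2).aestronglyMeasurable
      (Eventually.of_forall fun ω => by
        rw [Real.norm_of_nonneg (by positivity)]
        exact pow_le_pow_left₀ (norm_nonneg _) (norm_trunc_le_norm _) 2)
  rw [← hvar, ← integral_sub h2 ht, ← integral_div]
  exact integral_mono (h2.sub ht) (h3.div_const _) fun ω => sq_sub_sq_trunc_le hT _

theorem integral_norm_sub_mean_sq {f : Ω → ℂ} (hf : Integrable f μ)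
    (hf2 : Integrable (fun ω => ‖f ω‖ ^ 2) μ) :
    ∫ ω, ‖f ω - ∫ ω', f ω' ∂μ‖ ^ 2 ∂μ = ∫ ω, ‖f ω‖ ^ 2 ∂μ - ‖∫ ω, f ω ∂μ‖ ^ 2 := by
  obtain ⟨m, hm⟩ : ∃ m, m = ∫ ω, f ω ∂μ := ⟨_, rfl⟩
  rw [← hm]
  have hpt : ∀ ω, ‖f ω - m‖ ^ 2 = ‖f ω‖ ^ 2 - 2 * (f ω * star m).re + ‖m‖ ^ 2 := fun ω => by
    rw [← Complex.normSq_eq_norm_sq, ← Complex.normSq_eq_norm_sq, ← Complex.normSq_eq_norm_sq,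
      Complex.normSq_sub, Complex.star_def]
    ring
  have i1 : Integrable (fun ω => f ω * star m) μ := hf.mul_const _
  have i2 : Integrable (fun ω => 2 * (f ω * star m).re) μ := i1.re.const_mul 2
  have i3 : Integrable (fun ω => ‖f ω‖ ^ 2 - 2 * (f ω * star m).re) μ := hf2.sub i2
  simp_rw [hpt]
  have e : ∫ ω, (f ω * star m).re ∂μ = ‖m‖ ^ 2 := by
    have := integral_re i1
    simp only [RCLike.re_eq_complex_re] at this
    rw [this, integral_mul_const, ← hm, Complex.star_def, Complex.mul_conj']
    norm_cast
  rw [integral_add i3 (integrable_const _), integral_sub hf2 i2, integral_const_mul, e,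
    integral_const, probReal_univ, one_smul]
  ring

end Truncation

section BorelCantelli

theorem sum_four_pow_indicator_le (N : ℕ) (W : ℝ) (hW : 0 ≤ W) :
    ∑ k ∈ Finset.range N, (if (4 : ℝ) ^ k < W then (4 : ℝ) ^ k else 0) ≤ 2 * W := by
  have h : ∑ k ∈ Finset.range N, (if (4 : ℝ) ^ k < W then (4 : ℝ) ^ k else 0) ≤ 4 ^ N ∧
      ∑ k ∈ Finset.range N, (if (4 : ℝ) ^ k < W then (4 : ℝ) ^ k else 0) ≤ 2 * W := by
    induction N with
    | zero => simp [hW]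
    | succ N ih =>
      rw [Finset.sum_range_succ, pow_succ]
      have : (0 : ℝ) < 4 ^ N := by positivity
      split_ifs with h
      · constructor <;> linarith
      · constructor <;> linarith
  exact h.2

/-- Dyadic form of the tail summability of a variable with a finite fourth moment. -/
theorem summable_four_pow_mul_tail (ζ : Measure ℝ) [IsProbabilityMeasure ζ]
    (hζ : ∫⁻ z, ‖z‖ₑ ^ 4 ∂ζ < ⊤) :
    Summable fun k : ℕ => (4 : ℝ) ^ k * ζ.real {z | √(2 ^ k) < |z|} := by
  have hset : ∀ (k : ℕ) (z : ℝ), √(2 ^ k) < |z| ↔ (4 : ℝ) ^ k < z ^ 4 := by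
    intro k z
    rw [← pow_lt_pow_iff_left₀ (Real.sqrt_nonneg _) (abs_nonneg z) (by norm_num : 4 ≠ 0),
      show |z| ^ 4 = z ^ 4 from Even.pow_abs (by decide) z,
      show √(2 ^ k) ^ 4 = (√(2 ^ k) ^ 2) ^ 2 by ring, Real.sq_sqrt (by positivity), ← pow_mul,
      mul_comm, pow_mul]
    norm_num
  have hmeas : ∀ k : ℕ, MeasurableSet {z : ℝ | (4 : ℝ) ^ k < z ^ 4} := fun k =>
    measurableSet_lt measurable_const (by fun_prop)
  have hint : Integrable (fun z : ℝ => z ^ 4) ζ := by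
    refine ⟨(by fun_prop), ?_⟩
    rw [HasFiniteIntegral]
    simpa [enorm_pow] using hζ
  have hind : ∀ k : ℕ, Integrable (fun z : ℝ => if (4 : ℝ) ^ k < z ^ 4 then (4 : ℝ) ^ k else 0) ζ :=
    fun k => (integrable_const ((4 : ℝ) ^ k)).indicator (hmeas k)
  refine summable_of_sum_range_le (c := ∫ z, 2 * z ^ 4 ∂ζ) (fun k => by positivity) fun N => ?_
  have e : ∀ k : ℕ, (4 : ℝ) ^ k * ζ.real {z | √(2 ^ k) < |z|} =
      ∫ z, (if (4 : ℝ) ^ k < z ^ 4 then (4 : ℝ) ^ k else 0) ∂ζ := fun k => by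
    simp_rw [hset]
    rw [show (fun z : ℝ => if (4 : ℝ) ^ k < z ^ 4 then (4 : ℝ) ^ k else 0) =
      Set.indicator {z | (4 : ℝ) ^ k < z ^ 4} (fun _ => (4 : ℝ) ^ k) from rfl,
      integral_indicator_const _ (hmeas k), smul_eq_mul, mul_comm]
  simp_rw [e]
  rw [← integral_finsetSum _ fun k _ => hind k]
  exact integral_mono (integrable_finsetSum _ fun k _ => hind k) (hint.const_mul 2) fun z =>
    sum_four_pow_indicator_le N (z ^ 4) (by positivity)

variable {Ω : Type*} [MeasurableSpace Ω] {μ : Measure Ω} [IsProbabilityMeasure μ]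

/-- Almost surely, truncating the `n × n` corner at the level `√n` changes nothing for large `n`:
the Borel–Cantelli lemma along the dyadic sizes. -/
theorem HasDominatedTails.ae_eventually_norm_le {Y : ℕ → ℕ → Ω → ℂ}
    (h : HasDominatedTails μ Y) :
    ∀ᵐ ω ∂μ, ∀ᶠ n : ℕ in atTop, ∀ i j : Fin n, ‖Y i j ω‖ ≤ √n := by
  obtain ⟨K, ζ, hprob, hζ, x₀, hx₀, n₀, -, htail⟩ := h
  obtain ⟨k₀, hk₀⟩ : ∃ k₀ : ℕ, x₀ ^ 2 + n₀ < 2 ^ k₀ := pow_unbounded_of_one_lt _ one_lt_two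
  -- the dyadic block of sizes between `2 ^ k` and `2 ^ (k + 1)`
  set E : ℕ → Set Ω := fun k => ⋃ i : Fin (2 ^ (k + 1)), ⋃ j : Fin (2 ^ (k + 1)),
    {ω | √(2 ^ k) < ‖Y i j ω‖} with hE
  have hbound : ∀ k, k₀ ≤ k → μ.real (E k) ≤
      4 * |K| * ((4 : ℝ) ^ k * ζ.real {z | √(2 ^ k) < |z|}) := by
    intro k hk
    have hpow : (2 : ℝ) ^ k₀ ≤ 2 ^ k := pow_le_pow_right₀ one_le_two hk
    have hn₀ : (0 : ℝ) ≤ n₀ := Nat.cast_nonneg _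
    have hxk : x₀ < √(2 ^ k) := Real.lt_sqrt_of_sq_lt (by linarith)
    have hnk : n₀ < 2 ^ (k + 1) := by
      have h1 : (n₀ : ℝ) < 2 ^ (k + 1) := by
        rw [pow_succ]
        nlinarith [sq_nonneg x₀]
      exact_mod_cast h1
    have h1 := htail _ hxk _ hnk
    have h2 : μ.real (E k) ≤ ∑ i : Fin (2 ^ (k + 1)), ∑ j : Fin (2 ^ (k + 1)),
        μ.real {ω | √(2 ^ k) < ‖Y i j ω‖} :=
      (measureReal_iUnion_fintype_le _).trans (Finset.sum_le_sum fun i _ =>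
        measureReal_iUnion_fintype_le _)
    refine h2.trans ?_
    rw [one_div, inv_mul_le_iff₀ (by positivity)] at h1
    refine h1.trans ?_
    have h3 : K * ζ.real {z | √(2 ^ k) < |z|} ≤ |K| * ζ.real {z | √(2 ^ k) < |z|} :=
      mul_le_mul_of_nonneg_right (le_abs_self K) measureReal_nonneg
    have h4 : (((2 ^ (k + 1) : ℕ) : ℝ)) ^ 2 = 4 * 4 ^ k := by
      push_cast
      rw [← pow_mul, mul_comm (k + 1), pow_mul, pow_succ]
      norm_num
      ring
    rw [h4]
    calc _ ≤ 4 * 4 ^ k * (|K| * ζ.real {z | √(2 ^ k) < |z|}) :=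
          mul_le_mul_of_nonneg_left h3 (by positivity)
      _ = _ := by ring
  have hsum : ∑' k, μ (E (k + k₀)) ≠ ⊤ := by
    have h1 := ((summable_nat_add_iff k₀).2 ((summable_four_pow_mul_tail ζ hζ).mul_left (4 * |K|)))
    refine ne_top_of_le_ne_top h1.tsum_ofReal_ne_top (ENNReal.tsum_le_tsum fun k => ?_)
    rw [← ofReal_measureReal]
    exact ENNReal.ofReal_le_ofReal (hbound _ (Nat.le_add_left _ _))
  filter_upwards [ae_eventually_notMem hsum] with ω hω
  obtain ⟨k₁, hk₁⟩ := eventually_atTop.1 hω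
  filter_upwards [eventually_ge_atTop (2 ^ (k₁ + k₀))] with n hn i j
  have hn0 : n ≠ 0 := by have : 0 < 2 ^ (k₁ + k₀) := by positivity
                         omega
  have hlog : k₁ + k₀ ≤ Nat.log 2 n := Nat.le_log_of_pow_le one_lt_two hn
  have h1 := hk₁ (Nat.log 2 n - k₀) (by omega)
  rw [Nat.sub_add_cancel (by omega)] at h1
  have hlt : n < 2 ^ (Nat.log 2 n + 1) := Nat.lt_pow_succ_log_self one_lt_two n
  have h2 : ¬ √(2 ^ Nat.log 2 n) < ‖Y i j ω‖ := fun hcon => h1 (Set.mem_iUnion.2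
    ⟨⟨i, i.2.trans hlt⟩, Set.mem_iUnion.2 ⟨⟨j, j.2.trans hlt⟩, hcon⟩⟩)
  refine (not_lt.1 h2).trans (Real.sqrt_le_sqrt ?_)
  exact_mod_cast Nat.pow_log_le_self 2 hn0

end BorelCantelli

end NCProb


namespace NCProb

/-! ### The truncated Wigner ensemble -/

section WignerEnsemble

open Matrix

variable {Ω : Type*} [MeasurableSpace Ω] {r n : ℕ}

/-- The mean of the normalized truncated entry `(i, j)`, the truncation level being `√n`. -/
noncomputable def truncMean (μ : Measure Ω) (X : Fin r → ℕ → ℕ → Ω → ℂ) (n : ℕ) (v : Fin r) :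
    Matrix (Fin n) (Fin n) ℂ :=
  of fun i j => (√n : ℂ)⁻¹ * ∫ ω, trunc √n (X v i j ω) ∂μ

/-- The truncated, centred and normalized entry `(i, j)`. -/
noncomputable def truncEntry (μ : Measure Ω) (X : Fin r → ℕ → ℕ → Ω → ℂ) (n : ℕ) (v : Fin r)
    (i j : Fin n) (ω : Ω) : ℂ :=
  (√n : ℂ)⁻¹ * (trunc √n (X v i j ω) - ∫ ω', trunc √n (X v i j ω') ∂μ)

/-- The truncated, centred and normalized entries on and above the diagonal. -/
noncomputable def truncCoord (μ : Measure Ω) (X : Fin r → ℕ → ℕ → Ω → ℂ) (n : ℕ) (ω : Ω) :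
    Edge r n → ℂ :=
  fun e => truncEntry μ X n e.1.1 e.1.2.1 e.1.2.2 ω

variable {μ : Measure Ω} {X : Fin r → ℕ → ℕ → Ω → ℂ}

theorem measurable_truncEntry (hX : IsWignerFamily μ X) (v : Fin r) (i j : Fin n) :
    Measurable (truncEntry μ X n v i j) :=
  (((measurable_trunc _).comp (hX.measurable v i j)).sub_const _).const_mul _

theorem measurable_truncCoord (hX : IsWignerFamily μ X) : Measurable (truncCoord μ X n) :=
  measurable_pi_lambda _ fun _ => measurable_truncEntry hX _ _ _

theorem star_truncEntry (hX : IsWignerFamily μ X) (v : Fin r) (i j : Fin n) (ω : Ω) :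
    star (truncEntry μ X n v i j ω) = truncEntry μ X n v j i ω := by
  have e : ∀ ω, trunc √n (X v j i ω) = star (trunc √n (X v i j ω)) := fun ω => by
    rw [hX.hermitian v i j ω, trunc_star]
  rw [truncEntry, truncEntry]
  simp_rw [e, Complex.star_def]
  rw [integral_conj]
  simp

theorem hermitianOf_truncCoord (hX : IsWignerFamily μ X) (v : Fin r) (i j : Fin n) (ω : Ω) :
    hermitianOf (truncCoord μ X n ω) v i j = truncEntry μ X n v i j ω := by
  rcases lt_trichotomy i j with h | h | h
  · simp [hermitianOf, entry, edge, h, h.le, truncCoord]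
  · subst h
    simp only [hermitianOf, entry, edge, truncCoord, of_apply, lt_self_iff_false, if_false, le_refl]
    exact Complex.conj_eq_iff_re.1 (star_truncEntry hX v i i ω)
  · rw [← star_truncEntry hX]
    simp [hermitianOf, entry, edge, h, h.not_gt, h.not_ge, truncCoord]

/-- If truncation does not change the corner, then the normalized corner is the sum of its
centred part and of the means. -/
theorem inv_sqrt_smul_corner_eq (hX : IsWignerFamily μ X) (v : Fin r) {ω : Ω}
    (h : ∀ i j : Fin n, ‖X v i j ω‖ ≤ √n) :
    (√n : ℂ)⁻¹ • corner (X v) n ω =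
      hermitianOf (truncCoord μ X n ω) v + truncMean μ X n v := by
  ext i j
  rw [Matrix.add_apply, hermitianOf_truncCoord hX, truncEntry, trunc_of_le (h i j), truncMean,
    Matrix.smul_apply, corner, of_apply, of_apply, smul_eq_mul]
  ring

variable [IsProbabilityMeasure μ]

/-- The coordinates are independent. -/
theorem map_truncCoord (hX : IsWignerFamily μ X) : μ.map (truncCoord μ X n) =
    Measure.pi fun e : Edge r n => μ.map (truncEntry μ X n e.1.1 e.1.2.1 e.1.2.2) := by
  have h1 := hX.indep.precomp (g := fun e : Edge r n =>
    (⟨(e.1.1, (e.1.2.1 : ℕ), (e.1.2.2 : ℕ)), e.2⟩ : {q : Fin r × ℕ × ℕ // q.2.1 ≤ q.2.2})) (by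
      rintro ⟨⟨v, i, j⟩, h⟩ ⟨⟨v', i', j'⟩, h'⟩ heq
      simp only [Subtype.mk.injEq, Prod.mk.injEq, Fin.val_inj] at heq ⊢
      exact heq)
  have h2 := h1.comp (fun e y => (√n : ℂ)⁻¹ *
    (trunc √n y - ∫ ω', trunc √n (X e.1.1 e.1.2.1 e.1.2.2 ω') ∂μ)) fun e =>
      ((measurable_trunc _).sub_const _).const_mul _
  exact (iIndepFun_iff_map_fun_eq_pi_map fun e =>
    (measurable_truncEntry hX _ _ _).aemeasurable).1 h2

theorem integral_truncEntry (hX : IsWignerFamily μ X) (v : Fin r) (i j : Fin n) :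
    ∫ ω, truncEntry μ X n v i j ω ∂μ = 0 := by
  simp_rw [truncEntry]
  rw [integral_const_mul, integral_sub (integrable_trunc (hX.measurable v i j) (Real.sqrt_nonneg _))
    (integrable_const _), integral_const, probReal_univ, one_smul, sub_self, mul_zero]

omit [IsProbabilityMeasure μ] in
theorem norm_truncEntry (v : Fin r) (i j : Fin n) (ω : Ω) :
    ‖truncEntry μ X n v i j ω‖ =
      ‖trunc √n (X v i j ω) - ∫ ω', trunc √n (X v i j ω') ∂μ‖ / √n := by
  rw [truncEntry, norm_mul, norm_inv, Complex.norm_real, Real.norm_of_nonneg (Real.sqrt_nonneg _)]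
  ring

theorem norm_truncEntry_le (hX : IsWignerFamily μ X) (v : Fin r) (i j : Fin n) (ω : Ω) :
    ‖truncEntry μ X n v i j ω‖ ≤ 2 := by
  have hn : 1 ≤ n := i.pos
  have hn : (1 : ℝ) ≤ √n := Real.one_le_sqrt.2 (by exact_mod_cast hn)
  rw [norm_truncEntry, div_le_iff₀ (by linarith)]
  have h1 := norm_sub_le (trunc √n (X v i j ω)) (∫ ω', trunc √n (X v i j ω') ∂μ)
  have h2 := norm_trunc_le (Real.sqrt_nonneg n) (X v i j ω)
  have h3 := norm_integral_trunc_le_one (hX.measurable v i j) (Real.sqrt_nonneg n)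
    (hX.memLp v i j) (hX.variance v i j)
  linarith

theorem integral_norm_truncEntry_sq (hX : IsWignerFamily μ X) (v : Fin r) (i j : Fin n) :
    ∫ ω, ‖truncEntry μ X n v i j ω‖ ^ 2 ∂μ =
      (∫ ω, ‖trunc √n (X v i j ω)‖ ^ 2 ∂μ - ‖∫ ω, trunc √n (X v i j ω) ∂μ‖ ^ 2) / n := by
  have hm := (measurable_trunc √n).comp (hX.measurable v i j)
  have h2 : Integrable (fun ω => ‖trunc √n (X v i j ω)‖ ^ 2) μ :=
    integrable_of_norm_le (C := √n ^ 2) (hm.norm.pow_const 2).aestronglyMeasurable fun ω => by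
      rw [Real.norm_of_nonneg (by positivity)]
      exact pow_le_pow_left₀ (norm_nonneg _) (norm_trunc_le (Real.sqrt_nonneg _) _) 2
  simp_rw [norm_truncEntry, div_pow, Real.sq_sqrt (Nat.cast_nonneg n)]
  rw [integral_div, integral_norm_sub_mean_sq
    (integrable_trunc (hX.measurable v i j) (Real.sqrt_nonneg _)) h2]

theorem integral_norm_truncEntry_sq_le (hX : IsWignerFamily μ X) (v : Fin r) (i j : Fin n) :
    ∫ ω, ‖truncEntry μ X n v i j ω‖ ^ 2 ∂μ ≤ 1 / n := by
  rw [integral_norm_truncEntry_sq hX, ← hX.variance v i j]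
  refine div_le_div_of_nonneg_right ?_ (Nat.cast_nonneg n)
  have hm := (measurable_trunc √n).comp (hX.measurable v i j)
  have h2 : Integrable (fun ω => ‖X v i j ω‖ ^ 2) μ := (hX.memLp v i j).norm.integrable_sq
  have h3 : ∫ ω, ‖trunc √n (X v i j ω)‖ ^ 2 ∂μ ≤ ∫ ω, ‖X v i j ω‖ ^ 2 ∂μ :=
    integral_mono_of_nonneg (Eventually.of_forall fun ω => by positivity) h2
      (Eventually.of_forall fun ω => pow_le_pow_left₀ (norm_nonneg _) (norm_trunc_le_norm _) 2)
  nlinarith [sq_nonneg ‖∫ ω, trunc √n (X v i j ω) ∂μ‖]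

/-- The third absolute moments of the entries off the diagonal are at most `θ₀`. -/
def CubeBound (μ : Measure Ω) (X : Fin r → ℕ → ℕ → Ω → ℂ) (θ₀ : ℝ) : Prop :=
  ∀ v i j, i ≠ j → Integrable (fun ω => ‖X v i j ω‖ ^ 3) μ ∧ ∫ ω, ‖X v i j ω‖ ^ 3 ∂μ ≤ θ₀

omit [IsProbabilityMeasure μ] in
theorem exists_cubeBound (hX : IsWignerFamily μ X) (h : ∀ v, HasBoundedThirdMoments μ (X v)) :
    ∃ θ₀ : ℝ, 0 ≤ θ₀ ∧ CubeBound μ X θ₀ := by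
  choose θ hθ using h
  have hlt : ∀ v i j, i < j → Integrable (fun ω => ‖X v i j ω‖ ^ 3) μ ∧
      ∫ ω, ‖X v i j ω‖ ^ 3 ∂μ ≤ ∑ v, (θ v : ℝ) := by
    intro v i j hij
    have hm : AEStronglyMeasurable (fun ω => ‖X v i j ω‖ ^ 3) μ :=
      ((hX.measurable v i j).norm.pow_const 3).aestronglyMeasurable
    have e : ∫⁻ ω, ‖‖X v i j ω‖ ^ 3‖ₑ ∂μ ≤ θ v := by simpa [enorm_pow] using hθ v i j hij
    have hi : Integrable (fun ω => ‖X v i j ω‖ ^ 3) μ := ⟨hm, e.trans_lt ENNReal.coe_lt_top⟩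
    refine ⟨hi, ?_⟩
    have h1 : ∫ ω, ‖X v i j ω‖ ^ 3 ∂μ ≤ θ v := by
      rw [integral_eq_lintegral_of_nonneg_ae (Eventually.of_forall fun ω => by positivity) hm]
      refine ENNReal.toReal_le_coe_of_le_coe (le_trans (le_of_eq ?_) e)
      refine lintegral_congr fun ω => ?_
      rw [← ofReal_norm, Real.norm_of_nonneg (by positivity)]
    exact h1.trans (Finset.single_le_sum (f := fun v => (θ v : ℝ))
      (fun v _ => (θ v).coe_nonneg) (Finset.mem_univ v))
  refine ⟨∑ v, (θ v : ℝ), Finset.sum_nonneg fun v _ => (θ v).coe_nonneg, fun v i j hij => ?_⟩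
  rcases lt_or_gt_of_ne hij with h | h
  · exact hlt v i j h
  · simpa [hX.hermitian v j i] using hlt v j i h

variable {θ₀ : ℝ}

theorem norm_integral_trunc_le_of_ne (hX : IsWignerFamily μ X) (hc : CubeBound μ X θ₀)
    (v : Fin r) {i j : Fin n} (hij : i ≠ j) : ‖∫ ω, trunc √n (X v i j ω) ∂μ‖ ≤ θ₀ / n := by
  have hn : (0 : ℝ) < n := by exact_mod_cast i.pos
  obtain ⟨h1, h2⟩ := hc v i j (Fin.val_ne_of_ne hij)
  have h := norm_integral_trunc_le (T := √n) (hX.measurable v i j) (Real.sqrt_pos.2 hn)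
    ((hX.memLp v i j).integrable (by norm_num)) (hX.centred v i j) (k := 2) h1
  rw [Real.sq_sqrt hn.le] at h
  exact h.trans (div_le_div_of_nonneg_right h2 hn.le)

theorem inv_sub_integral_norm_truncEntry_sq_le (hX : IsWignerFamily μ X) (hc : CubeBound μ X θ₀)
    (hθ₀ : 0 ≤ θ₀) (v : Fin r) {i j : Fin n} (hij : i ≠ j) :
    1 / n - ∫ ω, ‖truncEntry μ X n v i j ω‖ ^ 2 ∂μ ≤ 2 * θ₀ / (n * √n) := by
  have hn : (0 : ℝ) < n := by exact_mod_cast i.pos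
  have hn1 : (1 : ℝ) ≤ n := by exact_mod_cast i.pos
  have hs : 0 < √(n : ℝ) := Real.sqrt_pos.2 hn
  have hsn : √(n : ℝ) ≤ n := Real.sqrt_le_iff.2 ⟨hn.le, by nlinarith⟩
  obtain ⟨h1, h2⟩ := hc v i j (Fin.val_ne_of_ne hij)
  have h3 := one_sub_integral_trunc_sq_le (hX.measurable v i j) hs (hX.memLp v i j)
    (hX.variance v i j) h1
  have h4 := norm_integral_trunc_le_of_ne hX hc v hij
  have h5 := norm_integral_trunc_le_one (hX.measurable v i j) hs.le (hX.memLp v i j)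
    (hX.variance v i j)
  have h6 : ‖∫ ω, trunc √n (X v i j ω) ∂μ‖ ^ 2 ≤ θ₀ / √n := by
    have : θ₀ / n ≤ θ₀ / √n := div_le_div_of_nonneg_left hθ₀ hs hsn
    nlinarith [norm_nonneg (∫ ω, trunc √n (X v i j ω) ∂μ)]
  have h7 : (∫ ω, ‖X v i j ω‖ ^ 3 ∂μ) / √n ≤ θ₀ / √n := div_le_div_of_nonneg_right h2 hs.le
  rw [integral_norm_truncEntry_sq hX, ← sub_div, mul_comm (n : ℝ), ← div_div]
  refine div_le_div_of_nonneg_right ?_ hn.le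
  rw [two_mul, add_div]
  linarith

theorem integral_norm_truncEntry_cube_le (hX : IsWignerFamily μ X) (hc : CubeBound μ X θ₀)
    (v : Fin r) {i j : Fin n} (hij : i ≠ j) :
    ∫ ω, ‖truncEntry μ X n v i j ω‖ ^ 3 ∂μ ≤ 4 * (θ₀ + 1) / (n * √n) := by
  have hn : (0 : ℝ) < n := by exact_mod_cast i.pos
  have hs : 0 < √(n : ℝ) := Real.sqrt_pos.2 hn
  obtain ⟨h1, h2⟩ := hc v i j (Fin.val_ne_of_ne hij)
  have h5 := norm_integral_trunc_le_one (hX.measurable v i j) hs.le (hX.memLp v i j)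
    (hX.variance v i j)
  have e3 : √(n : ℝ) ^ 3 = n * √n := by rw [pow_succ, Real.sq_sqrt hn.le]
  simp_rw [norm_truncEntry, div_pow, e3]
  rw [integral_div]
  refine div_le_div_of_nonneg_right ?_ (by positivity)
  have h6 : ∫ ω, 4 * (‖X v i j ω‖ ^ 3 + 1) ∂μ ≤ 4 * (θ₀ + 1) := by
    rw [integral_const_mul, integral_add h1 (integrable_const _), integral_const, probReal_univ,
      one_smul]
    linarith
  refine le_trans (integral_mono_of_nonneg (Eventually.of_forall fun ω => by positivity)
    ((h1.add (integrable_const 1)).const_mul 4) (Eventually.of_forall fun ω => ?_)) h6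
  -- convexity: `(a + b) ^ 3 ≤ 4 * (a ^ 3 + b ^ 3)`
  have h7 : ‖trunc √n (X v i j ω) - ∫ ω', trunc √n (X v i j ω') ∂μ‖ ≤ ‖X v i j ω‖ + 1 :=
    (norm_sub_le _ _).trans (add_le_add (norm_trunc_le_norm _) h5)
  refine (pow_le_pow_left₀ (norm_nonneg _) h7 3).trans ?_
  have h8 := norm_nonneg (X v i j ω)
  change _ ≤ 4 * (‖X v i j ω‖ ^ 3 + 1)
  nlinarith [mul_nonneg (add_nonneg h8 zero_le_one) (sq_nonneg (‖X v i j ω‖ - 1))]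

/-- The law of the truncated Wigner matrices, together with deterministic matrices `B`. -/
noncomputable def wignerEnsemble {β : Type*} {θ : ℝ} (hX : IsWignerFamily μ X)
    (hc : CubeBound μ X θ₀) (hθ₀ : 0 ≤ θ₀) (hθ : 4 * (θ₀ + 1) ≤ θ)
    (B : β → Matrix (Fin n) (Fin n) ℂ) (hB : ∀ b k, absMoment k (B b) ≤ n * θ ^ (2 * k)) :
    Ensemble r β θ n where
  ν e := μ.map (truncEntry μ X n e.1.1 e.1.2.1 e.1.2.2)
  prob e := Measure.isProbabilityMeasure_map (measurable_truncEntry hX _ _ _).aemeasurable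
  norm_le e := by
    rw [ae_map_iff (measurable_truncEntry hX _ _ _).aemeasurable
      (measurableSet_le measurable_norm measurable_const)]
    exact Eventually.of_forall fun ω => norm_truncEntry_le hX _ _ _ _
  centred e := by
    rw [integral_map (measurable_truncEntry hX _ _ _).aemeasurable (by fun_prop)]
    exact integral_truncEntry hX _ _ _
  sq_le e := by
    rw [integral_map (measurable_truncEntry hX _ _ _).aemeasurable (by fun_prop)]
    exact integral_norm_truncEntry_sq_le hX _ _ _
  sq_ge e he := by
    rw [integral_map (measurable_truncEntry hX _ _ _).aemeasurable (by fun_prop)]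
    exact (inv_sub_integral_norm_truncEntry_sq_le hX hc hθ₀ _ he.ne).trans
      (div_le_div_of_nonneg_right (by linarith) (by positivity))
  cube_le e he := by
    rw [integral_map (measurable_truncEntry hX _ _ _).aemeasurable (by fun_prop)]
    exact (integral_norm_truncEntry_cube_le hX hc _ he.ne).trans
      (div_le_div_of_nonneg_right hθ (by positivity))
  B := B
  absMoment_le := hB

theorem map_truncCoord_eq_law {β : Type*} {θ : ℝ} (hX : IsWignerFamily μ X)
    (hc : CubeBound μ X θ₀) (hθ₀ : 0 ≤ θ₀) (hθ : 4 * (θ₀ + 1) ≤ θ)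
    (B : β → Matrix (Fin n) (Fin n) ℂ) (hB : ∀ b k, absMoment k (B b) ≤ n * θ ^ (2 * k)) :
    μ.map (truncCoord μ X n) = (wignerEnsemble hX hc hθ₀ hθ B hB).law := map_truncCoord hX

/-- The matrices of means are asymptotically negligible, in spectral norm. -/
theorem matrixSpectralNorm_truncMean_le (hX : IsWignerFamily μ X) (hc : CubeBound μ X θ₀)
    (v : Fin r) : matrixSpectralNorm (truncMean μ X n v) ≤ √(θ₀ ^ 2 + 1) / √n := by
  rcases Nat.eq_zero_or_pos n with rfl | hn
  · refine (matrixSpectralNorm_le_sqrt _).trans ?_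
    simp
  have hn : (0 : ℝ) < n := by exact_mod_cast hn
  have hs : 0 < √(n : ℝ) := Real.sqrt_pos.2 hn
  rw [← Real.sqrt_div (by positivity)]
  refine (matrixSpectralNorm_le_sqrt _).trans (Real.sqrt_le_sqrt ?_)
  have hent : ∀ i j : Fin n, ‖truncMean μ X n v i j‖ ^ 2 ≤
      θ₀ ^ 2 / n ^ 3 + if i = j then 1 / (n : ℝ) ^ 2 else 0 := by
    intro i j
    have e : ‖truncMean μ X n v i j‖ ^ 2 = ‖∫ ω, trunc √n (X v i j ω) ∂μ‖ ^ 2 / n := by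
      rw [truncMean, of_apply, norm_mul, norm_inv, Complex.norm_real,
        Real.norm_of_nonneg hs.le, mul_pow, inv_pow, Real.sq_sqrt hn.le]
      ring
    rw [e]
    split_ifs with h
    · have h1 := norm_integral_trunc_le (T := √n) (hX.measurable v i j) hs
        ((hX.memLp v i j).integrable (by norm_num)) (hX.centred v i j) (k := 1)
        (hX.memLp v i j).norm.integrable_sq
      rw [hX.variance v i j, pow_one] at h1
      have h2 := pow_le_pow_left₀ (norm_nonneg _) h1 2
      rw [div_pow, one_pow, Real.sq_sqrt hn.le] at h2
      have h3 := div_le_div_of_nonneg_right h2 hn.le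
      rw [div_div, ← sq] at h3
      have : 0 ≤ θ₀ ^ 2 / (n : ℝ) ^ 3 := by positivity
      linarith
    · have h2 := pow_le_pow_left₀ (norm_nonneg _) (norm_integral_trunc_le_of_ne hX hc v h) 2
      have h3 := div_le_div_of_nonneg_right h2 hn.le
      rw [div_pow, div_div, ← pow_succ] at h3
      simpa using h3
  refine (Finset.sum_le_sum fun i _ => Finset.sum_le_sum fun j _ => hent i j).trans (le_of_eq ?_)
  simp only [Finset.sum_add_distrib, Finset.sum_const, Finset.card_univ, Fintype.card_fin,
    nsmul_eq_mul, Finset.sum_ite_eq, Finset.mem_univ, if_true]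
  field_simp

end WignerEnsemble

end NCProb


namespace NCProb

/-! ### Convergence in distribution -/

section Assembly

open Matrix

variable {r t : ℕ}

/-- The deterministic letters: the given matrices, their adjoints, and the matrices of means
of the truncated Wigner matrices. -/
abbrev DetLetter (r t : ℕ) : Type := (Fin t ⊕ Fin t) ⊕ Fin r

/-- The substitution that expresses a polynomial in the normalized Wigner matrices `Y v + D v`, in
the matrices `A u` and in the adjoints of all of these as a polynomial in the letters `Y v`, `A u`,
`(A u)*`, `D v`; the matrices `Y v` and `D v` are Hermitian. -/
noncomputable def centringSubst (r t : ℕ) :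
    FreeAlgebra ℂ ((Fin r ⊕ Fin t) ⊕ (Fin r ⊕ Fin t)) →ₐ[ℂ] FreeAlgebra ℂ (Fin r ⊕ DetLetter r t) :=
  FreeAlgebra.lift ℂ (Sum.elim
    (Sum.elim (fun v => FreeAlgebra.ι ℂ (Sum.inl v) + FreeAlgebra.ι ℂ (Sum.inr (Sum.inr v)))
      (fun u => FreeAlgebra.ι ℂ (Sum.inr (Sum.inl (Sum.inl u)))))
    (Sum.elim (fun v => FreeAlgebra.ι ℂ (Sum.inl v) + FreeAlgebra.ι ℂ (Sum.inr (Sum.inr v)))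
      (fun u => FreeAlgebra.ι ℂ (Sum.inr (Sum.inl (Sum.inr u))))))

theorem polyEval_eq_lift_centringSubst {R : Type*} [Ring R] [StarRing R] [Algebra ℂ R]
    {x y d : Fin r → R} {a : Fin t → R} (hx : ∀ v, star (x v) = x v) (hxyd : ∀ v, x v = y v + d v)
    (P : FreeAlgebra ℂ ((Fin r ⊕ Fin t) ⊕ (Fin r ⊕ Fin t))) :
    polyEval (Sum.elim x a) P = FreeAlgebra.lift ℂ
      (Sum.elim y (Sum.elim (Sum.elim a fun u => star (a u)) d)) (centringSubst r t P) := by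
  have h : polyEval (Sum.elim x a) = (FreeAlgebra.lift ℂ
      (Sum.elim y (Sum.elim (Sum.elim a fun u => star (a u)) d))).comp (centringSubst r t) := by
    refine FreeAlgebra.hom_ext (funext ?_)
    rintro ((v | u) | (v | u)) <;> simp [polyEval, centringSubst, hx, ← hxyd]
  rw [h]
  rfl

/-- Convergence of a linear functional on all words gives convergence on all polynomials. -/
theorem tendsto_lift_of_tendsto_evalWord {α : Type*} {R : ℕ → Type*} [∀ n, Ring (R n)]
    [∀ n, Algebra ℂ (R n)] {S : Type*} [Ring S] [Algebra ℂ S] (φ : ∀ n, R n →ₗ[ℂ] ℂ)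
    (ψ : S →ₗ[ℂ] ℂ) (M : ∀ n, α → R n) (g : α → S)
    (h : ∀ w, Tendsto (fun n => φ n (evalWord (M n) w)) atTop (𝓝 (ψ (evalWord g w))))
    (Q : FreeAlgebra ℂ α) :
    Tendsto (fun n => φ n (FreeAlgebra.lift ℂ (M n) Q)) atTop
      (𝓝 (ψ (FreeAlgebra.lift ℂ g Q))) := by
  have hQ : Q ∈ Submodule.span ℂ (Set.range (monomialWord (α := α))) :=
    span_range_monomialWord (α := α) ▸ Submodule.mem_top
  induction hQ using Submodule.span_induction with
  | mem f hf =>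
    obtain ⟨w, rfl⟩ := hf
    simpa [map_monomialWord] using h w
  | zero => simp
  | add f f' _ _ h h' => simpa using h.add h'
  | smul s f _ h => simpa using h.const_mul s

theorem evalWord_eq_zero {R α : Type*} [Ring R] {g : α → R} {w : List α} {c : α} (hc : c ∈ w)
    (h : g c = 0) : evalWord g w = 0 := by
  induction w with
  | nil => simp at hc
  | cons d w ih =>
    rw [evalWord_cons]
    rcases List.mem_cons.1 hc with rfl | hc
    · rw [h, zero_mul]
    · rw [ih hc, mul_zero]

theorem exists_eq_map_inl_or_mem_inr {γ δ : Type*} (w : List (γ ⊕ δ)) :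
    (∃ p : List γ, w = p.map Sum.inl) ∨ ∃ d, Sum.inr d ∈ w := by
  induction w with
  | nil => exact Or.inl ⟨[], rfl⟩
  | cons c w ih =>
    obtain c | d := c
    · obtain ⟨p, rfl⟩ | ⟨d, hd⟩ := ih
      · exact Or.inl ⟨c :: p, rfl⟩
      · exact Or.inr ⟨d, List.mem_cons_of_mem _ hd⟩
    · exact Or.inr ⟨d, List.mem_cons_self⟩

/-- Words in asymptotically bounded matrices, one of which is asymptotically negligible, are
negligible. -/
theorem tendsto_normalizedTrace_evalWord_zero {β : Type*} {θ : ℝ}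
    (B : ∀ n, β → Matrix (Fin n) (Fin n) ℂ) (hB : ∀ n b, matrixSpectralNorm (B n b) ≤ θ) {b : β}
    (hb : Tendsto (fun n => matrixSpectralNorm (B n b)) atTop (𝓝 0)) {p : List β} (hp : b ∈ p) :
    Tendsto (fun n => normalizedTrace n (evalWord (B n) p)) atTop (𝓝 0) := by
  obtain ⟨u, s, rfl⟩ := List.append_of_mem hp
  have hbd : ∀ n, ‖normalizedTrace n (evalWord (B n) (u ++ b :: s))‖ ≤
      θ ^ u.length * (matrixSpectralNorm (B n b) * θ ^ s.length) := by
    intro n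
    have hθ : 0 ≤ θ := (matrixSpectralNorm_nonneg _).trans (hB n b)
    refine (norm_normalizedTrace_le _).trans ?_
    rw [evalWord_append, evalWord_cons]
    refine (matrixSpectralNorm_mul_le _ _).trans (mul_le_mul
      (matrixSpectralNorm_evalWord_le (hB n) u) ((matrixSpectralNorm_mul_le _ _).trans
      (mul_le_mul_of_nonneg_left (matrixSpectralNorm_evalWord_le (hB n) s)
      (matrixSpectralNorm_nonneg _))) (matrixSpectralNorm_nonneg _) (pow_nonneg hθ _))
  refine squeeze_zero_norm hbd ?_
  simpa using (hb.mul_const (θ ^ s.length)).const_mul (θ ^ u.length)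

theorem isHermitian_corner {Ω : Type*} [MeasurableSpace Ω] {μ : Measure Ω}
    {X : Fin r → ℕ → ℕ → Ω → ℂ} (hX : IsWignerFamily μ X) (v : Fin r) (n : ℕ) (ω : Ω) :
    (corner (X v) n ω).IsHermitian := by
  ext i j
  simp [corner, hX.hermitian v j i]

end Assembly

end NCProb

theorem mainTheorem4 {r t : ℕ}
    -- the noncommutative probability space `(𝒜, τ)`
    {𝒜 : Type*} [Ring 𝒜] [StarRing 𝒜] [Algebra ℂ 𝒜] [StarModule ℂ 𝒜]
    (τ : 𝒜 →ₗ[ℂ] ℂ) (hτ : τ 1 = 1)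
    -- the semicircular system `x`, free from `a`
    (x : Fin r → 𝒜) (a : Fin t → 𝒜)
    (hx : NCProb.IsSemicircularSystem τ x)
    (hxa : NCProb.IsFree τ ![Set.range x, Set.range a])
    -- the deterministic matrices
    (A : ∀ n : ℕ, Fin t → Matrix (Fin n) (Fin n) ℂ)
    (hA_herm : ∀ n u, (A n u).IsHermitian)
    (hA_bdd : ∃ C : ℝ, ∀ n u, NCProb.matrixSpectralNorm (A n u) ≤ C)
    (hA_conv : NCProb.ConvergesInDistribution NCProb.normalizedTrace A τ a)
    -- the Wigner matrices
    {Ω : Type*} [MeasurableSpace Ω] (μ : Measure Ω) [IsProbabilityMeasure μ]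
    (X : Fin r → ℕ → ℕ → Ω → ℂ)
    (hX : NCProb.IsWignerFamily μ X)
    (hX_tails : ∀ v, NCProb.HasDominatedTails μ (X v))
    (hX_third : ∀ v, NCProb.HasBoundedThirdMoments μ (X v)) :
    ∀ᵐ ω ∂μ, NCProb.ConvergesInDistribution NCProb.normalizedTrace
      (fun n => Sum.elim
        (fun v : Fin r => ((Real.sqrt n : ℂ)⁻¹) • NCProb.corner (X v) n ω) (A n))
      τ (Sum.elim x a) := by
  classical
  obtain ⟨θ₀, hθ₀, hc⟩ := NCProb.exists_cubeBound hX hX_third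
  obtain ⟨C, hC⟩ := hA_bdd
  obtain ⟨θ, hθ⟩ : ∃ θ, θ = 4 * (θ₀ + 1) + |C| + √(θ₀ ^ 2 + 1) := ⟨_, rfl⟩
  have hθc : 4 * (θ₀ + 1) ≤ θ := by
    have h1 := abs_nonneg C
    have h2 := Real.sqrt_nonneg (θ₀ ^ 2 + 1)
    linarith
  have hθ1 : 1 ≤ θ := by linarith
  -- the deterministic matrices: the `A u`, their adjoints, and the means of the truncations
  obtain ⟨B, hBdef⟩ : ∃ B : ∀ n, NCProb.DetLetter r t → Matrix (Fin n) (Fin n) ℂ,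
      B = fun n => Sum.elim (Sum.elim (A n) fun u => star (A n u)) (NCProb.truncMean μ X n) :=
    ⟨_, rfl⟩
  obtain ⟨b, hbdef⟩ : ∃ b : NCProb.DetLetter r t → 𝒜,
      b = Sum.elim (Sum.elim a fun u => star (a u)) 0 := ⟨_, rfl⟩
  have hD : ∀ n v, NCProb.matrixSpectralNorm (NCProb.truncMean μ X n v) ≤
      √(θ₀ ^ 2 + 1) / √n := fun n v => NCProb.matrixSpectralNorm_truncMean_le hX hc v
  have hnorm : ∀ n c, NCProb.matrixSpectralNorm (B n c) ≤ θ := by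
    have h2 := Real.sqrt_nonneg (θ₀ ^ 2 + 1)
    have hA : ∀ n u, NCProb.matrixSpectralNorm (A n u) ≤ θ := fun n u => by
      have h1 := (hC n u).trans (le_abs_self C)
      linarith
    intro n c
    subst hBdef
    rcases c with (u | u) | v
    · exact hA n u
    · exact (NCProb.matrixSpectralNorm_conjTranspose (A n u)).trans_le (hA n u)
    · refine (hD n v).trans ?_
      have h1 := abs_nonneg C
      rcases Nat.eq_zero_or_pos n with rfl | hn
      · simp only [Nat.cast_zero, Real.sqrt_zero, div_zero]
        linarith
      · have hs : 1 ≤ √(n : ℝ) := Real.one_le_sqrt.2 (by exact_mod_cast hn)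
        have h3 := div_le_self h2 hs
        linarith
  have hmom : ∀ n c k, NCProb.absMoment k (B n c) ≤ n * θ ^ (2 * k) := fun n c k =>
    (NCProb.absMoment_le_matrixSpectralNorm _ k).trans (mul_le_mul_of_nonneg_left
      (pow_le_pow_left₀ (NCProb.matrixSpectralNorm_nonneg _) (hnorm n c) _) (Nat.cast_nonneg _))
  have hb : ∀ c, b c ∈ StarAlgebra.adjoin ℂ (Set.range a) := by
    subst hbdef
    have ha : ∀ u, a u ∈ StarAlgebra.adjoin ℂ (Set.range a) := fun u =>
      StarAlgebra.subset_adjoin ℂ _ ⟨u, rfl⟩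
    rintro ((u | u) | v)
    · exact ha u
    · exact star_mem (ha u)
    · exact zero_mem _
  have hB : ∀ p : List (NCProb.DetLetter r t),
      Tendsto (fun n => NCProb.normalizedTrace n (NCProb.evalWord (B n) p)) atTop
        (𝓝 (τ (NCProb.evalWord b p))) := by
    intro p
    obtain ⟨p, rfl⟩ | ⟨v, hv⟩ := NCProb.exists_eq_map_inl_or_mem_inr p
    · subst hBdef hbdef
      have h := hA_conv (NCProb.monomialWord p)
      simp only [NCProb.ncDistribution, NCProb.polyEval, LinearMap.comp_apply,
        AlgHom.toLinearMap_apply, NCProb.map_monomialWord, FreeAlgebra.lift_ι_apply] at h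
      simpa [NCProb.evalWord, Function.comp_def] using h
    · rw [NCProb.evalWord_eq_zero hv (by simp [hbdef]), map_zero]
      refine NCProb.tendsto_normalizedTrace_evalWord_zero B hnorm ?_ hv
      subst hBdef
      exact squeeze_zero (fun n => NCProb.matrixSpectralNorm_nonneg _) (fun n => hD n v)
        (NCProb.tendsto_const_div_sqrt _)
  have hconv := NCProb.ae_tendsto_ntr hθ1 hτ hx hxa hb
    (fun n => NCProb.wignerEnsemble hX hc hθ₀ hθc (B n) (hmom n)) hB
    (fun n => NCProb.measurable_truncCoord (n := n) hX)
    (fun n => NCProb.map_truncCoord_eq_law hX hc hθ₀ hθc (B n) (hmom n))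
  have htrunc := ae_all_iff.2 fun v => (hX_tails v).ae_eventually_norm_le
  filter_upwards [hconv, htrunc] with ω hω htω P
  have hlim := NCProb.tendsto_lift_of_tendsto_evalWord (fun n => NCProb.normalizedTrace n) τ
    (fun n => NCProb.letters (B n) (NCProb.truncCoord μ X n ω)) (Sum.elim x b) hω
    (NCProb.centringSubst r t P)
  have hlimit : NCProb.ncDistribution τ (Sum.elim x a) P =
      τ (FreeAlgebra.lift ℂ (Sum.elim x b) (NCProb.centringSubst r t P)) := by
    rw [hbdef]
    exact congrArg τ (NCProb.polyEval_eq_lift_centringSubst hx.selfAdjoint (by simp) P)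
  rw [hlimit]
  refine hlim.congr' ?_
  filter_upwards [eventually_all.2 htω] with n hn
  subst hBdef
  refine congrArg (NCProb.normalizedTrace n) (NCProb.polyEval_eq_lift_centringSubst
    (fun v => ?_) (fun v => NCProb.inv_sqrt_smul_corner_eq hX v (hn v)) P).symm
  rw [star_smul, Matrix.star_eq_conjTranspose, (NCProb.isHermitian_corner hX v n ω).eq]
  simp
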